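/- **Setting.** Let $\Omega\subset\mathbb R^2$ be a bounded (Lipschitz) polygonal domain. Let $\mathscr T_h$ be a geometrically conforming simplicial triangulation of $\Omega$ that is shape regular with parameter $\sigma$: $h_K\le\sigma\rho_K$ for every triangle $K\in\mathscr T_h$, where $h_K$ is the diameter of $K$ and $\rho_K$ the diameter of the largest disc contained in $K$. Put $h=\max_K h_K$, let $\mathscr E_h$ be the set of edges of the triangles, $|e|$ the length of an edge $e$, and $$Z_h=\{v\in C(\overline\Omega): v|_K\in P_2(K)\ \ \forall K\in\mathscr T_h\}.$$ For an interior edge $e$ shared by $K_\pm$, with unit normal $n_e$ pointing from $K_-$ to $K_+$ and $v_\pm=v|_{K_\pm}$, set $$\Big[\!\!\Big[\tfrac{\partial v}{\partial n_e}\Big]\!\!\Big]=n_e\cdot(\nabla v_+-\nabla v_-),\qquad \Big\{\!\!\Big\{\tfrac{\partial^2 v}{\partial n_e^2}\Big\}\!\!\Big\}=\tfrac12\,n_e\cdot(\nabla^2v_-+\nabla^2v_+)\,n_e;$$ for a boundary edge $e$ of $K$, with $n_e$ the outward unit normal, set $[\![\partial v/\partial n_e]\!]=-n_e\cdot\nabla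 v_K$ and $\{\!\{\partial^2v/\partial n_e^2\}\!\}=n_e\cdot(\nabla^2v_K)\,n_e$. For a penalty parameter $\alpha\ge1$ let $$a_h(w,v)=\sum_{K\in\mathscr T_h}\int_K\nabla^2w:\nabla^2v\,dx+\sum_{e\in\mathscr E_h}\int_e\Big\{\!\!\Big\{\tfrac{\partial^2 w}{\partial n_e^2}\Big\}\!\!\Big\}\Big[\!\!\Big[\tfrac{\partial v}{\partial n_e}\Big]\!\!\Big]dS+\sum_{e\in\mathscr E_h}\int_e\Big\{\!\!\Big\{\tfrac{\partial^2 v}{\partial n_e^2}\Big\}\!\!\Big\}\Big[\!\!\Big[\tfrac{\partial w}{\partial n_e}\Big]\!\!\Big]dS+\alpha\sum_{e\in\mathscr E_h}\frac1{|e|}\int_e\Big[\!\!\Big[\tfrac{\partial w}{\partial n_e}\Big]\!\!\Big]\Big[\!\!\Big[\tfrac{\partial v}{\partial n_e}\Big]\!\!\Big]dS,$$ $$\|v\|_{2,h}^2=\sum_{K\in\mathscr T_h}|v|_{H^2(K)}^2+\sum_{e\in\mathscr E_h}\frac{\alpha}{|e|}\Big\|\Big[\!\!\Big[\tfrac{\partial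 v}{\partial n_e}\Big]\!\!\Big]\Big\|_{L^2(e)}^2 .$$ For $\varepsilon<1$ and $u\in H^3(\Omega)$, the Ritz projection $P_hu\in Z_h$ is defined by $$a_h(P_hu-u,\xi)+(1-\varepsilon)(P_hu-u,\xi)_{L^2(\Omega)}=0\quad\forall\,\xi\in Z_h,\qquad (P_hu-u,1)_{L^2(\Omega)}=0 .$$ **Lemma.** For every $\sigma$ there is $\alpha_0\ge1$, depending only on $\sigma$, such that for all $\alpha\ge\alpha_0$, all $\varepsilon<1$ and every bounded polygonal domain $\Omega$ there is a constant $C>0$, depending only on $\sigma,\alpha,\varepsilon,\Omega$, with the following property. Let $\mathscr T_h$ be a triangulation of $\Omega$ that is shape regular with parameter $\sigma$, let $f\in L^2(\Omega)$, and let $u\in H^3(\Omega)$ solve $$\Delta^2u+(1-\varepsilon)u=f\ \text{ in }\Omega,\qquad \frac{\partial u}{\partial n}=\frac{\partial\Delta u}{\partial n}=0\ \text{ on }\partial\Omega$$ (the equation in the sense of distributions, the boundary conditions in the sense of vanishing normal traces of $\nabla u$ and $\nabla\Delta u$). Then $P_hu$ exists, is unique, and satisfies $$\|u-P_hu\|_{2,h}\le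 C\,h\,\|u\|_{H^3(\Omega)} .$$ -/

import Mathlib

open MeasureTheory Filter Topology Set
open scoped ContDiff

noncomputable section

namespace C0IP

/-- The Euclidean plane. -/
abbrev Plane : Type := EuclideanSpace ℝ (Fin 2)

/-! ### Weak derivatives and Sobolev spaces on open subsets of the plane -/

/-- The classical partial derivative `∂ᵢ φ`. -/
def pd (i : Fin 2) (φ : Plane → ℝ) (x : Plane) : ℝ :=
  fderiv ℝ φ x (EuclideanSpace.single i 1)

/-- Test functions: smooth functions with compact support contained in `U`. -/
structure IsTest (U : Set Plane) (φ : Plane → ℝ) : Prop where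
  smooth : ContDiff ℝ ∞ φ
  compact : HasCompactSupport φ
  supp : tsupport φ ⊆ U

/-- `v` is the weak partial derivative `∂ᵢ w` on the open set `U`. -/
structure IsWeakPartial (U : Set Plane) (i : Fin 2) (w v : Plane → ℝ) : Prop where
  locInt : LocallyIntegrableOn w U
  locInt_deriv : LocallyIntegrableOn v U
  integral_eq : ∀ φ, IsTest U φ → ∫ x in U, w x * pd i φ x = - ∫ x in U, v x * φ x

open Classical in
/-- The weak partial derivative `∂ᵢ w` on `U` (determined almost everywhere on `U`);
it is `0` if there is none. -/
def wD (U : Set Plane) (i : Fin 2) (w : Plane → ℝ) : Plane → ℝ :=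
  if h : ∃ v, IsWeakPartial U i w v then h.choose else 0

/-- Membership in the Sobolev space `Hᵏ(U) = W^{k,2}(U)`. -/
def MemH : ℕ → Set Plane → (Plane → ℝ) → Prop
  | 0, U, w => MemLp w 2 (volume.restrict U)
  | k + 1, U, w => MemLp w 2 (volume.restrict U) ∧
      ∀ i, ∃ v, IsWeakPartial U i w v ∧ MemH k U v

/-- The square of the `Hᵏ(U)` norm: the sum of the squared `L²(U)` norms of all (iterated)
weak partial derivatives of order at most `k`. -/
def hNormSq : ℕ → Set Plane → (Plane → ℝ) → ℝ
  | 0, U, w => ∫ x in U, w x ^ 2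
  | k + 1, U, w => (∫ x in U, w x ^ 2) + ∑ i, hNormSq k U (wD U i w)

/-- The `Hᵏ(U)` norm. -/
def hNorm (k : ℕ) (U : Set Plane) (w : Plane → ℝ) : ℝ := Real.sqrt (hNormSq k U w)

/-- Entry `(i, j)` of the weak Hessian on `U`. -/
def hess (U : Set Plane) (i j : Fin 2) (w : Plane → ℝ) : Plane → ℝ := wD U j (wD U i w)

/-- The weak Laplacian on `U`. -/
def lap (U : Set Plane) (w : Plane → ℝ) : Plane → ℝ := fun x => ∑ i, hess U i i w x

/-! ### Polygonal domains -/

/-- `U` lies locally on one side of the graph of a Lipschitz function, in suitable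
Cartesian coordinates, near each of its boundary points. -/
def HasLipschitzBoundary (U : Set Plane) : Prop :=
  ∀ x ∈ frontier U, ∃ r > 0, ∃ e : Plane ≃ᵃⁱ[ℝ] Plane, ∃ g : ℝ → ℝ,
    (∃ L, LipschitzWith L g) ∧ ∀ y ∈ Metric.ball x r, (y ∈ U ↔ g (e y 0) < e y 1)

/-- Bounded (Lipschitz) polygonal domains: bounded connected open sets whose boundary
consists of finitely many line segments. -/
structure IsPolygonalDomain (U : Set Plane) : Prop where
  isOpen : IsOpen U
  isConnected : IsConnected U
  bounded : Bornology.IsBounded U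
  lipschitz : HasLipschitzBoundary U
  polygonal : ∃ S : Finset (Plane × Plane), frontier U ⊆ ⋃ p ∈ S, segment ℝ p.1 p.2

/-! ### Triangulations -/

/-- The closed simplex (triangle or edge) with vertex set `s`. -/
def cell (s : Finset Plane) : Set Plane := convexHull ℝ (s : Set Plane)

/-- `T` is a (finite, geometrically conforming, simplicial) triangulation of `U`. -/
structure IsTriangulation (U : Set Plane) (T : Geometry.SimplicialComplex ℝ Plane) : Prop where
  finite : T.faces.Finite
  space_eq : T.space = closure U

/-- The triangles of `T`, given by their vertex sets. -/
def triangles (T : Geometry.SimplicialComplex ℝ Plane) : Set (Finset Plane) :=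
  {s | s ∈ T.faces ∧ s.card = 3}

/-- The edges of `T`, given by their vertex sets. -/
def edges (T : Geometry.SimplicialComplex ℝ Plane) : Set (Finset Plane) :=
  {s | s ∈ T.faces ∧ s.card = 2}

/-- The triangles of `T` having `e` as an edge: two for an interior edge, one for a
boundary edge. -/
def adjacent (T : Geometry.SimplicialComplex ℝ Plane) (e : Finset Plane) :
    Set (Finset Plane) :=
  {s | s ∈ triangles T ∧ e ⊆ s}

/-- The diameter of a cell: `h_K` for a triangle and the length `|e|` for an edge. -/
def size (s : Finset Plane) : ℝ := Metric.diam (cell s)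

/-- The mesh size `h = max_K h_K`. -/
def meshSize (T : Geometry.SimplicialComplex ℝ Plane) : ℝ := sSup (size '' triangles T)

/-- Shape regularity with parameter `σ`: `h_K ≤ σ ρ_K` for every triangle `K`, where `ρ_K` is
the diameter of the largest disc contained in `K`. -/
def ShapeRegular (σ : ℝ) (T : Geometry.SimplicialComplex ℝ Plane) : Prop :=
  ∀ s ∈ triangles T, ∃ x : Plane, ∃ r > 0,
    Metric.closedBall x r ⊆ cell s ∧ size s ≤ σ * (2 * r)

/-! ### Traces on edges, normals, jumps and averages -/

/-- `g` is the trace on the edge `e` of a function `w` of class `H¹` on the triangle `s`: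
there are smooth functions that converge to `w` in `H¹` of the triangle and
whose restrictions to the edge converge to `g` in `L²(e)`. -/
def IsTrace (s e : Finset Plane) (w g : Plane → ℝ) : Prop :=
  MemLp g 2 ((μH[1]).restrict (cell e)) ∧
  ∃ φ : ℕ → Plane → ℝ, (∀ n, ContDiff ℝ ∞ (φ n)) ∧
    Tendsto (fun n => eLpNorm (φ n - w) 2 (volume.restrict (interior (cell s)))) atTop (𝓝 0) ∧
    (∀ i, Tendsto (fun n => eLpNorm (pd i (φ n) - wD (interior (cell s)) i w) 2
      (volume.restrict (interior (cell s)))) atTop (𝓝 0)) ∧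
    Tendsto (fun n => eLpNorm (φ n - g) 2 ((μH[1]).restrict (cell e))) atTop (𝓝 0)

open Classical in
/-- The trace of `w` on the edge `e`, taken from the triangle `s`. -/
def trace (s e : Finset Plane) (w : Plane → ℝ) : Plane → ℝ :=
  if h : ∃ g, IsTrace s e w g then h.choose else 0

/-- `n` is the unit normal of the edge `e` of the triangle `s` pointing out of the triangle. -/
def IsOutwardNormal (s e : Finset Plane) (n : Plane) : Prop :=
  ‖n‖ = 1 ∧ (∀ x ∈ e, ∀ y ∈ e, inner ℝ n (y - x) = 0) ∧
    ∀ x ∈ e, ∀ z ∈ s, z ∉ e → inner ℝ n (z - x) < 0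

/-- The outward unit normal of the triangle `s` on its edge `e`. -/
def normal (s e : Finset Plane) : Plane := Classical.epsilon (IsOutwardNormal s e)

/-- The derivative of `w`, restricted to the triangle `s`, in the direction of the outward
normal of `s`, on the edge `e`. -/
def dn (s e : Finset Plane) (w : Plane → ℝ) (x : Plane) : ℝ :=
  ∑ i, normal s e i * trace s e (wD (interior (cell s)) i w) x

/-- The second normal derivative `n · (∇² w) n` of `w`, restricted to the triangle `s`, on the
edge `e`. -/
def d2n (s e : Finset Plane) (w : Plane → ℝ) (x : Plane) : ℝ :=
  ∑ i, ∑ j, normal s e i * normal s e j * trace s e (hess (interior (cell s)) i j w) x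

/-- The jump of the normal derivative. On an interior edge shared by `K₊` and `K₋`, with `n_e`
pointing from `K₋` to `K₊`, one has `n_e = n_{K₋} = - n_{K₊}`, so that
`n_e · (∇ w₊ - ∇ w₋) = - n_{K₊} · ∇ w₊ - n_{K₋} · ∇ w₋`; on a boundary edge it is
`- n_e · ∇ w_K`. -/
def jump (T : Geometry.SimplicialComplex ℝ Plane) (e : Finset Plane) (w : Plane → ℝ)
    (x : Plane) : ℝ :=
  - ∑ᶠ s ∈ adjacent T e, dn s e w x

/-- The average of the second normal derivative over the adjacent triangles: the arithmetic mean
of the two values on an interior edge, and the value itself on a boundary edge. -/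
def avg (T : Geometry.SimplicialComplex ℝ Plane) (e : Finset Plane) (w : Plane → ℝ)
    (x : Plane) : ℝ :=
  (∑ᶠ s ∈ adjacent T e, d2n s e w x) / ((adjacent T e).ncard : ℝ)

/-- Integration over an edge with respect to arc length. -/
def edgeInt (e : Finset Plane) (F : Plane → ℝ) : ℝ := ∫ x in cell e, F x ∂μH[1]

/-! ### The C⁰ interior penalty method -/

/-- `∫_K ∇² w : ∇² v`. -/
def hessInner (s : Finset Plane) (w v : Plane → ℝ) : ℝ :=
  ∫ x in interior (cell s), ∑ i, ∑ j,
    hess (interior (cell s)) i j w x * hess (interior (cell s)) i j v x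

/-- The C⁰ interior penalty bilinear form with penalty parameter `α`. -/
def aIP (T : Geometry.SimplicialComplex ℝ Plane) (α : ℝ) (w v : Plane → ℝ) : ℝ :=
  (∑ᶠ s ∈ triangles T, hessInner s w v)
  + (∑ᶠ e ∈ edges T, edgeInt e fun x => avg T e w x * jump T e v x)
  + (∑ᶠ e ∈ edges T, edgeInt e fun x => avg T e v x * jump T e w x)
  + α * ∑ᶠ e ∈ edges T, 1 / size e * edgeInt e fun x => jump T e w x * jump T e v x

/-- The mesh dependent norm `‖·‖_{2,h}`. -/
def norm2h (T : Geometry.SimplicialComplex ℝ Plane) (α : ℝ) (w : Plane → ℝ) : ℝ :=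
  Real.sqrt ((∑ᶠ s ∈ triangles T, hessInner s w w)
    + ∑ᶠ e ∈ edges T, α / size e * edgeInt e fun x => jump T e w x ^ 2)

/-- The space `Z_h` of continuous functions on the closure of `U` that are polynomials of
degree at most two on each triangle (values outside the closure of `U` are immaterial). -/
def MemZh (U : Set Plane) (T : Geometry.SimplicialComplex ℝ Plane) (v : Plane → ℝ) : Prop :=
  ContinuousOn v (closure U) ∧
  ∀ s ∈ triangles T, ∃ p : MvPolynomial (Fin 2) ℝ, p.totalDegree ≤ 2 ∧
    ∀ x ∈ cell s, v x = MvPolynomial.eval (fun i => x i) p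

/-- `p` is the Ritz projection `P_h u` of `u`. -/
structure IsRitz (U : Set Plane) (T : Geometry.SimplicialComplex ℝ Plane) (α ε : ℝ)
    (u p : Plane → ℝ) : Prop where
  mem : MemZh U T p
  orth : ∀ ξ, MemZh U T ξ →
    aIP T α (p - u) ξ + (1 - ε) * ∫ x in U, (p x - u x) * ξ x = 0
  mean : ∫ x in U, (p x - u x) * 1 = 0

/-! ### The model problem -/

/-- `div F = g` on `U` in the sense of distributions. -/
def IsWeakDiv (U : Set Plane) (F : Fin 2 → Plane → ℝ) (g : Plane → ℝ) : Prop :=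
  ∀ φ, IsTest U φ → ∫ x in U, ∑ i, F i x * pd i φ x = - ∫ x in U, g x * φ x

/-- The normal trace `F · n` vanishes on the boundary of `U`, for a square integrable field `F`
with square integrable divergence `g`. The normal trace is the functional
`v ↦ ∫_U (F · ∇ v + g v)` on `H¹(U)`. -/
def NormalTraceZero (U : Set Plane) (F : Fin 2 → Plane → ℝ) (g : Plane → ℝ) : Prop :=
  ∀ v, MemH 1 U v → (∫ x in U, ∑ i, F i x * wD U i v x) + ∫ x in U, g x * v x = 0

/-- `u ∈ H³(U)` solves `Δ² u + (1 - ε) u = f` in `U`, `∂u/∂n = ∂(Δu)/∂n = 0` on the boundary. -/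
structure SolvesModelProblem (U : Set Plane) (ε : ℝ) (f u : Plane → ℝ) : Prop where
  mem : MemH 3 U u
  pde : IsWeakDiv U (fun i => wD U i (lap U u)) (fun x => f x - (1 - ε) * u x)
  neumann : NormalTraceZero U (fun i => wD U i u) (lap U u)
  neumann_lap : NormalTraceZero U (fun i => wD U i (lap U u)) (fun x => f x - (1 - ε) * u x)

end C0IP

end

open MeasureTheory Filter Topology Set
open scoped ContDiff

noncomputable section

namespace C0IP

/-! The form `a_h` plus `1 - ε` times the `L²` product is regarded as a symmetric form on functions
that are `H³` on every triangle. It is written with four linear maps into Hilbert spaces: `H`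
(piecewise Hessian), `A` (averages weighted by `√|e|`), `J` (jumps weighted by `1/√|e|`) and `M`
(inclusion into `L²(Ω)`), so that it equals `⟪Hw,Hv⟫ + ⟪Aw,Jv⟫ + ⟪Av,Jw⟫ + α⟪Jw,Jv⟫ + (1-ε)⟪Mw,Mv⟫`
(`IsTriangulation.aIP_add_eq_ipForm`).

Stability. Third derivatives vanish on `Z_h`, so the trace inequality reduces there to `‖Aξ‖² ≤
9σ²‖Hξ‖²` (`IsTriangulation.norm_sq_avgMap_le_of_mem`). For `α ≥ 36σ²` the mixed terms are absorbed
and the form is coercive on `Z_h` (`ipForm_coercive`). The mass term makes it definite, which gives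
existence and uniqueness in finite dimension. Testing with constants, which `a_h` does not see,
yields the mean value condition. Galerkin orthogonality is the definition of `P_h`, so a Céa
argument bounds the squared error by `30` times `errSq (u - z)` for every `z ∈ Z_h`
(`norm_sub_le_errSq`).

Approximation. If `w` is smooth and vanishes at the vertices and edge midpoints of a triangle, then
its second derivative along an edge has zero mean on that edge against a hat function, since that
mean is a second difference. A Poincaré inequality with an edge mean (`edge_poincare`) bounds these
derivatives by third derivatives; the three edge directions recover the whole Hessian by
polarization, and lower derivatives follow similarly (`interpolation_estimate`). This controls the
Lagrange interpolation error in every term of `errSq` with one factor `h²`.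

Passage to `H³`. Smooth functions are dense in `H³` of a Lipschitz domain (`MemH.approx`, by a
partition of unity and mollification with kernels shifted so that only interior values are used).
Only smooth approximations `φₙ` of `u` are interpolated; `errSq (u - φₙ)` tends to `0` on the fixed
mesh, and the estimate survives in the limit (`IsTriangulation.norm2h_sub_le`). The same
approximations identify the edge traces, whose existence and uniqueness come from
`trace_inequality`. -/

/-! ### Convergence in `L²` -/

/-- `f n` tends to `F` in `L²(μ)`. -/
structure ConvL2 (μ : Measure Plane) (f : ℕ → Plane → ℝ) (F : Plane → ℝ) : Prop where
  memLp : ∀ n, MemLp (f n) 2 μ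
  memLp_lim : MemLp F 2 μ
  tendsto : Tendsto (fun n => eLpNorm (f n - F) 2 μ) atTop (𝓝 0)

namespace ConvL2

variable {μ ν : Measure Plane} {f g : ℕ → Plane → ℝ} {F G : Plane → ℝ}

lemma const (hF : MemLp F 2 μ) : ConvL2 μ (fun _ => F) F :=
  ⟨fun _ => hF, hF, by simp⟩

lemma tendsto_toLp (h : ConvL2 μ f F) :
    Tendsto (fun n => (h.memLp n).toLp (f n)) atTop (𝓝 (h.memLp_lim.toLp F)) :=
  (Lp.tendsto_Lp_iff_tendsto_eLpNorm'' f h.memLp F h.memLp_lim).2 h.tendsto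

/-- The integrals are inner products in the Hilbert space `L²(μ)`, and the inner product is jointly
continuous. -/
lemma tendsto_integral_mul (h : ConvL2 μ f F) (h' : ConvL2 μ g G) :
    Tendsto (fun n => ∫ x, f n x * g n x ∂μ) atTop (𝓝 (∫ x, F x * G x ∂μ)) := by
  have key : ∀ (a b : Plane → ℝ) (ha : MemLp a 2 μ) (hb : MemLp b 2 μ),
      ∫ x, a x * b x ∂μ = inner ℝ (ha.toLp a) (hb.toLp b) := by
    intro a b ha hb
    rw [L2.inner_def]
    refine integral_congr_ae ?_
    filter_upwards [ha.coeFn_toLp, hb.coeFn_toLp] with x h1 h2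
    simp [h1, h2, mul_comm]
  rw [key F G h.memLp_lim h'.memLp_lim]
  simp_rw [fun n => key (f n) (g n) (h.memLp n) (h'.memLp n)]
  exact h.tendsto_toLp.inner h'.tendsto_toLp

lemma tendsto_integral_sq (h : ConvL2 μ f F) :
    Tendsto (fun n => ∫ x, f n x ^ 2 ∂μ) atTop (𝓝 (∫ x, F x ^ 2 ∂μ)) := by
  simpa only [sq] using h.tendsto_integral_mul h

lemma add (h : ConvL2 μ f F) (h' : ConvL2 μ g G) :
    ConvL2 μ (fun n => f n + g n) (F + G) := by
  refine ⟨fun n => (h.memLp n).add (h'.memLp n), h.memLp_lim.add h'.memLp_lim, ?_⟩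
  have := h.tendsto.add h'.tendsto
  rw [add_zero] at this
  refine tendsto_of_tendsto_of_tendsto_of_le_of_le tendsto_const_nhds this (fun _ => zero_le) ?_
  intro n
  have e : f n + g n - (F + G) = (f n - F) + (g n - G) := by abel
  simp only [e]
  exact eLpNorm_add_le ((h.memLp n).sub h.memLp_lim).1 ((h'.memLp n).sub h'.memLp_lim).1
    (by norm_num)

lemma bdd_mul (h : ConvL2 μ f F) {ψ : Plane → ℝ} (hψ : AEStronglyMeasurable ψ μ) {c : ℝ}
    (hc : ∀ x, |ψ x| ≤ c) : ConvL2 μ (fun n => ψ * f n) (ψ * F) := by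
  have hb : ∀ {a : Plane → ℝ}, MemLp a 2 μ → MemLp (ψ * a) 2 μ := by
    intro a ha
    refine MemLp.of_le_mul (c := c) ha (hψ.mul ha.1) (Eventually.of_forall fun x => ?_)
    simp only [Pi.mul_apply, norm_mul, Real.norm_eq_abs]
    gcongr
    exact hc x
  refine ⟨fun n => hb (h.memLp n), hb h.memLp_lim, ?_⟩
  have := ENNReal.Tendsto.const_mul (a := ENNReal.ofReal c) h.tendsto (Or.inr ENNReal.ofReal_ne_top)
  rw [mul_zero] at this
  refine tendsto_of_tendsto_of_tendsto_of_le_of_le tendsto_const_nhds this (fun _ => zero_le) ?_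
  intro n
  refine eLpNorm_le_mul_eLpNorm_of_ae_le_mul (Eventually.of_forall fun x => ?_) 2
  simp only [Pi.mul_apply, Pi.sub_apply, ← mul_sub, norm_mul, Real.norm_eq_abs]
  gcongr
  exact hc x

lemma const_smul (h : ConvL2 μ f F) (c : ℝ) : ConvL2 μ (fun n => c • f n) (c • F) := by
  have := h.bdd_mul (ψ := fun _ => c) aestronglyMeasurable_const (c := |c|) (fun _ => le_rfl)
  exact this

lemma sub (h : ConvL2 μ f F) (h' : ConvL2 μ g G) :
    ConvL2 μ (fun n => f n - g n) (F - G) := by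
  have := h.add (h'.const_smul (-1))
  simpa [sub_eq_add_neg] using this

lemma mono (h : ConvL2 μ f F) (hν : ν ≤ μ) : ConvL2 ν f F :=
  ⟨fun n => (h.memLp n).mono_measure hν, h.memLp_lim.mono_measure hν,
    tendsto_of_tendsto_of_tendsto_of_le_of_le tendsto_const_nhds h.tendsto (fun _ => zero_le)
      fun _ => eLpNorm_mono_measure _ hν⟩

lemma congr (h : ConvL2 μ f F) (hf : ∀ n, f n =ᵐ[μ] g n) (hF : F =ᵐ[μ] G) : ConvL2 μ g G := by
  refine ⟨fun n => (h.memLp n).ae_eq (hf n), h.memLp_lim.ae_eq hF, ?_⟩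
  refine h.tendsto.congr fun n => eLpNorm_congr_ae ?_
  exact (hf n).sub hF

lemma unique (h : ConvL2 μ f F) (h' : ConvL2 μ f G) : F =ᵐ[μ] G := by
  have := tendsto_nhds_unique h.tendsto_toLp h'.tendsto_toLp
  exact (MemLp.toLp_eq_toLp_iff _ _).1 this

end ConvL2

/-! ### Classical partial derivatives -/

section pd

variable {φ ψ : Plane → ℝ} {i j : Fin 2}

lemma contDiff_pd (hφ : ContDiff ℝ ∞ φ) (i : Fin 2) : ContDiff ℝ ∞ (pd i φ) :=
  (hφ.fderiv_right (m := ∞) (by simp)).clm_apply contDiff_const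

lemma pd_add (hφ : ContDiff ℝ ∞ φ) (hψ : ContDiff ℝ ∞ ψ) (i : Fin 2) :
    pd i (φ + ψ) = pd i φ + pd i ψ := by
  ext x
  simp [pd, fderiv_add (hφ.differentiable (by simp) x) (hψ.differentiable (by simp) x)]

lemma pd_sub (hφ : ContDiff ℝ ∞ φ) (hψ : ContDiff ℝ ∞ ψ) (i : Fin 2) :
    pd i (φ - ψ) = pd i φ - pd i ψ := by
  ext x
  simp [pd, fderiv_sub (hφ.differentiable (by simp) x) (hψ.differentiable (by simp) x)]

lemma pd_smul (hφ : ContDiff ℝ ∞ φ) (c : ℝ) (i : Fin 2) : pd i (c • φ) = c • pd i φ := by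
  ext x
  simp [pd, fderiv_const_smul (hφ.differentiable (by simp) x)]

lemma pd_mul (hφ : ContDiff ℝ ∞ φ) (hψ : ContDiff ℝ ∞ ψ) (i : Fin 2) :
    pd i (φ * ψ) = pd i φ * ψ + φ * pd i ψ := by
  ext x
  simp [pd, fderiv_mul (hφ.differentiable (by simp) x) (hψ.differentiable (by simp) x)]
  ring

lemma pd_comm (hφ : ContDiff ℝ ∞ φ) (i j : Fin 2) : pd i (pd j φ) = pd j (pd i φ) := by
  ext x
  have hd : DifferentiableAt ℝ (fderiv ℝ φ) x :=
    (hφ.fderiv_right (m := ∞) (by simp)).differentiable (by simp) x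
  have h : ∀ u v : Plane, fderiv ℝ (fun y => fderiv ℝ φ y u) x v =
      fderiv ℝ (fderiv ℝ φ) x v u := by
    intro u v
    rw [fderiv_clm_apply hd (differentiableAt_const u)]
    simp
  have hs : IsSymmSndFDerivAt ℝ φ x :=
    hφ.contDiffAt.isSymmSndFDerivAt (by
      rw [minSmoothness_of_isRCLikeNormedField]
      exact WithTop.coe_le_coe.2 (le_top : (2 : ℕ∞) ≤ ⊤))
  change fderiv ℝ (fun y => fderiv ℝ φ y _) x _ = fderiv ℝ (fun y => fderiv ℝ φ y _) x _
  rw [h, h]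
  exact hs _ _

lemma pd_eqOn {K : Set Plane} (hK : IsOpen K) (h : EqOn φ ψ K) (i : Fin 2) :
    EqOn (pd i φ) (pd i ψ) K := by
  intro x hx
  have : φ =ᶠ[𝓝 x] ψ := by filter_upwards [hK.mem_nhds hx] with y hy using h hy
  simp only [pd, this.fderiv_eq]

lemma tsupport_pd_subset (φ : Plane → ℝ) (i : Fin 2) : tsupport (pd i φ) ⊆ tsupport φ :=
  tsupport_fderiv_apply_subset ℝ _

lemma fderiv_apply_eq_sum (φ : Plane → ℝ) (x v : Plane) :
    fderiv ℝ φ x v = ∑ i, v i * pd i φ x := by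
  have hv : v = ∑ i, v i • EuclideanSpace.single i (1 : ℝ) := by
    ext k
    fin_cases k <;> simp [Fin.sum_univ_two]
  conv_lhs => rw [hv]
  simp [pd]

lemma memLp_of_contDiff {K : Set Plane} (hK : Bornology.IsBounded K) (hφ : ContDiff ℝ ∞ φ) :
    MemLp φ 2 (volume.restrict K) := by
  have hc : IsCompact (closure K) := hK.isCompact_closure
  have : MemLp φ 2 (volume.restrict (closure K)) := by
    obtain ⟨C, hC⟩ := hc.exists_bound_of_continuousOn hφ.continuous.continuousOn
    have : IsFiniteMeasure (volume.restrict (closure K)) :=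
      ⟨by simpa using hc.measure_lt_top⟩
    refine MemLp.of_bound hφ.continuous.aestronglyMeasurable C ?_
    exact (ae_restrict_iff' isClosed_closure.measurableSet).2 (Eventually.of_forall hC)
  exact this.mono_measure (Measure.restrict_mono subset_closure le_rfl)

end pd

/-! ### Weak derivatives -/

section weak

variable {K U : Set Plane} {i : Fin 2} {w v w' v' : Plane → ℝ}

lemma _root_.MeasureTheory.MemLp.locallyIntegrableOn_of_restrict (h : MemLp w 2 (volume.restrict K)) :
    LocallyIntegrableOn w K :=
  locallyIntegrableOn_of_locallyIntegrable_restrict (h.locallyIntegrable (by norm_num))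

lemma IsTest.mono {φ : Plane → ℝ} (h : IsTest K φ) (hKU : K ⊆ U) : IsTest U φ :=
  ⟨h.smooth, h.compact, h.supp.trans hKU⟩

lemma IsTest.pd {φ : Plane → ℝ} (h : IsTest K φ) (i : Fin 2) : IsTest K (pd i φ) :=
  ⟨contDiff_pd h.smooth i, h.compact.mono' ((subset_tsupport _).trans (tsupport_pd_subset φ i)),
    (tsupport_pd_subset φ i).trans h.supp⟩

lemma IsTest.memLp {φ : Plane → ℝ} (h : IsTest K φ) (μ : Measure Plane)
    [IsFiniteMeasureOnCompacts μ] : MemLp φ 2 μ :=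
  h.smooth.continuous.memLp_of_hasCompactSupport h.compact

lemma setIntegral_mul_of_tsupport_subset {φ : Plane → ℝ} (h : tsupport φ ⊆ K) (w : Plane → ℝ) :
    ∫ x in K, w x * φ x = ∫ x, w x * φ x := by
  refine setIntegral_eq_integral_of_forall_compl_eq_zero fun x hx => ?_
  rw [image_eq_zero_of_notMem_tsupport fun hx' => hx (h hx'), mul_zero]

lemma _root_.MeasureTheory.LocallyIntegrableOn.integrable_test_mul (hw : LocallyIntegrableOn w K)
    {φ : Plane → ℝ} (h : IsTest K φ) : Integrable (fun x => φ x * w x) := by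
  have h1 : IntegrableOn (fun x => φ x * w x) (tsupport φ) :=
    (hw.integrableOn_compact_subset h.supp h.compact).continuousOn_mul
      h.smooth.continuous.continuousOn h.compact
  refine (integrableOn_iff_integrable_of_support_subset ?_).1 h1
  exact (Function.support_mul_subset_left _ _).trans (subset_tsupport _)

/-- This is the fundamental lemma of the calculus of variations; it makes the arbitrary choice in
`wD` harmless up to null sets. -/
lemma IsWeakPartial.ae_eq (hK : IsOpen K) (h : IsWeakPartial K i w v)
    (h' : IsWeakPartial K i w v') : v =ᵐ[volume.restrict K] v' := by
  have hl : LocallyIntegrableOn (v - v') K := h.locInt_deriv.sub h'.locInt_deriv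
  have := hK.ae_eq_zero_of_integral_contDiff_smul_eq_zero (μ := volume) hl ?_
  · rw [Filter.EventuallyEq, ae_restrict_iff' hK.measurableSet]
    filter_upwards [this] with x hx hxK
    exact sub_eq_zero.1 (hx hxK)
  · intro φ h1 h2 h3
    have ht : IsTest K φ := ⟨h1, h2, h3⟩
    have e1 := h.integral_eq φ ht
    have e2 := h'.integral_eq φ ht
    rw [e1, neg_inj, setIntegral_mul_of_tsupport_subset h3,
      setIntegral_mul_of_tsupport_subset h3] at e2
    have i1 := h.locInt_deriv.integrable_test_mul ht
    have i2 := h'.locInt_deriv.integrable_test_mul ht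
    have : ∀ x, φ x • (v - v') x = φ x * v x - φ x * v' x := fun x => by simp [mul_sub]
    simp_rw [this]
    rw [integral_sub i1 i2, sub_eq_zero]
    simpa only [mul_comm] using e2

lemma LocallyIntegrableOn_congr_ae (h : w =ᵐ[volume.restrict K] w')
    (hw : LocallyIntegrableOn w K) : LocallyIntegrableOn w' K := by
  intro x hx
  obtain ⟨s, hs, hi⟩ := hw x hx
  refine ⟨s ∩ K, inter_mem hs self_mem_nhdsWithin, ?_⟩
  exact (hi.mono_set inter_subset_left).congr_fun_ae
    (ae_mono (Measure.restrict_mono inter_subset_right le_rfl) h)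

lemma IsWeakPartial.congr (h : IsWeakPartial K i w v) (hw : w =ᵐ[volume.restrict K] w')
    (hv : v =ᵐ[volume.restrict K] v') : IsWeakPartial K i w' v' where
  locInt := LocallyIntegrableOn_congr_ae hw h.locInt
  locInt_deriv := LocallyIntegrableOn_congr_ae hv h.locInt_deriv
  integral_eq φ hφ := by
    have e := h.integral_eq φ hφ
    rw [integral_congr_ae (g := fun x => w' x * C0IP.pd i φ x),
      integral_congr_ae (f := fun x => v x * φ x) (g := fun x => v' x * φ x)] at e
    · exact e
    · filter_upwards [hv] with x hx using by rw [hx]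
    · filter_upwards [hw] with x hx using by rw [hx]

/-- A test function on `K` is also one on `U`, and all integrals live on its support. -/
lemma IsWeakPartial.mono (h : IsWeakPartial U i w v) (hKU : K ⊆ U) : IsWeakPartial K i w v where
  locInt := h.locInt.mono_set hKU
  locInt_deriv := h.locInt_deriv.mono_set hKU
  integral_eq φ hφ := by
    have hs := hφ.supp
    have e := h.integral_eq φ (hφ.mono hKU)
    rw [setIntegral_mul_of_tsupport_subset (hs.trans hKU),
      setIntegral_mul_of_tsupport_subset ((tsupport_pd_subset φ i).trans (hs.trans hKU))] at e
    rw [setIntegral_mul_of_tsupport_subset hs,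
      setIntegral_mul_of_tsupport_subset ((tsupport_pd_subset φ i).trans hs), e]

lemma wD_spec (h : ∃ v, IsWeakPartial U i w v) : IsWeakPartial U i w (wD U i w) := by
  rw [wD, dif_pos h]
  exact h.choose_spec

lemma IsWeakPartial.wD_ae_eq (hK : IsOpen K) (h : IsWeakPartial K i w v) :
    wD K i w =ᵐ[volume.restrict K] v :=
  (wD_spec ⟨v, h⟩).ae_eq hK h

lemma wD_congr (hK : IsOpen K) (hw : w =ᵐ[volume.restrict K] w') :
    wD K i w =ᵐ[volume.restrict K] wD K i w' := by
  by_cases h : ∃ v, IsWeakPartial K i w v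
  · exact ((wD_spec h).congr hw ae_eq_rfl).wD_ae_eq hK |>.symm
  -- Without a weak derivative both sides are the default value `0`.
  · have h' : ¬ ∃ v, IsWeakPartial K i w' v :=
      fun ⟨v, hv⟩ => h ⟨v, hv.congr hw.symm ae_eq_rfl⟩
    rw [wD, wD, dif_neg h, dif_neg h']

/-- Each `φ n` can be integrated by parts classically against a test function, and both sides pass
to the `L²` limit. -/
lemma isWeakPartial_of_convL2 {φ : ℕ → Plane → ℝ}
    (hφ : ∀ n, ContDiff ℝ ∞ (φ n)) (h : ConvL2 (volume.restrict K) φ w)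
    (h' : ConvL2 (volume.restrict K) (fun n => pd i (φ n)) v) : IsWeakPartial K i w v where
  locInt := h.memLp_lim.locallyIntegrableOn_of_restrict
  locInt_deriv := h'.memLp_lim.locallyIntegrableOn_of_restrict
  integral_eq ψ hψ := by
    have t1 := h.tendsto_integral_mul (ConvL2.const ((hψ.pd i).memLp (volume.restrict K)))
    have t2 := h'.tendsto_integral_mul (ConvL2.const (hψ.memLp (volume.restrict K)))
    refine tendsto_nhds_unique t1 (t2.neg.congr fun n => ?_)
    rw [setIntegral_mul_of_tsupport_subset hψ.supp,
      setIntegral_mul_of_tsupport_subset ((tsupport_pd_subset ψ i).trans hψ.supp)]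
    have hcs : ∀ (a b : Plane → ℝ), ContDiff ℝ ∞ a → ContDiff ℝ ∞ b → HasCompactSupport b →
        Integrable (fun x => a x * b x) := fun a b ha hb hc =>
      (ha.continuous.mul hb.continuous).integrable_of_hasCompactSupport hc.mul_left
    exact (integral_mul_fderiv_eq_neg_fderiv_mul_of_integrable
      (hcs _ _ (contDiff_pd (hφ n) i) hψ.smooth hψ.compact)
      (hcs _ _ (hφ n) (contDiff_pd hψ.smooth i) (hψ.pd i).compact)
      (hcs _ _ (hφ n) hψ.smooth hψ.compact)
      (fun x _ => (hφ n).differentiable (by simp) x)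
      (fun x _ => hψ.smooth.differentiable (by simp) x)).symm

end weak

/-! ### Approximation by smooth functions in `Hᵏ` -/

/-- `φ n` tends to `w` in `Hᵏ(K)`. -/
def Conv : ℕ → Set Plane → (ℕ → Plane → ℝ) → (Plane → ℝ) → Prop
  | 0, K, φ, w => ConvL2 (volume.restrict K) φ w
  | k + 1, K, φ, w => ConvL2 (volume.restrict K) φ w ∧
      ∀ i, ∃ v, Conv k K (fun n => pd i (φ n)) v

/-- `w` is the limit in `Hᵏ(K)` of functions that are smooth on the plane. -/
def Approx (k : ℕ) (K : Set Plane) (w : Plane → ℝ) : Prop :=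
  ∃ φ : ℕ → Plane → ℝ, (∀ n, ContDiff ℝ ∞ (φ n)) ∧ Conv k K φ w

/-- The squared `Hᵏ` seminorm in terms of weak derivatives. -/
def nS : ℕ → Set Plane → (Plane → ℝ) → ℝ
  | 0, K, w => ∫ x in K, w x ^ 2
  | k + 1, K, w => ∑ i, nS k K (wD K i w)

/-- The squared `Hᵏ` seminorm in terms of classical derivatives. -/
def pS : ℕ → Set Plane → (Plane → ℝ) → ℝ
  | 0, K, w => ∫ x in K, w x ^ 2
  | k + 1, K, w => ∑ i, pS k K (pd i w)

section conv

variable {K U : Set Plane} {φ ψ : ℕ → Plane → ℝ} {w w' : Plane → ℝ} {k : ℕ}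

lemma Conv.convL2 (h : Conv k K φ w) : ConvL2 (volume.restrict K) φ w := by
  cases k with
  | zero => exact h
  | succ k => exact h.1

lemma Conv.of_succ (h : Conv (k + 1) K φ w) : Conv k K φ w := by
  induction k generalizing φ w with
  | zero => exact h.1
  | succ k ih => exact ⟨h.1, fun i => (h.2 i).imp fun v hv => ih hv⟩

lemma Conv.congr_lim (h : Conv k K φ w) (hw : w =ᵐ[volume.restrict K] w') : Conv k K φ w' := by
  cases k with
  | zero => exact ConvL2.congr h (fun _ => ae_eq_rfl) hw
  | succ k => exact ⟨h.1.congr (fun _ => ae_eq_rfl) hw, h.2⟩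

lemma Conv.congr_seq (hK : IsOpen K) (h : Conv k K φ w) (hφ : ∀ n, EqOn (φ n) (ψ n) K) :
    Conv k K ψ w := by
  have hae : ∀ n, φ n =ᵐ[volume.restrict K] ψ n := fun n =>
    (ae_restrict_iff' hK.measurableSet).2 (Eventually.of_forall fun x hx => hφ n hx)
  induction k generalizing φ ψ w with
  | zero => exact ConvL2.congr h hae ae_eq_rfl
  | succ k ih =>
    refine ⟨h.1.congr hae ae_eq_rfl, fun i => (h.2 i).imp fun v hv => ?_⟩
    have he : ∀ n, EqOn (pd i (φ n)) (pd i (ψ n)) K := fun n => pd_eqOn hK (hφ n) i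
    exact ih hv he fun n =>
      (ae_restrict_iff' hK.measurableSet).2 (Eventually.of_forall fun x hx => he n hx)

lemma Conv.mono (h : Conv k U φ w) (hKU : K ⊆ U) : Conv k K φ w := by
  have hm : volume.restrict K ≤ (volume : Measure Plane).restrict U :=
    Measure.restrict_mono hKU le_rfl
  induction k generalizing φ w with
  | zero => exact ConvL2.mono h hm
  | succ k ih => exact ⟨h.1.mono hm, fun i => (h.2 i).imp fun v hv => ih hv⟩

lemma Conv.add (hφ : ∀ n, ContDiff ℝ ∞ (φ n)) (hψ : ∀ n, ContDiff ℝ ∞ (ψ n))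
    (h : Conv k K φ w) (h' : Conv k K ψ w') : Conv k K (fun n => φ n + ψ n) (w + w') := by
  induction k generalizing φ ψ w w' with
  | zero => exact ConvL2.add h h'
  | succ k ih =>
    refine ⟨h.1.add h'.1, fun i => ?_⟩
    obtain ⟨v, hv⟩ := h.2 i
    obtain ⟨v', hv'⟩ := h'.2 i
    refine ⟨v + v', ?_⟩
    simp_rw [fun n => pd_add (hφ n) (hψ n) i]
    exact ih (fun n => contDiff_pd (hφ n) i) (fun n => contDiff_pd (hψ n) i) hv hv'

lemma Conv.smul (hφ : ∀ n, ContDiff ℝ ∞ (φ n)) (c : ℝ)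
    (h : Conv k K φ w) : Conv k K (fun n => c • φ n) (c • w) := by
  induction k generalizing φ w with
  | zero => exact ConvL2.const_smul h c
  | succ k ih =>
    refine ⟨h.1.const_smul c, fun i => ?_⟩
    obtain ⟨v, hv⟩ := h.2 i
    refine ⟨c • v, ?_⟩
    simp_rw [fun n => pd_smul (hφ n) c i]
    exact ih (fun n => contDiff_pd (hφ n) i) hv

lemma Conv.const (hK : Bornology.IsBounded K) {p : Plane → ℝ} (hp : ContDiff ℝ ∞ p) (k : ℕ) :
    Conv k K (fun _ => p) p := by
  induction k generalizing p with
  | zero => exact ConvL2.const (memLp_of_contDiff hK hp)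
  | succ k ih =>
    exact ⟨ConvL2.const (memLp_of_contDiff hK hp), fun i => ⟨pd i p, ih (contDiff_pd hp i)⟩⟩

lemma Conv.isWeakPartial (hφ : ∀ n, ContDiff ℝ ∞ (φ n)) (h : Conv (k + 1) K φ w) (i : Fin 2) :
    IsWeakPartial K i w (wD K i w) := by
  obtain ⟨v, hv⟩ := h.2 i
  exact wD_spec ⟨v, isWeakPartial_of_convL2 hφ h.1 hv.convL2⟩

/-- The limits of the derivatives are only asserted to exist in `Conv`; uniqueness of weak
derivatives identifies them with `wD`. -/
lemma Conv.wD (hK : IsOpen K) (hφ : ∀ n, ContDiff ℝ ∞ (φ n)) (h : Conv (k + 1) K φ w)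
    (i : Fin 2) : Conv k K (fun n => pd i (φ n)) (wD K i w) := by
  obtain ⟨v, hv⟩ := h.2 i
  exact hv.congr_lim ((isWeakPartial_of_convL2 hφ h.1 hv.convL2).wD_ae_eq hK).symm

lemma Conv.tendsto_pS (hK : IsOpen K) (hφ : ∀ n, ContDiff ℝ ∞ (φ n)) (h : Conv k K φ w) :
    Tendsto (fun n => pS k K (φ n)) atTop (𝓝 (nS k K w)) := by
  induction k generalizing φ w with
  | zero => exact ConvL2.tendsto_integral_sq h
  | succ k ih =>
    exact tendsto_finsetSum _ fun i _ => ih (fun n => contDiff_pd (hφ n) i) (h.wD hK hφ i)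

lemma Approx.of_succ (h : Approx (k + 1) K w) : Approx k K w :=
  h.imp fun _ hφ => ⟨hφ.1, hφ.2.of_succ⟩

lemma Approx.memLp (h : Approx k K w) : MemLp w 2 (volume.restrict K) := by
  obtain ⟨φ, -, h⟩ := h
  exact h.convL2.memLp_lim

lemma Approx.congr (h : Approx k K w) (hw : w =ᵐ[volume.restrict K] w') : Approx k K w' :=
  h.imp fun _ hφ => ⟨hφ.1, hφ.2.congr_lim hw⟩

lemma Approx.mono (h : Approx k U w) (hKU : K ⊆ U) : Approx k K w :=
  h.imp fun _ hφ => ⟨hφ.1, hφ.2.mono hKU⟩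

lemma Approx.add (h : Approx k K w) (h' : Approx k K w') : Approx k K (w + w') := by
  obtain ⟨φ, hφ, h⟩ := h
  obtain ⟨ψ, hψ, h'⟩ := h'
  exact ⟨_, fun n => (hφ n).add (hψ n), h.add hφ hψ h'⟩

lemma Approx.smul (h : Approx k K w) (c : ℝ) : Approx k K (c • w) := by
  obtain ⟨φ, hφ, h⟩ := h
  exact ⟨_, fun n => (hφ n).const_smul c, h.smul hφ c⟩

lemma Approx.of_contDiff (hK : Bornology.IsBounded K) {p : Plane → ℝ} (hp : ContDiff ℝ ∞ p)
    (k : ℕ) : Approx k K p :=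
  ⟨_, fun _ => hp, Conv.const hK hp k⟩

lemma Approx.wD (hK : IsOpen K) (h : Approx (k + 1) K w) (i : Fin 2) :
    Approx k K (wD K i w) := by
  obtain ⟨φ, hφ, h⟩ := h
  exact ⟨_, fun n => contDiff_pd (hφ n) i, h.wD hK hφ i⟩

lemma Approx.isWeakPartial (h : Approx (k + 1) K w) (i : Fin 2) :
    IsWeakPartial K i w (C0IP.wD K i w) := by
  obtain ⟨φ, hφ, h⟩ := h
  exact h.isWeakPartial hφ i

lemma Approx.wD_mono_ae (hK : IsOpen K) (h : Approx (k + 1) U w) (hKU : K ⊆ U) (i : Fin 2) :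
    C0IP.wD K i w =ᵐ[volume.restrict K] C0IP.wD U i w :=
  ((h.isWeakPartial i).mono hKU).wD_ae_eq hK

/-- Additivity of the chosen weak derivatives is inherited from `pd`, because an `L²` limit is
unique almost everywhere. -/
lemma Approx.wD_add (hK : IsOpen K) (h : Approx (k + 1) K w) (h' : Approx (k + 1) K w')
    (i : Fin 2) : C0IP.wD K i (w + w') =ᵐ[volume.restrict K] C0IP.wD K i w + C0IP.wD K i w' := by
  obtain ⟨φ, hφ, h⟩ := h
  obtain ⟨ψ, hψ, h'⟩ := h'
  have c1 := (h.add hφ hψ h').wD hK (fun n => (hφ n).add (hψ n)) i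
  have c2 := (h.wD hK hφ i).add (fun n => contDiff_pd (hφ n) i) (fun n => contDiff_pd (hψ n) i)
    (h'.wD hK hψ i)
  refine ConvL2.unique (c1.convL2.congr (fun n => ?_) ae_eq_rfl) c2.convL2
  exact (pd_add (hφ n) (hψ n) i).eventuallyEq

lemma Approx.wD_smul (hK : IsOpen K) (h : Approx (k + 1) K w) (c : ℝ)
    (i : Fin 2) : C0IP.wD K i (c • w) =ᵐ[volume.restrict K] c • C0IP.wD K i w := by
  obtain ⟨φ, hφ, h⟩ := h
  have c1 := (h.smul hφ c).wD hK (fun n => (hφ n).const_smul c) i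
  have c2 := (h.wD hK hφ i).smul (fun n => contDiff_pd (hφ n) i) c
  refine ConvL2.unique (c1.convL2.congr (fun n => ?_) ae_eq_rfl) c2.convL2
  exact (pd_smul (hφ n) c i).eventuallyEq

lemma wD_ae_eq_pd (hK : IsOpen K) (hb : Bornology.IsBounded K) {p : Plane → ℝ}
    (hp : ContDiff ℝ ∞ p) (hw : w =ᵐ[volume.restrict K] p) (i : Fin 2) :
    wD K i w =ᵐ[volume.restrict K] pd i p :=
  (wD_congr hK hw).trans
    ((isWeakPartial_of_convL2 (fun _ => hp) (Conv.const hb hp 0)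
      (Conv.const hb (contDiff_pd hp i) 0)).wD_ae_eq hK)

lemma nS_nonneg (k : ℕ) (K : Set Plane) (w : Plane → ℝ) : 0 ≤ nS k K w := by
  induction k generalizing w with
  | zero => exact integral_nonneg fun x => sq_nonneg _
  | succ k ih => exact Finset.sum_nonneg fun i _ => ih _

lemma pS_nonneg (k : ℕ) (K : Set Plane) (w : Plane → ℝ) : 0 ≤ pS k K w := by
  induction k generalizing w with
  | zero => exact integral_nonneg fun x => sq_nonneg _
  | succ k ih => exact Finset.sum_nonneg fun i _ => ih _

lemma nS_congr (hK : IsOpen K) (hw : w =ᵐ[volume.restrict K] w') : nS k K w = nS k K w' := by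
  induction k generalizing w w' with
  | zero => exact integral_congr_ae (by filter_upwards [hw] with x hx using by rw [hx])
  | succ k ih => exact Finset.sum_congr rfl fun i _ => ih (wD_congr hK hw)

lemma nS_eq_pS (hK : IsOpen K) (hb : Bornology.IsBounded K) {p : Plane → ℝ}
    (hp : ContDiff ℝ ∞ p) (hw : w =ᵐ[volume.restrict K] p) (k : ℕ) : nS k K w = pS k K p := by
  induction k generalizing w p with
  | zero => exact nS_congr (k := 0) hK hw
  | succ k ih =>
    exact Finset.sum_congr rfl fun i _ => ih (contDiff_pd hp i) (wD_ae_eq_pd hK hb hp hw i)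

/-- Weak derivatives on `U` restrict to those on the pieces, so only additivity of the integral over
disjoint sets is needed. It sums the `H³` seminorms over the triangles. -/
lemma sum_nS_le {ι : Type*} (S : Finset ι) (κ : ι → Set Plane) (hκ : ∀ s ∈ S, IsOpen (κ s))
    (hsub : ∀ s ∈ S, κ s ⊆ U) (hU : IsOpen U)
    (hdisj : (S : Set ι).PairwiseDisjoint κ) (h : Approx k U w) :
    ∑ s ∈ S, nS k (κ s) w ≤ nS k U w := by
  induction k generalizing w with
  | zero =>
    have hi : Integrable (fun x => w x ^ 2) (volume.restrict U) := h.memLp.integrable_sq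
    change ∑ s ∈ S, ∫ x in κ s, w x ^ 2 ≤ ∫ x in U, w x ^ 2
    rw [← integral_biUnion_finset S (fun s hs => (hκ s hs).measurableSet) hdisj
      fun s hs => IntegrableOn.mono_set hi (hsub s hs)]
    refine setIntegral_mono_set hi (Eventually.of_forall fun x => sq_nonneg _) ?_
    exact LE.le.eventuallyLE (iUnion₂_subset hsub)
  | succ k ih =>
    change ∑ s ∈ S, ∑ i, nS k (κ s) (wD (κ s) i w) ≤ ∑ i, nS k U (wD U i w)
    rw [Finset.sum_comm]
    refine Finset.sum_le_sum fun i _ => ?_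
    refine le_trans (le_of_eq ?_) (ih (h.wD hU i))
    exact Finset.sum_congr rfl fun s hs => nS_congr (hκ s hs) (h.wD_mono_ae (hκ s hs) (hsub s hs) i)

end conv

/-! ### Mollification -/

open scoped Convolution in
/-- The convolution of `f` with the kernel `κ`. -/
def smear (κ f : Plane → ℝ) : Plane → ℝ := f ⋆[ContinuousLinearMap.mul ℝ ℝ, volume] κ

lemma smear_apply (κ f : Plane → ℝ) (x : Plane) : smear κ f x = ∫ t, f t * κ (x - t) := rfl

lemma smear_apply_swap (κ f : Plane → ℝ) (x : Plane) :
    smear κ f x = ∫ y, f (x - y) * κ y := by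
  rw [smear, convolution_eq_swap]
  rfl

lemma contDiff_smear {κ f : Plane → ℝ} (hκ : ContDiff ℝ ∞ κ) (hc : HasCompactSupport κ)
    (hf : LocallyIntegrable f) : ContDiff ℝ ∞ (smear κ f) :=
  hc.contDiff_convolution_right _ hf hκ

lemma pd_smear {κ f : Plane → ℝ} (hκ : ContDiff ℝ ∞ κ) (hc : HasCompactSupport κ)
    (hf : LocallyIntegrable f) (i : Fin 2) : pd i (smear κ f) = smear (pd i κ) f := by
  ext x
  have h := hc.hasFDerivAt_convolution_right (ContinuousLinearMap.mul ℝ ℝ) hf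
    (hκ.of_le (by simp)) x
  rw [pd, smear, h.fderiv, convolution_precompR_apply]
  · rfl
  · exact hf
  · exact hc.fderiv ℝ
  · exact hκ.continuous_fderiv (by simp)

/-- The mollification error is the average of the differences `f(· - y) - f` under the probability
measure `κ dy`; Jensen's inequality and Tonelli's theorem bound it by the worst translation in the
support of `κ`. -/
lemma eLpNorm_smear_sub_le {κ f : Plane → ℝ} (hκ : ContDiff ℝ ∞ κ) (hc : HasCompactSupport κ)
    (h0 : ∀ y, 0 ≤ κ y) (h1 : ∫ y, κ y = 1) (hf : MemLp f 2 volume) {ε : ENNReal}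
    (hε : ∀ y, κ y ≠ 0 → eLpNorm (fun x => f (x - y) - f x) 2 volume ≤ ε) :
    eLpNorm (smear κ f - f) 2 volume ≤ ε := by
  -- A measurable representative is needed for joint measurability in Tonelli's theorem.
  wlog hm : Measurable f generalizing f
  · have hg := hf.1.ae_eq_mk
    have hs : smear κ f = smear κ (hf.1.mk f) := by
      ext x
      rw [smear_apply, smear_apply]
      refine integral_congr_ae ?_
      filter_upwards [hg] with t ht
      rw [ht]
    rw [hs, eLpNorm_congr_ae ((ae_eq_refl (smear κ (hf.1.mk f))).sub hg)]
    refine this (hf.ae_eq hg) (fun y hy => ?_) hf.1.stronglyMeasurable_mk.measurable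
    refine le_trans (le_of_eq (eLpNorm_congr_ae ?_)) (hε y hy)
    have := (measurePreserving_sub_right (volume : Measure Plane) y).quasiMeasurePreserving.ae_eq_comp
      hg
    exact (this.sub hg).symm
  have hκi : Integrable κ := hκ.continuous.integrable_of_hasCompactSupport hc
  have hκm : Measurable κ := hκ.continuous.measurable
  set ν : Measure Plane := volume.withDensity fun y => ENNReal.ofReal (κ y) with hν
  have hνp : IsProbabilityMeasure ν := by
    constructor
    rw [hν, withDensity_apply _ MeasurableSet.univ, Measure.restrict_univ,
      ← ofReal_integral_eq_lintegral_ofReal hκi (Eventually.of_forall h0), h1, ENNReal.ofReal_one]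
  have hint : ∀ g : Plane → ℝ, ∫ y, g y ∂ν = ∫ y, g y * κ y := by
    intro g
    rw [hν, integral_withDensity_eq_integral_toReal_smul (by fun_prop) (by simp)]
    refine integral_congr_ae (Eventually.of_forall fun y => ?_)
    simp [ENNReal.toReal_ofReal (h0 y), mul_comm]
  have hI : ∀ x, Integrable (fun y => f (x - y)) ν := by
    intro x
    rw [hν, integrable_withDensity_iff_integrable_smul' (by fun_prop) (by simp)]
    have hl : LocallyIntegrable (fun y => f (x - y)) := by
      have : MemLp (fun y => f (x - y)) 2 volume :=
        hf.comp_measurePreserving (Measure.measurePreserving_sub_left volume x)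
      exact this.locallyIntegrable (by norm_num)
    have := hl.integrable_smul_left_of_hasCompactSupport hκ.continuous hc
    refine this.congr (Eventually.of_forall fun y => ?_)
    simp [ENNReal.toReal_ofReal (h0 y)]
  have hpt : ∀ x, ‖smear κ f x - f x‖ₑ ^ (2 : ℝ) ≤ ∫⁻ y, ‖f (x - y) - f x‖ₑ ^ (2 : ℝ) ∂ν := by
    intro x
    have e : smear κ f x - f x = ∫ y, (f (x - y) - f x) ∂ν := by
      rw [integral_sub (hI x) (integrable_const _), smear_apply_swap, ← hint]
      simp
    have hm' : AEStronglyMeasurable (fun y => f (x - y) - f x) ν :=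
      ((hm.comp (measurable_const.sub measurable_id)).sub measurable_const).aestronglyMeasurable
    rw [e]
    have hle : ‖∫ y, (f (x - y) - f x) ∂ν‖ₑ ≤ eLpNorm (fun y => f (x - y) - f x) 2 ν := by
      refine (enorm_integral_le_lintegral_enorm _).trans ?_
      rw [← eLpNorm_one_eq_lintegral_enorm]
      exact eLpNorm_le_eLpNorm_of_exponent_le (by norm_num) hm'
    calc _ ≤ (eLpNorm (fun y => f (x - y) - f x) 2 ν) ^ (2 : ℝ) := by gcongr
      _ = _ := by
        have := eLpNorm_nnreal_pow_eq_lintegral (f := fun y => f (x - y) - f x) (μ := ν)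
          (p := 2) (by norm_num)
        simpa using this
  have hsq : ∀ g : Plane → ℝ, eLpNorm g 2 volume ^ (2 : ℝ) = ∫⁻ x, ‖g x‖ₑ ^ (2 : ℝ) := by
    intro g
    have := eLpNorm_nnreal_pow_eq_lintegral (f := g) (μ := volume) (p := 2) (by norm_num)
    simpa using this
  have hfin : eLpNorm (smear κ f - f) 2 volume ^ (2 : ℝ) ≤ ε ^ (2 : ℝ) := by
    rw [hsq]
    calc ∫⁻ x, ‖(smear κ f - f) x‖ₑ ^ (2 : ℝ)
        ≤ ∫⁻ x, ∫⁻ y, ‖f (x - y) - f x‖ₑ ^ (2 : ℝ) ∂ν := lintegral_mono hpt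
      _ = ∫⁻ y, (∫⁻ x, ‖f (x - y) - f x‖ₑ ^ (2 : ℝ) ∂volume) ∂ν := by
          refine lintegral_lintegral_swap ?_
          refine Measurable.aemeasurable ?_
          have : Measurable fun p : Plane × Plane => f (p.1 - p.2) - f p.1 := by fun_prop
          exact (this.enorm).pow_const _
      _ ≤ ∫⁻ _, ε ^ (2 : ℝ) ∂ν := by
          refine lintegral_mono_ae ?_
          rw [hν, ae_withDensity_iff (by fun_prop)]
          refine Eventually.of_forall fun y hy => ?_
          have hy' : κ y ≠ 0 := fun h => hy (by simp [h])
          have := hsq (fun x => f (x - y) - f x)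
          rw [← this]
          gcongr
          exact hε y hy'
      _ = ε ^ (2 : ℝ) := by simp
  exact (ENNReal.rpow_le_rpow_iff (by norm_num)).1 hfin

lemma tendsto_eLpNorm_translate {f : Plane → ℝ} (hf : MemLp f 2 volume) :
    Tendsto (fun y => eLpNorm (fun x => f (x - y) - f x) 2 volume) (𝓝 0) (𝓝 0) := by
  let g : C(Plane, C(Plane, Plane)) :=
    (ContinuousMap.mk (fun a : Plane × Plane => a.2 - a.1) (by fun_prop)).curry
  have hmp : ∀ y : Plane, MeasurePreserving (g y) (volume : Measure Plane) volume :=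
    fun y => measurePreserving_sub_right volume y
  have hc : Continuous fun y => Lp.compMeasurePreserving (g y) (hmp y) (hf.toLp f) :=
    Continuous.compMeasurePreservingLp continuous_const g.continuous hmp (by norm_num)
  have ht : Tendsto (fun y => Lp.compMeasurePreserving (g y) (hmp y) (hf.toLp f)) (𝓝 0)
      (𝓝 (hf.toLp f)) := by
    have := hc.tendsto 0
    have e : Lp.compMeasurePreserving (g 0) (hmp 0) (hf.toLp f) = hf.toLp f := by
      rw [Lp.toLp_compMeasurePreserving]
      refine (MemLp.toLp_eq_toLp_iff _ _).2 (Eventually.of_forall fun x => ?_)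
      simp [g]
    rwa [e] at this
  exact (Lp.tendsto_Lp_iff_tendsto_eLpNorm'' (fun y => f ∘ g y)
    (fun y => hf.comp_measurePreserving (hmp y)) _ hf).1 ht

/-! ### The local cone property of Lipschitz domains -/

/-- Near `z`, the set `Ω` is stable under small translations in the directions of a ball. -/
def LocalCone (Ω : Set Plane) (z : Plane) : Prop :=
  ∃ r > 0, ∃ d : Plane, ∃ ρ > 0, ∃ δ₀ > 0, ∀ x ∈ Ω, dist x z < r → ∀ δ : ℝ, 0 < δ → δ < δ₀ →
    ∀ y ∈ Metric.ball d ρ, x + δ • y ∈ Ω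

/-- At an interior point every short translation is allowed, so the central direction can be `0`. -/
lemma localCone_of_mem {Ω : Set Plane} (hΩ : IsOpen Ω) {z : Plane} (hz : z ∈ Ω) :
    LocalCone Ω z := by
  obtain ⟨r, hr, hb⟩ := Metric.isOpen_iff.1 hΩ z hz
  refine ⟨r / 2, half_pos hr, 0, 1, one_pos, r / 2, half_pos hr, fun x _ hxz δ h0 hδ y hy => ?_⟩
  apply hb
  rw [mem_ball_zero_iff] at hy
  rw [Metric.mem_ball, dist_eq_norm] at *
  calc ‖x + δ • y - z‖ = ‖(x - z) + δ • y‖ := by congr 1; abel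
    _ ≤ ‖x - z‖ + δ * ‖y‖ := (norm_add_le _ _).trans (by rw [norm_smul, Real.norm_of_nonneg h0.le])
    _ < r / 2 + r / 2 * 1 := by
      refine add_lt_add_of_lt_of_le hxz ?_
      gcongr
    _ = r := by ring

lemma abs_apply_le_norm (v : Plane) (i : Fin 2) : |v i| ≤ ‖v‖ := by
  simpa using PiLp.norm_apply_le v i

lemma affineIsometry_add (e : Plane ≃ᵃⁱ[ℝ] Plane) (x v : Plane) :
    e (x + v) = e x + e.linearIsometryEquiv v := by
  have := e.map_vadd x v
  simpa [vadd_eq_add, add_comm] using this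

lemma HasLipschitzBoundary.localCone {Ω : Set Plane} (h : HasLipschitzBoundary Ω) {z : Plane}
    (hz : z ∈ frontier Ω) : LocalCone Ω z := by
  obtain ⟨r, hr, e, g, ⟨L, hL⟩, hg⟩ := h z hz
  set d : Plane := e.linearIsometryEquiv.symm (EuclideanSpace.single 1 1) with hd
  have hdn : ‖d‖ = 1 := by simp [hd]
  have hL0 : (0 : ℝ) < L + 2 := by positivity
  -- Translations point upwards from the graph. The opening `1 / (L + 2)` ensures `L|y₀| < y₁`, so
  -- the motion climbs faster than a graph of slope `L`; since `‖y‖ ≤ 2`, the bound `r / 4` keeps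
  -- the translate in the chart.
  refine ⟨r / 2, half_pos hr, d, 1 / (L + 2), by positivity, r / 4, by positivity,
    fun x hx hxz δ h0 hδ y hy => ?_⟩
  rw [Metric.mem_ball, dist_eq_norm] at hy
  have hρ1 : 1 / ((L : ℝ) + 2) ≤ 1 := by
    rw [div_le_one hL0]
    linarith [L.coe_nonneg]
  have hyn : ‖y‖ ≤ 2 := by
    calc ‖y‖ = ‖d + (y - d)‖ := by congr 1; abel
      _ ≤ ‖d‖ + ‖y - d‖ := norm_add_le _ _
      _ ≤ 2 := by linarith
  have hxb : x ∈ Metric.ball z r := by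
    rw [Metric.mem_ball]; linarith
  have hyb : x + δ • y ∈ Metric.ball z r := by
    rw [Metric.mem_ball, dist_eq_norm] at *
    calc ‖x + δ • y - z‖ = ‖(x - z) + δ • y‖ := by congr 1; abel
      _ ≤ ‖x - z‖ + δ * ‖y‖ :=
        (norm_add_le _ _).trans (by rw [norm_smul, Real.norm_of_nonneg h0.le])
      _ < r / 2 + r / 4 * 2 := by
        refine add_lt_add_of_lt_of_le hxz ?_
        gcongr
      _ = r := by ring
  rw [hg _ hyb]
  have hx' := (hg _ hxb).1 hx
  set y' := e.linearIsometryEquiv y with hy'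
  have hsub : ‖y' - EuclideanSpace.single 1 1‖ < 1 / (L + 2) := by
    have : y' - EuclideanSpace.single 1 1 = e.linearIsometryEquiv (y - d) := by
      simp [hd, hy']
    rw [this, LinearIsometryEquiv.norm_map]
    exact hy
  have h0' : |y' 0| < 1 / (L + 2) := by
    have := abs_apply_le_norm (y' - EuclideanSpace.single 1 1) 0
    simp at this
    linarith
  have h1' : |y' 1 - 1| < 1 / (L + 2) := by
    have := abs_apply_le_norm (y' - EuclideanSpace.single 1 1) 1
    simp at this
    linarith
  have hLip := hL.dist_le_mul (e x 0 + δ * y' 0) (e x 0)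
  rw [affineIsometry_add, map_smul, ← hy']
  simp only [PiLp.add_apply, PiLp.smul_apply, smul_eq_mul]
  rw [Real.dist_eq, Real.dist_eq, add_sub_cancel_left, abs_mul, abs_of_pos h0] at hLip
  have hA := (abs_le.1 hLip).2
  have hB : (L : ℝ) * |y' 0| ≤ L * (1 / (L + 2)) := by gcongr
  have hC : (L : ℝ) * (1 / (L + 2)) + 1 / (L + 2) < 1 := by
    rw [← add_one_mul, mul_one_div, div_lt_one hL0]
    linarith
  have hD := (abs_lt.1 h1').1
  have hE : δ * (L * |y' 0|) < δ * y' 1 := by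
    apply mul_lt_mul_of_pos_left _ h0
    linarith
  nlinarith

/-- Just below a boundary point lies an open set free of `Ω`, so no boundary point is interior to
the closure. This places the interiors of the triangles inside `Ω`. -/
lemma HasLipschitzBoundary.interior_closure {Ω : Set Plane} (h : HasLipschitzBoundary Ω)
    (hΩ : IsOpen Ω) : interior (closure Ω) = Ω := by
  refine subset_antisymm (fun z hz => ?_) (interior_maximal subset_closure hΩ)
  by_contra hzΩ
  have hzf : z ∈ frontier Ω := ⟨interior_subset hz, by rwa [hΩ.interior_eq]⟩
  obtain ⟨r, hr, e, g, ⟨L, hL⟩, hg⟩ := h z hzf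
  set d : Plane := e.linearIsometryEquiv.symm (EuclideanSpace.single 1 1) with hd
  have hz' : e z 1 ≤ g (e z 0) := by
    by_contra hlt
    exact hzΩ ((hg z (Metric.mem_ball_self hr)).2 (not_le.1 hlt))
  have hc : Tendsto (fun t : ℝ => z - t • d) (𝓝[>] 0) (𝓝 z) := by
    have : Continuous fun t : ℝ => z - t • d := by fun_prop
    simpa using (this.tendsto 0).mono_left nhdsWithin_le_nhds
  have h1 : ∀ᶠ t in 𝓝[>] (0 : ℝ), z - t • d ∈ closure Ω ∩ Metric.ball z r ∧ 0 < t :=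
    ((hc.eventually (mem_interior_iff_mem_nhds.1 hz)).and
      (hc.eventually (Metric.ball_mem_nhds z hr))).and self_mem_nhdsWithin
  obtain ⟨t, ⟨htc, htb⟩, ht⟩ := h1.exists
  have hcont : ContinuousAt (fun y => g (e y 0) - e y 1) (z - t • d) := by
    have := hL.continuous
    have := e.continuous
    fun_prop
  have hpos : 0 < g (e (z - t • d) 0) - e (z - t • d) 1 := by
    rw [sub_eq_add_neg z, affineIsometry_add]
    simp [hd]
    linarith
  have hev := (hcont.eventually (lt_mem_nhds hpos)).and (Metric.isOpen_ball.mem_nhds htb)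
  obtain ⟨y, ⟨hy1, hy2⟩, hy3⟩ := mem_closure_iff_nhds.1 htc _ hev
  have := (hg y hy2).1 hy3
  linarith

/-! ### Density of smooth functions -/

/-- The smooth kernel of unit mass supported in the ball with centre `-δ d` and radius `δρ/2`. -/
def shiftBump (d : Plane) (ρ δ : ℝ) (h : 0 < δ * ρ / 4) : ContDiffBump (-(δ • d)) :=
  ⟨δ * ρ / 4, δ * ρ / 2, h, by linarith⟩

lemma convL2_smear {f : Plane → ℝ} (hf : MemLp f 2 volume) (d : Plane) {ρ : ℝ}
    {δ : ℕ → ℝ} (hδ : ∀ n, 0 < δ n * ρ / 4) (hδ0 : Tendsto δ atTop (𝓝 0)) :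
    Tendsto (fun n => eLpNorm (smear ((shiftBump d ρ (δ n) (hδ n)).normed volume) f - f) 2 volume)
      atTop (𝓝 0) := by
  rw [ENNReal.tendsto_nhds_zero]
  intro ε hε
  have h1 := (ENNReal.tendsto_nhds_zero.1 (tendsto_eLpNorm_translate hf)) ε hε
  obtain ⟨η, hη, hb⟩ := Metric.eventually_nhds_iff.1 h1
  have h2 : Tendsto (fun n => δ n * ρ / 2 + ‖δ n • d‖) atTop (𝓝 0) := by
    have : Continuous fun t : ℝ => t * ρ / 2 + ‖t • d‖ := by fun_prop
    have h3 := (this.tendsto 0).comp hδ0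
    simp only [zero_mul, zero_div, zero_smul, norm_zero, add_zero] at h3
    exact h3
  filter_upwards [h2.eventually (gt_mem_nhds hη)] with n hn
  refine eLpNorm_smear_sub_le (ContDiffBump.contDiff_normed _)
    (ContDiffBump.hasCompactSupport_normed _) (ContDiffBump.nonneg_normed _)
    (ContDiffBump.integral_normed _) hf fun y hy => hb ?_
  have hy' : y ∈ Function.support ((shiftBump d ρ (δ n) (hδ n)).normed volume) := hy
  rw [ContDiffBump.support_normed_eq, Metric.mem_ball, dist_eq_norm] at hy'
  rw [dist_zero_right]
  calc ‖y‖ = ‖(y - -(δ n • d)) + -(δ n • d)‖ := by congr 1; abel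
    _ ≤ ‖y - -(δ n • d)‖ + ‖δ n • d‖ := (norm_add_le _ _).trans (by rw [norm_neg])
    _ ≤ δ n * ρ / 2 + ‖δ n • d‖ := by gcongr; exact hy'.le
    _ < η := hn

/-- The extension of `w` by zero may fail to be weakly differentiable across the boundary, but when
the reflected kernel `t ↦ κ (x - t)` is supported in `Ω` it is itself an admissible test function.
-/
lemma pd_smear_of_isWeakPartial {Ω : Set Plane} (hΩ : IsOpen Ω) {κ w v : Plane → ℝ} {i : Fin 2}
    (hκ : ContDiff ℝ ∞ κ) (hc : HasCompactSupport κ) (hw : LocallyIntegrable (Ω.indicator w))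
    (hv : IsWeakPartial Ω i w v) {x : Plane} (hx : ∀ t, x - t ∈ tsupport κ → t ∈ Ω) :
    pd i (smear κ (Ω.indicator w)) x = smear κ (Ω.indicator v) x := by
  rw [pd_smear hκ hc hw, smear_apply, smear_apply]
  set ψ : Plane → ℝ := fun t => κ (x - t) with hψ
  have htest : IsTest Ω ψ := by
    have hts : tsupport ψ ⊆ (fun t => x - t) ⁻¹' tsupport κ :=
      closure_minimal (fun t ht => subset_tsupport κ ht)
        (IsClosed.preimage (by fun_prop) (isClosed_tsupport κ))
    exact ⟨by fun_prop, hc.comp_homeomorph (Homeomorph.subLeft x), fun t ht => hx t (hts ht)⟩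
  have hpd : ∀ t, pd i ψ t = - pd i κ (x - t) := by
    intro t
    have hd : DifferentiableAt ℝ κ (x - t) := hκ.differentiable (by simp) _
    have hs : HasFDerivAt (fun t : Plane => x - t) (-ContinuousLinearMap.id ℝ Plane) t :=
      (hasFDerivAt_id t).const_sub x
    have := hd.hasFDerivAt.comp t hs
    rw [pd, (show fderiv ℝ ψ t = _ from this.fderiv), pd]
    simp
  have hkey := hv.integral_eq ψ htest
  have hind : ∀ (u χ : Plane → ℝ), ∫ t, Ω.indicator u t * χ t = ∫ t in Ω, u t * χ t := by
    intro u χ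
    rw [← integral_indicator hΩ.measurableSet]
    refine integral_congr_ae (Eventually.of_forall fun t => ?_)
    by_cases ht : t ∈ Ω <;> simp [ht]
  rw [hind v ψ, hind w fun t => pd i κ (x - t)]
  simp_rw [hpd, mul_neg] at hkey
  rw [integral_neg, neg_inj] at hkey
  exact hkey

/-- The kernels are centred at `-δ d`, so the mollified value at `x` uses points `x + δ y` with `y`
near `d`, which lie in `Ω` by the cone property. Differentiation thus commutes with mollification up
to the boundary. -/
lemma conv_smear {Ω : Set Plane} (hΩ : IsOpen Ω) {z d : Plane} {r ρ δ₀ : ℝ} (hρ : 0 < ρ)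
    (hcone : ∀ x ∈ Ω, dist x z < r → ∀ δ : ℝ, 0 < δ → δ < δ₀ →
      ∀ y ∈ Metric.ball d ρ, x + δ • y ∈ Ω)
    {δ : ℕ → ℝ} (hδ : ∀ n, 0 < δ n * ρ / 4) (hδ₀ : ∀ n, δ n < δ₀) (hδ0 : Tendsto δ atTop (𝓝 0))
    {k : ℕ} {w : Plane → ℝ} (hw : MemH k Ω w) :
    Conv k (Ω ∩ Metric.ball z r)
      (fun n => smear ((shiftBump d ρ (δ n) (hδ n)).normed volume) (Ω.indicator w)) w := by
  have hK : IsOpen (Ω ∩ Metric.ball z r) := hΩ.inter Metric.isOpen_ball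
  have base : ∀ {w : Plane → ℝ}, MemLp w 2 (volume.restrict Ω) →
      ConvL2 (volume.restrict (Ω ∩ Metric.ball z r))
      (fun n => smear ((shiftBump d ρ (δ n) (hδ n)).normed volume) (Ω.indicator w)) w := by
    intro w hw
    have hf : MemLp (Ω.indicator w) 2 volume := (memLp_indicator_iff_restrict hΩ.measurableSet).2 hw
    have ht := convL2_smear hf d hδ hδ0
    have hl : LocallyIntegrable (Ω.indicator w) := hf.locallyIntegrable (by norm_num)
    have hb : Bornology.IsBounded (Ω ∩ Metric.ball z r) :=
      Metric.isBounded_ball.subset inter_subset_right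
    refine ConvL2.congr (F := Ω.indicator w) ⟨fun n => memLp_of_contDiff hb ?_,
      hf.restrict _, ?_⟩ (fun n => ae_eq_rfl) ?_
    · exact contDiff_smear (ContDiffBump.contDiff_normed _)
        (ContDiffBump.hasCompactSupport_normed _) hl
    · exact tendsto_of_tendsto_of_tendsto_of_le_of_le tendsto_const_nhds ht (fun _ => zero_le)
        fun n => eLpNorm_mono_measure _ Measure.restrict_le_self
    · rw [Filter.EventuallyEq, ae_restrict_iff' hK.measurableSet]
      exact Eventually.of_forall fun x hx => indicator_of_mem hx.1 w
  induction k generalizing w with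
  | zero => exact base hw
  | succ k ih =>
    refine ⟨base hw.1, fun i => ?_⟩
    obtain ⟨v, hv, hvk⟩ := hw.2 i
    refine ⟨v, (ih hvk).congr_seq hK fun n x hx => ?_⟩
    have hl : LocallyIntegrable (Ω.indicator w) :=
      ((memLp_indicator_iff_restrict hΩ.measurableSet).2 hw.1).locallyIntegrable (by norm_num)
    refine (pd_smear_of_isWeakPartial hΩ (ContDiffBump.contDiff_normed _)
      (ContDiffBump.hasCompactSupport_normed _) hl hv fun t ht => ?_).symm
    rw [ContDiffBump.tsupport_normed_eq, Metric.mem_closedBall, dist_eq_norm,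
      sub_neg_eq_add] at ht
    have h1 : ‖x - t + δ n • d‖ ≤ δ n * ρ / 2 := ht
    have hδp : 0 < δ n := by
      have := hδ n
      by_contra hneg
      nlinarith
    have h2 : t = x + δ n • ((δ n)⁻¹ • (t - x)) := by
      rw [smul_inv_smul₀ hδp.ne']; abel
    rw [h2]
    refine hcone x hx.1 hx.2 _ hδp (hδ₀ n) _ ?_
    rw [Metric.mem_ball, dist_eq_norm]
    have h3 : (δ n)⁻¹ • (t - x) - d = -((δ n)⁻¹ • (x - t + δ n • d)) := by
      rw [smul_add, inv_smul_smul₀ hδp.ne', ← neg_sub x t, smul_neg]; abel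
    rw [h3, norm_neg, norm_smul, norm_inv, Real.norm_of_nonneg hδp.le]
    calc (δ n)⁻¹ * ‖x - t + δ n • d‖ ≤ (δ n)⁻¹ * (δ n * ρ / 2) := by gcongr
      _ = ρ / 2 := by field_simp
      _ < ρ := by linarith

lemma LocalCone.approx {Ω : Set Plane} (hΩ : IsOpen Ω) {z : Plane} (h : LocalCone Ω z) {k : ℕ}
    {w : Plane → ℝ} (hw : MemH k Ω w) : ∃ r > 0, Approx k (Ω ∩ Metric.ball z r) w := by
  obtain ⟨r, hr, d, ρ, hρ, δ₀, hδ₀, hcone⟩ := h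
  -- The shift by `2` keeps the step strictly below `δ₀` from `n = 0` on.
  have hpos : ∀ n : ℕ, 0 < δ₀ / (n + 2) := fun n => by positivity
  have hδ : ∀ n : ℕ, 0 < δ₀ / (n + 2) * ρ / 4 := fun n => by positivity
  have hlim : Tendsto (fun n : ℕ => δ₀ / (n + 2)) atTop (𝓝 0) := by
    have := (tendsto_const_div_atTop_nhds_zero_nat δ₀).comp (tendsto_add_atTop_nat 2)
    refine this.congr fun n => ?_
    simp
  have hL2 : MemLp w 2 (volume.restrict Ω) := by
    cases k with
    | zero => exact hw
    | succ k => exact hw.1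
  refine ⟨r, hr, _, fun n => ?_, conv_smear hΩ hρ hcone hδ (fun n => ?_) hlim hw⟩
  · exact contDiff_smear (ContDiffBump.contDiff_normed _)
      (ContDiffBump.hasCompactSupport_normed _)
      (((memLp_indicator_iff_restrict hΩ.measurableSet).2 hL2).locallyIntegrable (by norm_num))
  · rw [div_lt_iff₀ (by positivity)]
    nlinarith [n.cast_nonneg (α := ℝ)]

/-- A cutoff supported in `B` turns convergence on `Ω ∩ B` into convergence on all of `Ω`; the
product rule drives the induction on the order, with `pd i χ` as a new cutoff. -/
lemma Conv.cutoff {Ω B : Set Plane} (hB : IsOpen B) {k : ℕ}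
    {φ : ℕ → Plane → ℝ} {w χ : Plane → ℝ} (hφ : ∀ n, ContDiff ℝ ∞ (φ n))
    (hχ : ContDiff ℝ ∞ χ) (hχc : HasCompactSupport χ) (hχB : tsupport χ ⊆ B)
    (h : Conv k (Ω ∩ B) φ w) : Conv k Ω (fun n => χ * φ n) (χ * w) := by
  have base : ∀ {φ : ℕ → Plane → ℝ} {w χ : Plane → ℝ},
      ContDiff ℝ ∞ χ → HasCompactSupport χ → tsupport χ ⊆ B →
      ConvL2 (volume.restrict (Ω ∩ B)) φ w →
      ConvL2 (volume.restrict Ω) (fun n => χ * φ n) (χ * w) := by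
    intro φ w χ hχ hχc hχB h
    obtain ⟨c, hc⟩ := hχc.exists_bound_of_continuous hχ.continuous
    have h1 := h.bdd_mul hχ.continuous.aestronglyMeasurable hc
    have hz : ∀ (u : Plane → ℝ), ∀ x ∉ B, (χ * u) x = 0 := fun u x hx => by
      rw [Pi.mul_apply, image_eq_zero_of_notMem_tsupport fun hx' => hx (hχB hx'), zero_mul]
    have hr : volume.restrict (Ω ∩ B) = (volume.restrict Ω).restrict B := by
      rw [Measure.restrict_restrict hB.measurableSet, inter_comm]
    have hi : ∀ {u : Plane → ℝ}, (∀ x ∉ B, u x = 0) → B.indicator u = u := fun hu => by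
      ext x
      by_cases hx : x ∈ B
      · simp [hx]
      · simp [hx, hu x hx]
    have hm : ∀ u, MemLp (χ * u) 2 (volume.restrict (Ω ∩ B)) → MemLp (χ * u) 2 (volume.restrict Ω) := by
      intro u hu
      rw [hr, ← memLp_indicator_iff_restrict hB.measurableSet, hi (hz u)] at hu
      exact hu
    refine ⟨fun n => hm _ (h1.memLp n), hm _ h1.memLp_lim, h1.tendsto.congr fun n => ?_⟩
    rw [hr, ← eLpNorm_indicator_eq_eLpNorm_restrict hB.measurableSet, hi]
    intro x hx
    simp [hz _ x hx]
  induction k generalizing φ w χ with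
  | zero => exact base hχ hχc hχB h
  | succ k ih =>
    refine ⟨base hχ hχc hχB h.1, fun i => ?_⟩
    obtain ⟨v, hv⟩ := h.2 i
    have hχ' := contDiff_pd hχ i
    have hs := tsupport_pd_subset χ i
    have hc' : HasCompactSupport (pd i χ) := hχc.mono' ((subset_tsupport _).trans hs)
    refine ⟨pd i χ * w + χ * v, ?_⟩
    simp_rw [fun n => pd_mul hχ (hφ n) i]
    exact (ih hφ hχ' hc' (hs.trans hχB) h.of_succ).add (fun n => hχ'.mul (hφ n))
      (fun n => hχ.mul (contDiff_pd (hφ n) i))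
      (ih (fun n => contDiff_pd (hφ n) i) hχ hχc hχB hv)

lemma Approx.sum {K : Set Plane} (hK : Bornology.IsBounded K) {k : ℕ} {ι : Type*} (S : Finset ι)
    {w : ι → Plane → ℝ} (h : ∀ i ∈ S, Approx k K (w i)) : Approx k K (∑ i ∈ S, w i) := by
  classical
  induction S using Finset.induction_on with
  | empty => simpa using Approx.of_contDiff hK (p := 0) contDiff_const k
  | insert a S ha ih =>
    rw [Finset.sum_insert ha]
    exact (h a (by simp)).add (ih fun i hi => h i (by simp [hi]))

open scoped Manifold in
/-- Smooth functions are dense in `Hᵏ(Ω)` for bounded Lipschitz domains. -/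
theorem MemH.approx {Ω : Set Plane} (hΩ : IsOpen Ω) (hb : Bornology.IsBounded Ω)
    (hL : HasLipschitzBoundary Ω) {k : ℕ} {w : Plane → ℝ} (hw : MemH k Ω w) : Approx k Ω w := by
  have hcone : ∀ z ∈ closure Ω, LocalCone Ω z := by
    intro z hz
    by_cases hzΩ : z ∈ Ω
    · exact localCone_of_mem hΩ hzΩ
    · exact hL.localCone ⟨hz, by rwa [hΩ.interior_eq]⟩
  have h1 : ∀ z : closure Ω, ∃ r > 0, Approx k (Ω ∩ Metric.ball z r) w :=
    fun z => (hcone z z.2).approx hΩ hw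
  choose r hr ha using h1
  -- Finitely many local approximations cover the compact closure and are glued by a subordinate
  -- partition of unity.
  obtain ⟨S, hS⟩ := hb.isCompact_closure.elim_finite_subcover (fun z : closure Ω => Metric.ball z.1 (r z))
    (fun z => Metric.isOpen_ball) fun z hz => mem_iUnion.2 ⟨⟨z, hz⟩, Metric.mem_ball_self (hr _)⟩
  obtain ⟨f, hf⟩ := SmoothPartitionOfUnity.exists_isSubordinate 𝓘(ℝ, Plane) isClosed_closure
    (fun z : S => Metric.ball z.1.1 (r z.1)) (fun z => Metric.isOpen_ball)
    (fun x hx => by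
      obtain ⟨z, hz, hxz⟩ := mem_iUnion₂.1 (hS hx)
      exact mem_iUnion.2 ⟨⟨z, hz⟩, hxz⟩)
  have hpart : ∀ z : S, Approx k Ω (f z * w) := by
    intro z
    obtain ⟨φ, hφ, hc⟩ := ha z.1
    have hsm : ContDiff ℝ ∞ (f z) := (f z).contMDiff.contDiff
    have hcs : HasCompactSupport (f z) :=
      HasCompactSupport.of_support_subset_isCompact (isCompact_closedBall z.1.1 (r z.1))
        ((subset_tsupport _).trans ((hf z).trans Metric.ball_subset_closedBall))
    exact ⟨_, fun n => hsm.mul (hφ n),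
      Conv.cutoff Metric.isOpen_ball hφ hsm hcs (hf z) hc⟩
  refine (Approx.sum hb Finset.univ fun z _ => hpart z).congr ?_
  rw [Filter.EventuallyEq, ae_restrict_iff' hΩ.measurableSet]
  refine Eventually.of_forall fun x hx => ?_
  have h2 := f.sum_eq_one (subset_closure hx)
  rw [finsum_eq_sum_of_fintype] at h2
  rw [Finset.sum_apply]
  simp only [Pi.mul_apply]
  rw [← Finset.sum_mul, h2, one_mul]

/-! ### Integration over triangles and edges -/

/-- The determinant of two vectors of the plane. -/
def det2 (u v : Plane) : ℝ := u 0 * v 1 - u 1 * v 0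

/-- The affine map sending the reference triangle to the triangle `a b c`. -/
def refMap (a b c : Plane) (s t : ℝ) : Plane := a + s • (b - a) + t • (c - a)

/-- The closed triangle with vertices `a`, `b`, `c`. -/
def tri (a b c : Plane) : Set Plane := convexHull ℝ {a, b, c}

lemma continuous_refMap (a b c : Plane) :
    Continuous fun p : ℝ × ℝ => refMap a b c p.1 p.2 := by
  unfold refMap; fun_prop

lemma mem_tri_iff {a b c x : Plane} :
    x ∈ tri a b c ↔ ∃ s t : ℝ, 0 ≤ s ∧ 0 ≤ t ∧ s + t ≤ 1 ∧ x = refMap a b c s t := by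
  constructor
  · intro hx
    have hconv : Convex ℝ {x | ∃ s t : ℝ, 0 ≤ s ∧ 0 ≤ t ∧ s + t ≤ 1 ∧ x = refMap a b c s t} := by
      rintro x ⟨s, t, hs, ht, hst, rfl⟩ y ⟨s', t', hs', ht', hst', rfl⟩ p q hp hq hpq
      refine ⟨p * s + q * s', p * t + q * t', by positivity, by positivity, ?_, ?_⟩
      · nlinarith
      · obtain rfl : q = 1 - p := by linarith
        unfold refMap
        module
    refine convexHull_min ?_ hconv hx
    rintro y (rfl | rfl | rfl)
    · exact ⟨0, 0, by simp [refMap]⟩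
    · exact ⟨1, 0, by simp [refMap]⟩
    · exact ⟨0, 1, by simp [refMap]⟩
  · rintro ⟨s, t, hs, ht, hst, rfl⟩
    have ha : a ∈ tri a b c := subset_convexHull ℝ _ (by simp)
    have hb : b ∈ tri a b c := subset_convexHull ℝ _ (by simp)
    have hc : c ∈ tri a b c := subset_convexHull ℝ _ (by simp)
    have := (convex_convexHull ℝ ({a, b, c} : Set Plane)).sum_mem (t := Finset.univ)
      (w := ![1 - s - t, s, t]) (z := ![a, b, c])
      (by
        intro i _
        fin_cases i
        · simp; linarith
        · simpa using hs
        · simpa using ht)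
      (by simp [Fin.sum_univ_three]; ring)
      (by
        intro i _
        fin_cases i
        · exact ha
        · exact hb
        · exact hc)
    simp only [Fin.sum_univ_three, Matrix.cons_val_zero, Matrix.cons_val_one,
      Matrix.cons_val_two, Matrix.head_cons, Matrix.tail_cons] at this
    convert! this using 1
    simp [refMap]
    module

lemma isCompact_tri (a b c : Plane) : IsCompact (tri a b c) :=
  (Set.toFinite {a, b, c}).isCompact_convexHull ℝ

/-- Fubini and the substitution `x = (1 - t) s` collapse the square onto the triangle; the Jacobian
`1 - t` vanishes at the apex, which the trace inequality exploits. -/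
lemma setIntegral_refTriangle {G : ℝ × ℝ → ℝ} (hG : Continuous G) :
    ∫ p in {p : ℝ × ℝ | 0 ≤ p.1 ∧ 0 ≤ p.2 ∧ p.1 + p.2 ≤ 1}, G p =
      ∫ t in (0 : ℝ)..1, (1 - t) * ∫ s in (0 : ℝ)..1, G ((1 - t) * s, t) := by
  set S : Set (ℝ × ℝ) := {p | 0 ≤ p.1 ∧ 0 ≤ p.2 ∧ p.1 + p.2 ≤ 1} with hS
  have hcl : IsClosed S := by
    refine (isClosed_le continuous_const continuous_fst).inter
      ((isClosed_le continuous_const continuous_snd).inter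
        (isClosed_le (continuous_fst.add continuous_snd) continuous_const))
  have hsub : S ⊆ Icc 0 1 ×ˢ Icc 0 1 := by
    rintro ⟨x, y⟩ ⟨h1, h2, h3⟩
    simp only at h1 h2 h3
    exact ⟨⟨h1, by linarith⟩, ⟨h2, by linarith⟩⟩
  have hcomp : IsCompact S := (isCompact_Icc.prod isCompact_Icc).of_isClosed_subset hcl hsub
  have hint : Integrable (S.indicator G) :=
    (integrable_indicator_iff hcl.measurableSet).2 (hG.continuousOn.integrableOn_compact hcomp)
  rw [← integral_indicator hcl.measurableSet, Measure.volume_eq_prod, integral_prod_symm _ hint,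
    intervalIntegral.integral_of_le zero_le_one, ← integral_Icc_eq_integral_Ioc,
    ← integral_indicator measurableSet_Icc]
  refine integral_congr_ae (Eventually.of_forall fun t => ?_)
  by_cases ht : t ∈ Icc (0 : ℝ) 1
  · rw [indicator_of_mem ht]
    have h1 := intervalIntegral.mul_integral_comp_mul_left (a := 0) (b := 1)
      (f := fun x => G (x, t)) (c := 1 - t)
    simp only [mul_zero, mul_one] at h1
    rw [h1, intervalIntegral.integral_of_le (by linarith [ht.2]), ← integral_Icc_eq_integral_Ioc,
      ← integral_indicator measurableSet_Icc]
    refine integral_congr_ae (Eventually.of_forall fun x => ?_)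
    have : (x, t) ∈ S ↔ x ∈ Icc 0 (1 - t) := by
      simp only [hS, mem_ofPred_eq, mem_Icc]
      constructor
      · rintro ⟨h1, h2, h3⟩; exact ⟨h1, by linarith⟩
      · rintro ⟨h1, h2⟩; exact ⟨h1, ht.1, by linarith⟩
    by_cases hx : x ∈ Icc 0 (1 - t)
    · simp only [indicator_of_mem hx, indicator_of_mem (this.2 hx)]
    · simp only [indicator_of_notMem hx, indicator_of_notMem (fun h => hx (this.1 h))]
  · rw [indicator_of_notMem ht]
    refine (integral_congr_ae (Eventually.of_forall fun x => ?_)).trans (integral_zero ℝ ℝ)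
    exact indicator_of_notMem (fun h => ht (hsub h).2) _

/-- The linear map with columns `u` and `v`. -/
def colMap (u v : Plane) : Plane →L[ℝ] Plane :=
  (EuclideanSpace.proj 0 : Plane →L[ℝ] ℝ).smulRight u +
    (EuclideanSpace.proj 1 : Plane →L[ℝ] ℝ).smulRight v

lemma colMap_apply (u v x : Plane) : colMap u v x = x 0 • u + x 1 • v := rfl

lemma det_colMap (u v : Plane) : (colMap u v).det = det2 u v := by
  rw [ContinuousLinearMap.det,
    ← LinearMap.det_toMatrix (EuclideanSpace.basisFun (Fin 2) ℝ).toBasis, Matrix.det_fin_two]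
  simp [LinearMap.toMatrix_apply, colMap, det2]
  ring

lemma integral_tri {a b c : Plane} (hD : det2 (b - a) (c - a) ≠ 0) {F : Plane → ℝ}
    (hF : Continuous F) : ∫ x in tri a b c, F x = |det2 (b - a) (c - a)| *
      ∫ t in (0 : ℝ)..1, (1 - t) * ∫ s in (0 : ℝ)..1, F (refMap a b c ((1 - t) * s) t) := by
  set L := colMap (b - a) (c - a) with hL
  set S : Set (ℝ × ℝ) := {p | 0 ≤ p.1 ∧ 0 ≤ p.2 ∧ p.1 + p.2 ≤ 1} with hS
  let e : Plane ≃ᵐ ℝ × ℝ :=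
    (MeasurableEquiv.toLp 2 (Fin 2 → ℝ)).symm.trans MeasurableEquiv.finTwoArrow
  have he : MeasurePreserving e volume volume :=
    (volume_preserving_finTwoArrow ℝ).comp (PiLp.volume_preserving_ofLp (Fin 2))
  have hee : ∀ x : Plane, e x = (x 0, x 1) := fun x => rfl
  have himg : tri a b c = (fun x => a + L x) '' (e ⁻¹' S) := by
    ext x
    rw [mem_tri_iff]
    constructor
    · rintro ⟨s, t, hs, ht, hst, rfl⟩
      refine ⟨!₂[s, t], ⟨by simpa [hee] using hs, by simpa [hee] using ht, by simpa [hee] using hst⟩, ?_⟩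
      simp [hL, colMap_apply, refMap, add_assoc]
    · rintro ⟨y, ⟨h1, h2, h3⟩, rfl⟩
      exact ⟨y 0, y 1, h1, h2, h3, by simp [hL, colMap_apply, refMap, add_assoc]⟩
  have hSm : MeasurableSet S := by
    refine IsClosed.measurableSet ?_
    exact (isClosed_le continuous_const continuous_fst).inter
      ((isClosed_le continuous_const continuous_snd).inter
        (isClosed_le (continuous_fst.add continuous_snd) continuous_const))
  have hinj : InjOn (fun x => a + L x) (e ⁻¹' S) := by
    intro x _ y _ hxy
    have h1 : L x = L y := add_left_cancel hxy
    have h2 : L (x - y) = 0 := by rw [map_sub, h1, sub_self]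
    have h3 : LinearMap.det (L : Plane →ₗ[ℝ] Plane) ≠ 0 := by
      have := det_colMap (b - a) (c - a)
      rw [ContinuousLinearMap.det] at this
      rwa [this]
    have h4 : LinearMap.ker (L : Plane →ₗ[ℝ] Plane) = ⊥ := by
      by_contra hne
      exact h3 (LinearMap.det_eq_zero_iff_ker_ne_bot.2 hne)
    exact sub_eq_zero.1 ((LinearMap.ker_eq_bot'.1 h4) _ h2)
  rw [himg, integral_image_eq_integral_abs_det_fderiv_smul volume (e.measurable hSm) (f' := fun _ => L)
    (fun x _ => (L.hasFDerivAt.const_add a).hasFDerivWithinAt) hinj]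
  simp_rw [smul_eq_mul]
  rw [integral_const_mul, hL, det_colMap]
  congr 1
  rw [← setIntegral_refTriangle (G := fun p => F (refMap a b c p.1 p.2))
    (hF.comp (continuous_refMap a b c)),
    ← he.setIntegral_preimage_emb e.measurableEmbedding]
  refine setIntegral_congr_fun (e.measurable hSm) fun x _ => ?_
  simp [hee, colMap_apply, refMap, add_assoc]

lemma volume_real_tri {a b c : Plane} (hD : det2 (b - a) (c - a) ≠ 0) :
    volume.real (tri a b c) = |det2 (b - a) (c - a)| / 2 := by
  have h := integral_tri hD (F := fun _ => (1 : ℝ)) continuous_const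
  simp only [integral_const, MeasurableSet.univ, measureReal_restrict_apply, univ_inter,
    smul_eq_mul, mul_one, intervalIntegral.integral_const, sub_zero] at h
  rw [h, intervalIntegral.integral_sub (by simp) (by simp)]
  simp
  ring

/-- The parametrisation of the edge `a b`. -/
def edgeMap (a b : Plane) (s : ℝ) : Plane := a + s • (b - a)

@[fun_prop]
lemma continuous_edgeMap (a b : Plane) : Continuous (edgeMap a b) := by
  unfold edgeMap; fun_prop

/-- The arc length parametrisation is an isometric embedding of the line, so it carries Lebesgue
measure to one-dimensional Hausdorff measure. -/
lemma integral_segment {a b : Plane} (hab : a ≠ b) (F : Plane → ℝ) :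
    ∫ x in segment ℝ a b, F x ∂μH[1] = ‖b - a‖ * ∫ s in (0 : ℝ)..1, F (edgeMap a b s) := by
  have hl : 0 < ‖b - a‖ := norm_pos_iff.2 (sub_ne_zero.2 hab.symm)
  set l := ‖b - a‖ with hl'
  set γ : ℝ → Plane := fun r => a + r • (l⁻¹ • (b - a)) with hγ
  have hiso : Isometry γ := by
    refine Isometry.of_dist_eq fun x y => ?_
    rw [dist_eq_norm, dist_eq_norm]
    have : γ x - γ y = (x - y) • (l⁻¹ • (b - a)) := by simp only [hγ]; module
    rw [this, norm_smul, norm_smul, norm_inv, ← hl', Real.norm_of_nonneg hl.le,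
      inv_mul_cancel₀ hl.ne', mul_one]
  have hseg : segment ℝ a b = γ '' Icc 0 l := by
    rw [segment_eq_image']
    ext x
    constructor
    · rintro ⟨t, ⟨h0, h1⟩, rfl⟩
      refine ⟨t * l, ⟨by positivity, by nlinarith⟩, ?_⟩
      simp only [hγ, smul_smul]
      congr 2
      field_simp
    · rintro ⟨r, ⟨h0, h1⟩, rfl⟩
      refine ⟨r * l⁻¹, ⟨by positivity, by rw [← div_eq_mul_inv, div_le_one hl]; exact h1⟩, ?_⟩
      simp only [hγ, smul_smul]
  have hemb := hiso.isClosedEmbedding.measurableEmbedding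
  have hmap := hiso.map_hausdorffMeasure (d := 1) (Or.inl zero_le_one)
  rw [hausdorffMeasure_real] at hmap
  have hsub : segment ℝ a b ⊆ range γ := hseg ▸ image_subset_range _ _
  have hms : MeasurableSet (segment ℝ a b) := by
    rw [hseg]; exact hemb.measurableSet_image.2 measurableSet_Icc
  have h1 : (μH[1]).restrict (segment ℝ a b) =
      (Measure.map γ volume).restrict (segment ℝ a b) := by
    rw [hmap, Measure.restrict_restrict hms, inter_eq_left.2 hsub]
  rw [h1, hemb.setIntegral_map, hseg, preimage_image_eq _ hiso.injective,
    integral_Icc_eq_integral_Ioc, ← intervalIntegral.integral_of_le hl.le]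
  have h2 := intervalIntegral.mul_integral_comp_mul_left (a := 0) (b := 1)
      (f := fun r => F (γ r)) (c := l)
  simp only [mul_zero, mul_one] at h2
  rw [← h2]
  congr 1
  refine intervalIntegral.integral_congr fun s _ => ?_
  simp only [hγ, edgeMap, smul_smul]
  congr 3
  field_simp

lemma interior_ae_eq {K : Set Plane} (hK : Convex ℝ K) : interior K =ᵐ[volume] K :=
  interior_ae_eq_of_null_frontier (hK.addHaar_frontier volume)

lemma setIntegral_interior {K : Set Plane} (hK : Convex ℝ K) (F : Plane → ℝ) :
    ∫ x in interior K, F x = ∫ x in K, F x :=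
  setIntegral_congr_set (interior_ae_eq hK)

/-! ### The trace inequality -/

lemma sq_fderiv_le (ψ : Plane → ℝ) (x v : Plane) :
    (fderiv ℝ ψ x v) ^ 2 ≤ ‖v‖ ^ 2 * ∑ i, pd i ψ x ^ 2 := by
  rw [fderiv_apply_eq_sum, EuclideanSpace.norm_sq_eq]
  simpa using Finset.sum_mul_sq_le_sq_mul_sq Finset.univ (fun i => v i) (fun i => pd i ψ x)

lemma pS_zero_add_pS_one {K : Set Plane} (hb : Bornology.IsBounded K) {ψ : Plane → ℝ}
    (hψ : ContDiff ℝ ∞ ψ) (p q : ℝ) :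
    ∫ x in K, (p * ψ x ^ 2 + q * ∑ i, pd i ψ x ^ 2) = p * pS 0 K ψ + q * pS 1 K ψ := by
  have hi : ∀ {g : Plane → ℝ}, ContDiff ℝ ∞ g → Integrable (fun x => g x ^ 2) (volume.restrict K) :=
    fun hg => (memLp_of_contDiff hb hg).integrable_sq
  rw [integral_add ((hi hψ).const_mul p)
    ((integrable_finsetSum _ fun i _ => hi (contDiff_pd hψ i)).const_mul q),
    integral_const_mul, integral_const_mul, integral_finsetSum _ fun i _ => hi (contDiff_pd hψ i)]
  rfl

/-- Each point of the edge `a b` is joined to the opposite vertex `c` by a segment, along which `(1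
- t)² ψ²` drops to zero. The fundamental theorem of calculus leaves one weight `1 - t`, precisely
the Jacobian of the collapsed coordinates. -/
lemma trace_inequality {a b c : Plane} (hD : det2 (b - a) (c - a) ≠ 0) {h : ℝ}
    (hac : ‖c - a‖ ≤ h) (hbc : ‖c - b‖ ≤ h) {ψ : Plane → ℝ} (hψ : ContDiff ℝ ∞ ψ) :
    ∫ s in (0 : ℝ)..1, ψ (edgeMap a b s) ^ 2 ≤ 1 / |det2 (b - a) (c - a)| *
      (3 * pS 0 (interior (tri a b c)) ψ + h ^ 2 * pS 1 (interior (tri a b c)) ψ) := by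
  set D := |det2 (b - a) (c - a)| with hDdef
  have hDpos : 0 < D := abs_pos.2 hD
  set F : Plane → ℝ := fun x => 3 * ψ x ^ 2 + h ^ 2 * ∑ i, pd i ψ x ^ 2 with hF
  have hψc := hψ.continuous
  have hpc : ∀ i, Continuous (pd i ψ) := fun i => (contDiff_pd hψ i).continuous
  have hFc : Continuous F := by fun_prop
  have hFint := integral_tri hD hFc
  rw [tri, ← setIntegral_interior (convex_convexHull ℝ _), ← tri,
    pS_zero_add_pS_one ((isCompact_tri a b c).isBounded.subset interior_subset) hψ] at hFint
  rw [hFint, ← mul_assoc, one_div, inv_mul_cancel₀ hDpos.ne', one_mul]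
  have hrc : Continuous fun p : ℝ × ℝ => refMap a b c ((1 - p.2) * p.1) p.2 := by
    unfold refMap; fun_prop
  have hswap : ∫ t in (0 : ℝ)..1, (1 - t) * ∫ s in (0 : ℝ)..1, F (refMap a b c ((1 - t) * s) t) =
      ∫ s in (0 : ℝ)..1, ∫ t in (0 : ℝ)..1, (1 - t) * F (refMap a b c ((1 - t) * s) t) := by
    simp_rw [← intervalIntegral.integral_const_mul]
    refine intervalIntegral_intervalIntegral_swap ?_
    have hj : Continuous (Function.uncurry fun t s => (1 - t) * F (refMap a b c ((1 - t) * s) t)) := by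
      unfold refMap
      fun_prop
    refine (hj.continuousOn.integrableOn_compact
      ((isCompact_uIcc (a := 0) (b := 1)).prod (isCompact_uIcc (a := 0) (b := 1)))).mono_set
      (prod_mono uIoc_subset_uIcc uIoc_subset_uIcc)
  rw [hswap]
  refine intervalIntegral.integral_mono_on zero_le_one ?_ ?_ fun s hs => ?_
  · exact Continuous.intervalIntegrable ((hψc.comp (continuous_edgeMap a b)).pow 2) _ _
  · refine Continuous.intervalIntegrable ?_ _ _
    have hj : Continuous (Function.uncurry fun s t => (1 - t) * F (refMap a b c ((1 - t) * s) t)) := by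
      unfold refMap
      fun_prop
    exact intervalIntegral.continuous_parametric_intervalIntegral_of_continuous' hj 0 1
  -- This is the vector from the edge point to `c`, a convex combination of two sides and hence of
  -- length at most `h`.
  set v : Plane := (c - a) - s • (b - a) with hv
  have hvn : ‖v‖ ≤ h := by
    have : v = (1 - s) • (c - a) + s • (c - b) := by rw [hv]; module
    rw [this]
    calc _ ≤ ‖(1 - s) • (c - a)‖ + ‖s • (c - b)‖ := norm_add_le _ _
      _ = (1 - s) * ‖c - a‖ + s * ‖c - b‖ := by
        rw [norm_smul, norm_smul, Real.norm_of_nonneg hs.1,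
          Real.norm_of_nonneg (sub_nonneg.2 hs.2)]
      _ ≤ (1 - s) * h + s * h := by
        have := hs.1
        have := sub_nonneg.2 hs.2
        gcongr
      _ = h := by ring
  set G : ℝ → Plane := fun t => refMap a b c ((1 - t) * s) t with hG
  have hGd : ∀ t, HasDerivAt G v t := by
    intro t
    have h1 : G = fun t => (a + s • (b - a)) + t • v := by
      ext1 t; simp only [hG, refMap, hv]; module
    rw [h1]
    simpa using ((hasDerivAt_id t).smul_const v).const_add (a + s • (b - a))
  have hψG : ∀ t, HasDerivAt (fun t => ψ (G t)) (fderiv ℝ ψ (G t) v) t := fun t =>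
    (hψ.differentiable (by simp) (G t)).hasFDerivAt.comp_hasDerivAt t (hGd t)
  have hg : ∀ t, HasDerivAt (fun t => (1 - t) ^ 2 * ψ (G t) ^ 2)
      (-(2 * (1 - t)) * ψ (G t) ^ 2 + (1 - t) ^ 2 * (2 * ψ (G t) * fderiv ℝ ψ (G t) v)) t := by
    intro t
    have h1 : HasDerivAt (fun t : ℝ => (1 - t) ^ 2) (-(2 * (1 - t))) t := by
      exact (((hasDerivAt_id t).const_sub 1).fun_pow 2).congr_deriv (by simp)
    exact (h1.fun_mul ((hψG t).fun_pow 2)).congr_deriv (by simp)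
  have hGc : Continuous G := continuous_iff_continuousAt.2 fun t => (hGd t).continuousAt
  have hfc : Continuous fun t => fderiv ℝ ψ (G t) v :=
    ((hψ.continuous_fderiv (by simp)).comp hGc).clm_apply continuous_const
  have hftc := intervalIntegral.integral_eq_sub_of_hasDerivAt (a := 0) (b := 1)
    (fun t _ => hg t) (Continuous.intervalIntegrable (by fun_prop) _ _)
  have h0 : ψ (edgeMap a b s) ^ 2 = - ∫ t in (0 : ℝ)..1,
      (-(2 * (1 - t)) * ψ (G t) ^ 2 + (1 - t) ^ 2 * (2 * ψ (G t) * fderiv ℝ ψ (G t) v)) := by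
    rw [hftc]
    simp [hG, refMap, edgeMap]
  rw [h0, ← intervalIntegral.integral_neg]
  refine intervalIntegral.integral_mono_on zero_le_one
    (Continuous.intervalIntegrable (by fun_prop) _ _)
    (Continuous.intervalIntegrable (by
      have : Continuous fun t => F (G t) := hFc.comp hGc
      exact (continuous_const.sub continuous_id).mul this) _ _) fun t ht => ?_
  have h1 := sq_fderiv_le ψ (G t) v
  have h2 : ‖v‖ ^ 2 * ∑ i, pd i ψ (G t) ^ 2 ≤ h ^ 2 * ∑ i, pd i ψ (G t) ^ 2 := by
    gcongr
  have h3 := h1.trans h2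
  simp only [hF]
  change _ ≤ (1 - t) * (3 * ψ (G t) ^ 2 + h ^ 2 * ∑ i, pd i ψ (G t) ^ 2)
  set A := ψ (G t)
  set B := fderiv ℝ ψ (G t) v
  set Q := h ^ 2 * ∑ i, pd i ψ (G t) ^ 2
  have ht1 : 0 ≤ 1 - t := sub_nonneg.2 ht.2
  -- Young's inequality; together with the `2 A²` from differentiating the weight it produces the
  -- constant `3`.
  have h4 : -((1 - t) * (2 * A * B)) ≤ A ^ 2 + B ^ 2 := by
    nlinarith [sq_nonneg (A + (1 - t) * B), sq_nonneg B, ht.1, mul_nonneg ht1 ht.1]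
  nlinarith [mul_le_mul_of_nonneg_left h4 ht1, mul_le_mul_of_nonneg_left h3 ht1]

/-! ### Poincaré inequalities -/

/-- The variance of `f` under the probability density `k` is nonnegative. -/
lemma sq_integral_weight_mul_le {k f : ℝ → ℝ} (hk : Continuous k) (hf : Continuous f)
    (hk0 : ∀ s ∈ Icc (0 : ℝ) 1, 0 ≤ k s) (hk1 : ∫ s in (0 : ℝ)..1, k s = 1) :
    (∫ s in (0 : ℝ)..1, k s * f s) ^ 2 ≤ ∫ s in (0 : ℝ)..1, k s * f s ^ 2 := by
  set m := ∫ s in (0 : ℝ)..1, k s * f s with hm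
  have h0 : 0 ≤ ∫ s in (0 : ℝ)..1, k s * (f s - m) ^ 2 :=
    intervalIntegral.integral_nonneg zero_le_one fun s hs => mul_nonneg (hk0 s hs) (sq_nonneg _)
  have h1 : ∀ r : ℝ, ∫ s in (0 : ℝ)..1, k s * (f s - r) ^ 2 =
      (∫ s in (0 : ℝ)..1, k s * f s ^ 2) - 2 * r * (∫ s in (0 : ℝ)..1, k s * f s)
        + r ^ 2 * ∫ s in (0 : ℝ)..1, k s := by
    intro r
    rw [← intervalIntegral.integral_const_mul, ← intervalIntegral.integral_const_mul,
      ← intervalIntegral.integral_sub, ← intervalIntegral.integral_add]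
    · refine intervalIntegral.integral_congr fun s _ => ?_
      ring
    all_goals exact Continuous.intervalIntegrable (by fun_prop) _ _
  rw [h1, ← hm, hk1] at h0
  nlinarith

lemma sq_integral_le {f : ℝ → ℝ} (hf : Continuous f) :
    (∫ s in (0 : ℝ)..1, f s) ^ 2 ≤ ∫ s in (0 : ℝ)..1, f s ^ 2 := by
  simpa using sq_integral_weight_mul_le (k := fun _ => 1) continuous_const hf (by simp) (by simp)

/-- Scaling the plane by `t` costs `t⁻²`, which is at most `4` here. -/
lemma lintegral_comp_add_smul {g : Plane → ENNReal} (hg : Measurable g) (a : Plane) {t : ℝ}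
    (ht : 1 / 2 ≤ t) : ∫⁻ y, g (a + t • y) ≤ 4 * ∫⁻ y, g y := by
  have ht0 : 0 < t := by linarith
  have h1 : ∫⁻ y, g (a + t • y) = ∫⁻ y, g (a + y) ∂(Measure.map (fun y : Plane => t • y) volume) := by
    rw [lintegral_map (by fun_prop) (by fun_prop)]
  rw [h1, Measure.map_addHaar_smul volume ht0.ne', lintegral_smul_measure,
    lintegral_add_left_eq_self g a, smul_eq_mul]
  gcongr
  rw [show Module.finrank ℝ Plane = 2 by simp, abs_of_pos (by positivity)]
  have : (t ^ 2)⁻¹ ≤ 4 := by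
    rw [inv_le_comm₀ (by positivity) (by norm_num)]
    nlinarith
  calc ENNReal.ofReal (t ^ 2)⁻¹ ≤ ENNReal.ofReal 4 := ENNReal.ofReal_le_ofReal this
    _ = 4 := by norm_num

/-- The increment is the integral of the directional derivative over the segment from `x` to `y`, to
which the Cauchy–Schwarz inequality applies; convexity keeps the segment in `K`, so the indicator
loses nothing. -/
lemma sq_sub_le_lintegral {K : Set Plane} (hK : Convex ℝ K) {q : Plane → ℝ}
    (hq : ContDiff ℝ ∞ q) {h : ℝ} {x y : Plane} (hx : x ∈ K) (hy : y ∈ K) (hxy : ‖y - x‖ ≤ h) :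
    ENNReal.ofReal ((q y - q x) ^ 2) ≤ ENNReal.ofReal (h ^ 2) *
      ∫⁻ t in Icc (0 : ℝ) 1,
        K.indicator (fun z => ENNReal.ofReal (∑ i, pd i q z ^ 2)) (x + t • (y - x)) := by
  have hγ : ∀ t : ℝ, HasDerivAt (fun t : ℝ => x + t • (y - x)) (y - x) t := fun t => by
    simpa using ((hasDerivAt_id t).smul_const (y - x)).const_add x
  have hqγ : ∀ t : ℝ, HasDerivAt (fun t => q (x + t • (y - x)))
      (fderiv ℝ q (x + t • (y - x)) (y - x)) t := fun t =>
    (hq.differentiable (by simp) _).hasFDerivAt.comp_hasDerivAt t (hγ t)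
  have hfc : Continuous fun t : ℝ => fderiv ℝ q (x + t • (y - x)) (y - x) :=
    ((hq.continuous_fderiv (by simp)).comp (by fun_prop)).clm_apply continuous_const
  have hpc : ∀ i, Continuous (pd i q) := fun i => (contDiff_pd hq i).continuous
  have hftc := intervalIntegral.integral_eq_sub_of_hasDerivAt (a := 0) (b := 1)
    (fun t _ => hqγ t) (hfc.intervalIntegrable _ _)
  simp only [one_smul, add_sub_cancel, zero_smul, add_zero] at hftc
  have h1 : (q y - q x) ^ 2 ≤ h ^ 2 * ∫ t in (0 : ℝ)..1, ∑ i, pd i q (x + t • (y - x)) ^ 2 := by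
    rw [← hftc]
    refine (sq_integral_le hfc).trans ?_
    rw [← intervalIntegral.integral_const_mul]
    refine intervalIntegral.integral_mono_on zero_le_one
      (Continuous.intervalIntegrable (by fun_prop) _ _)
      (Continuous.intervalIntegrable (by fun_prop) _ _) fun t _ => ?_
    refine (sq_fderiv_le q _ _).trans ?_
    gcongr
  refine (ENNReal.ofReal_le_ofReal h1).trans ?_
  rw [ENNReal.ofReal_mul (sq_nonneg h)]
  gcongr
  rw [intervalIntegral.integral_of_le zero_le_one, ← integral_Icc_eq_integral_Ioc,
    ofReal_integral_eq_lintegral_ofReal]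
  · refine lintegral_mono_ae ?_
    rw [ae_restrict_iff' measurableSet_Icc]
    refine Eventually.of_forall fun t ht => ?_
    rw [indicator_of_mem]
    exact hK.add_smul_sub_mem hx hy ht
  · exact (Continuous.continuousOn (by fun_prop)).integrableOn_compact isCompact_Icc
  · exact Eventually.of_forall fun t => Finset.sum_nonneg fun i _ => sq_nonneg _

lemma lintegral_segments_le {K : Set Plane} {g : Plane → ENNReal} (hg : Measurable g) :
    ∫⁻ y in K, ∫⁻ x in K, ∫⁻ t in Icc (0 : ℝ) 1, g (x + t • (y - x)) ≤
      volume K * (4 * ∫⁻ z, g z) := by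
  have hG : Measurable fun p : (Plane × Plane) × ℝ => g (p.1.1 + p.2 • (p.1.2 - p.1.1)) := by
    fun_prop
  have h1 : ∫⁻ y in K, ∫⁻ x in K, ∫⁻ t in Icc (0 : ℝ) 1, g (x + t • (y - x)) =
      ∫⁻ t in Icc (0 : ℝ) 1, ∫⁻ y in K, ∫⁻ x in K, g (x + t • (y - x)) := by
    have : ∀ y : Plane, ∫⁻ x in K, ∫⁻ t in Icc (0 : ℝ) 1, g (x + t • (y - x)) =
        ∫⁻ t in Icc (0 : ℝ) 1, ∫⁻ x in K, g (x + t • (y - x)) := fun y =>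
      lintegral_lintegral_swap (Measurable.aemeasurable (by fun_prop))
    simp_rw [this]
    refine lintegral_lintegral_swap (Measurable.aemeasurable ?_)
    have hm : Measurable fun p : (Plane × ℝ) × Plane => g (p.2 + p.1.2 • (p.1.1 - p.2)) := by
      fun_prop
    exact hm.lintegral_prod_right'
  rw [h1]
  calc _ ≤ ∫⁻ t in Icc (0 : ℝ) 1, volume K * (4 * ∫⁻ z, g z) := by
        refine lintegral_mono_ae ?_
        rw [ae_restrict_iff' measurableSet_Icc]
        refine Eventually.of_forall fun t ht => ?_
        -- At least one of the coefficients `t` of `y` and `1 - t` of `x` is `≥ 1/2`; the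
        -- corresponding variable is integrated first, which avoids the singular Jacobian.
        rcases le_total (1 / 2) t with h | h
        · rw [lintegral_lintegral_swap (Measurable.aemeasurable (by fun_prop))]
          calc _ ≤ ∫⁻ _ in K, 4 * ∫⁻ z, g z := by
                refine lintegral_mono fun x => (setLIntegral_le_lintegral _ _).trans ?_
                refine le_trans (le_of_eq ?_) (lintegral_comp_add_smul hg (x - t • x) h)
                refine lintegral_congr fun y => ?_
                congr 1
                module
            _ = _ := by rw [lintegral_const, Measure.restrict_apply_univ, mul_comm]
        · calc _ ≤ ∫⁻ _ in K, 4 * ∫⁻ z, g z := by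
                refine lintegral_mono fun y => (setLIntegral_le_lintegral _ _).trans ?_
                refine le_trans (le_of_eq ?_)
                  (lintegral_comp_add_smul hg (t • y) (t := 1 - t) (by linarith))
                refine lintegral_congr fun x => ?_
                congr 1
                module
            _ = _ := by rw [lintegral_const, Measure.restrict_apply_univ, mul_comm]
    _ = _ := by simp

/-- The double integral of `(q y - q x)²` over `K × K` is controlled by integrating the gradient
along all segments. The subtracted constant is a value of `q` instead of its mean. -/
lemma poincare {K : Set Plane} (hK : Convex ℝ K) (hKo : IsOpen K) (hb : Bornology.IsBounded K)
    (hne : K.Nonempty) {h : ℝ} (hh : ∀ x ∈ K, ∀ y ∈ K, ‖y - x‖ ≤ h) {q : Plane → ℝ}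
    (hq : ContDiff ℝ ∞ q) :
    ∃ c : ℝ, pS 0 K (fun x => q x - c) ≤ 4 * h ^ 2 * pS 1 K q := by
  set g : Plane → ENNReal := K.indicator fun z => ENNReal.ofReal (∑ i, pd i q z ^ 2) with hg
  have hpc : ∀ i, Continuous (pd i q) := fun i => (contDiff_pd hq i).continuous
  have hqc := hq.continuous
  have hgm : Measurable g := by
    refine Measurable.indicator ?_ hKo.measurableSet
    exact ENNReal.measurable_ofReal.comp (Continuous.measurable (by fun_prop))
  have hgi : ∫⁻ z, g z = ENNReal.ofReal (pS 1 K q) := by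
    rw [hg, lintegral_indicator hKo.measurableSet]
    have hi : ∀ i, Integrable (fun x => pd i q x ^ 2) (volume.restrict K) :=
      fun i => (memLp_of_contDiff hb (contDiff_pd hq i)).integrable_sq
    rw [← ofReal_integral_eq_lintegral_ofReal (integrable_finsetSum _ fun i _ => hi i)
      (Eventually.of_forall fun z => Finset.sum_nonneg fun i _ => sq_nonneg _),
      integral_finsetSum _ fun i _ => hi i]
    rfl
  have hv0 : volume K ≠ 0 := (hKo.measure_pos volume hne).ne'
  have hv1 : volume K ≠ ⊤ := hb.measure_lt_top.ne
  have hΦm : Measurable fun y => ∫⁻ x in K, ENNReal.ofReal ((q y - q x) ^ 2) := by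
    have : Measurable fun p : Plane × Plane => ENNReal.ofReal ((q p.1 - q p.2) ^ 2) := by
      fun_prop
    exact this.lintegral_prod_right'
  -- Some `y` does no worse than the average over `K`, and `q y` serves as the constant.
  obtain ⟨y, hy, hle⟩ := exists_le_setLAverage hv0 hv1 hΦm.aemeasurable
  refine ⟨q y, ?_⟩
  have hbound : ∫⁻ y in K, ∫⁻ x in K, ENNReal.ofReal ((q y - q x) ^ 2) ≤
      volume K * (ENNReal.ofReal (4 * h ^ 2 * pS 1 K q)) := by
    calc _ ≤ ∫⁻ y in K, ∫⁻ x in K, ENNReal.ofReal (h ^ 2) *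
          ∫⁻ t in Icc (0 : ℝ) 1, g (x + t • (y - x)) := by
          refine setLIntegral_mono' hKo.measurableSet fun y hy => ?_
          refine setLIntegral_mono' hKo.measurableSet fun x hx => ?_
          exact sq_sub_le_lintegral hK hq hx hy (hh x hx y hy)
      _ = ENNReal.ofReal (h ^ 2) * ∫⁻ y in K, ∫⁻ x in K,
          ∫⁻ t in Icc (0 : ℝ) 1, g (x + t • (y - x)) := by
          simp_rw [lintegral_const_mul' _ _ ENNReal.ofReal_ne_top]
      _ ≤ ENNReal.ofReal (h ^ 2) * (volume K * (4 * ∫⁻ z, g z)) := by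
          gcongr
          exact lintegral_segments_le hgm
      _ = _ := by
          rw [hgi, mul_comm (4 : ℝ), mul_assoc, ENNReal.ofReal_mul (sq_nonneg h),
            ENNReal.ofReal_mul (by norm_num), ENNReal.ofReal_ofNat]
          ring
  rw [setLAverage_eq] at hle
  have h2 : ∫⁻ x in K, ENNReal.ofReal ((q y - q x) ^ 2) ≤
      ENNReal.ofReal (4 * h ^ 2 * pS 1 K q) :=
    hle.trans (ENNReal.div_le_of_le_mul' hbound)
  have h3 : ENNReal.ofReal (pS 0 K (fun x => q x - q y)) =
      ∫⁻ x in K, ENNReal.ofReal ((q y - q x) ^ 2) := by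
    have hsm : ContDiff ℝ ∞ fun x => q x - q y := hq.sub contDiff_const
    change ENNReal.ofReal (∫ x in K, (q x - q y) ^ 2) = _
    rw [ofReal_integral_eq_lintegral_ofReal (memLp_of_contDiff hb hsm).integrable_sq
      (Eventually.of_forall fun x => sq_nonneg _)]
    refine lintegral_congr fun x => ?_
    congr 1
    ring
  rw [← h3] at h2
  exact (ENNReal.ofReal_le_ofReal_iff
    (mul_nonneg (by positivity) (pS_nonneg 1 K q))).1 h2

lemma interior_tri_nonempty {a b c : Plane} (hD : det2 (b - a) (c - a) ≠ 0) :
    (interior (tri a b c)).Nonempty := by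
  by_contra hne
  have h1 := volume_real_tri hD
  have h2 := interior_ae_eq (convex_convexHull ℝ {a, b, c})
  rw [← tri, not_nonempty_iff_eq_empty.1 hne] at h2
  rw [← measureReal_congr h2, measureReal_empty] at h1
  have := abs_pos.2 hD
  linarith

lemma pS_zero_le_of_sub_const {K : Set Plane} (hb : Bornology.IsBounded K)
    {q : Plane → ℝ} (hq : ContDiff ℝ ∞ q) (c : ℝ) :
    pS 0 K q ≤ 2 * pS 0 K (fun x => q x - c) + 2 * c ^ 2 * volume.real K := by
  have hs : ContDiff ℝ ∞ fun x => q x - c := hq.sub contDiff_const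
  have h1 := (memLp_of_contDiff hb hs).integrable_sq
  have h2 := (memLp_of_contDiff hb hq).integrable_sq
  have hf : IsFiniteMeasure (volume.restrict K) := ⟨by simpa using hb.measure_lt_top⟩
  have h3 : 2 * c ^ 2 * volume.real K = ∫ _ in K, 2 * c ^ 2 := by simp [mul_comm]
  rw [h3]
  change ∫ x in K, q x ^ 2 ≤ 2 * (∫ x in K, (q x - c) ^ 2) + _
  rw [← integral_const_mul, ← integral_add (h1.const_mul 2) (integrable_const _)]
  refine integral_mono h2 ((h1.const_mul 2).add (integrable_const _)) fun x => ?_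
  simp only
  nlinarith [sq_nonneg (q x - 2 * c)]

/-- A Poincaré inequality with a weighted mean over an edge. -/
lemma edge_poincare {a b c : Plane} (hD : det2 (b - a) (c - a) ≠ 0) {h : ℝ}
    (hh : ∀ x ∈ tri a b c, ∀ y ∈ tri a b c, ‖y - x‖ ≤ h) {k : ℝ → ℝ} (hk : Continuous k)
    (hk0 : ∀ s ∈ Icc (0 : ℝ) 1, 0 ≤ k s) (hk2 : ∀ s ∈ Icc (0 : ℝ) 1, k s ≤ 2)
    (hk1 : ∫ s in (0 : ℝ)..1, k s = 1) {q : Plane → ℝ} (hq : ContDiff ℝ ∞ q) :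
    pS 0 (interior (tri a b c)) q ≤ 60 * h ^ 2 * pS 1 (interior (tri a b c)) q +
      2 * |det2 (b - a) (c - a)| * (∫ s in (0 : ℝ)..1, k s * q (edgeMap a b s)) ^ 2 := by
  have ha : a ∈ tri a b c := subset_convexHull ℝ _ (by simp)
  have hb : b ∈ tri a b c := subset_convexHull ℝ _ (by simp)
  have hc : c ∈ tri a b c := subset_convexHull ℝ _ (by simp)
  have hbd : Bornology.IsBounded (interior (tri a b c)) :=
    (isCompact_tri a b c).isBounded.subset interior_subset
  set K := interior (tri a b c) with hK
  obtain ⟨μ, hμ⟩ := poincare (K := K) (convex_convexHull ℝ _).interior isOpen_interior hbd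
    (interior_tri_nonempty hD) (fun x hx y hy => hh x (interior_subset hx) y (interior_subset hy)) hq
  have hr : ContDiff ℝ ∞ fun x => q x - μ := hq.sub contDiff_const
  have htr := trace_inequality hD (hh a ha c hc) (hh b hb c hc) hr
  have hp1 : pS 1 K (fun x => q x - μ) = pS 1 K q := by
    have : ∀ i, pd i (fun x => q x - μ) = pd i q := fun i => by
      ext x; simp [pd, fderiv_sub_const]
    simp only [pS, this]
  rw [hp1, ← hK] at htr
  have hvol : volume.real K = |det2 (b - a) (c - a)| / 2 := by
    rw [← volume_real_tri hD]
    exact measureReal_congr (interior_ae_eq (convex_convexHull ℝ {a, b, c}))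
  have hsub := pS_zero_le_of_sub_const hbd hq μ
  rw [hvol] at hsub
  set D := |det2 (b - a) (c - a)| with hDd
  have hDp : 0 < D := abs_pos.2 hD
  set m := ∫ s in (0 : ℝ)..1, k s * q (edgeMap a b s) with hm
  have hqe : Continuous fun s => q (edgeMap a b s) := hq.continuous.comp (continuous_edgeMap a b)
  have h1 : m - μ = ∫ s in (0 : ℝ)..1, k s * (q (edgeMap a b s) - μ) := by
    simp_rw [mul_sub]
    rw [intervalIntegral.integral_sub (Continuous.intervalIntegrable (by fun_prop) _ _)
      (Continuous.intervalIntegrable (by fun_prop) _ _), intervalIntegral.integral_mul_const, hk1,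
      one_mul]
  -- The edge mean `m` replaces the constant `μ` at the price of the trace of `q - μ`; the factor
  -- `2` is the bound on the weight `k`.
  have h2 : (m - μ) ^ 2 ≤ 2 * ∫ s in (0 : ℝ)..1, (q (edgeMap a b s) - μ) ^ 2 := by
    rw [h1]
    refine (sq_integral_weight_mul_le (f := fun s => q (edgeMap a b s) - μ) hk
      (hqe.sub continuous_const) hk0 hk1).trans ?_
    rw [← intervalIntegral.integral_const_mul]
    refine intervalIntegral.integral_mono_on zero_le_one
      (Continuous.intervalIntegrable (by fun_prop) _ _)
      (Continuous.intervalIntegrable (by fun_prop) _ _) fun s hs => ?_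
    gcongr
    exact hk2 s hs
  set S := pS 1 K q
  have hS : 0 ≤ S := pS_nonneg 1 K q
  -- The constant is `26 = 2 (3 · 4 + 1)`, from the weight bound, the trace inequality and the
  -- Poincaré inequality. The final `60` is `8 + 2 · 26`.
  have h3 : D * (m - μ) ^ 2 ≤ 26 * h ^ 2 * S := by
    have : D * ∫ s in (0 : ℝ)..1, (q (edgeMap a b s) - μ) ^ 2 ≤
        3 * pS 0 K (fun x => q x - μ) + h ^ 2 * S := by
      have := mul_le_mul_of_nonneg_left htr hDp.le
      rwa [← mul_assoc, mul_one_div_cancel hDp.ne', one_mul] at this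
    nlinarith
  have h4 : D * μ ^ 2 ≤ 2 * D * m ^ 2 + 52 * h ^ 2 * S := by
    nlinarith [mul_nonneg hDp.le (sq_nonneg (2 * m - μ))]
  nlinarith

/-! ### Directional derivatives -/

/-- The derivative of `w` in the direction `u`. -/
def dirD (u : Plane) (w : Plane → ℝ) : Plane → ℝ := u 0 • pd 0 w + u 1 • pd 1 w

lemma fderiv_eq_dirD (u : Plane) (w : Plane → ℝ) (x : Plane) : fderiv ℝ w x u = dirD u w x := by
  rw [fderiv_apply_eq_sum, Fin.sum_univ_two]
  rfl

lemma contDiff_dirD {w : Plane → ℝ} (hw : ContDiff ℝ ∞ w) (u : Plane) :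
    ContDiff ℝ ∞ (dirD u w) :=
  ((contDiff_pd hw 0).const_smul (u 0)).add ((contDiff_pd hw 1).const_smul (u 1))

lemma pd_lincomb {f g : Plane → ℝ} (hf : ContDiff ℝ ∞ f) (hg : ContDiff ℝ ∞ g) (p q : ℝ)
    (i : Fin 2) : pd i (p • f + q • g) = p • pd i f + q • pd i g := by
  have h1 := pd_add (hf.const_smul p) (hg.const_smul q) i
  have h2 := pd_smul hf p i
  have h3 := pd_smul hg q i
  change pd i ((fun x => p • f x) + fun x => q • g x) = _
  rw [h1]
  exact congrArg₂ _ h2 h3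

section seminorm

variable {K : Set Plane} {f g w : Plane → ℝ}

lemma pS_lincomb_le (hb : Bornology.IsBounded K) (hf : ContDiff ℝ ∞ f) (hg : ContDiff ℝ ∞ g)
    (p q : ℝ) (m : ℕ) : pS m K (p • f + q • g) ≤ (p ^ 2 + q ^ 2) * (pS m K f + pS m K g) := by
  induction m generalizing f g with
  | zero =>
    have h1 := (memLp_of_contDiff hb hf).integrable_sq
    have h2 := (memLp_of_contDiff hb hg).integrable_sq
    change ∫ x in K, (p * f x + q * g x) ^ 2 ≤ _ * ((∫ x in K, f x ^ 2) + ∫ x in K, g x ^ 2)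
    rw [← integral_add h1 h2, ← integral_const_mul]
    refine integral_mono_of_nonneg (Eventually.of_forall fun x => sq_nonneg _)
      ((h1.add h2).const_mul _) (Eventually.of_forall fun x => ?_)
    simp only
    nlinarith [sq_nonneg (p * g x - q * f x)]
  | succ m ih =>
    simp only [pS, pd_lincomb hf hg]
    rw [← Finset.sum_add_distrib, Finset.mul_sum]
    exact Finset.sum_le_sum fun i _ => ih (contDiff_pd hf i) (contDiff_pd hg i)

lemma pS_dirD_le (hb : Bornology.IsBounded K) (hw : ContDiff ℝ ∞ w) {u : Plane} {h : ℝ}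
    (hu : ‖u‖ ≤ h) (m : ℕ) : pS m K (dirD u w) ≤ h ^ 2 * pS (m + 1) K w := by
  have h1 := pS_lincomb_le hb (contDiff_pd hw 0) (contDiff_pd hw 1) (u 0) (u 1) m
  have h2 : pS (m + 1) K w = pS m K (pd 0 w) + pS m K (pd 1 w) := by
    simp [pS, Fin.sum_univ_two]
  have h3 : u 0 ^ 2 + u 1 ^ 2 ≤ h ^ 2 := by
    have := EuclideanSpace.norm_sq_eq u
    simp only [Fin.sum_univ_two, Real.norm_eq_abs, sq_abs] at this
    rw [← this]
    gcongr
  rw [h2]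
  refine h1.trans (mul_le_mul_of_nonneg_right h3 ?_)
  exact add_nonneg (pS_nonneg _ _ _) (pS_nonneg _ _ _)

/-- Cramer's rule expresses the coordinate derivatives through the derivatives along `u` and `v`. -/
lemma pS_succ_le_dirD (hb : Bornology.IsBounded K) (hw : ContDiff ℝ ∞ w) {u v : Plane} {h : ℝ}
    (hu : ‖u‖ ≤ h) (hv : ‖v‖ ≤ h) (hD : det2 u v ≠ 0) (m : ℕ) :
    pS (m + 1) K w ≤ 2 * (h / det2 u v) ^ 2 * (pS m K (dirD u w) + pS m K (dirD v w)) := by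
  set D := det2 u v with hDd
  have hD' : D = u 0 * v 1 - u 1 * v 0 := rfl
  have e0 : pd 0 w = (v 1 / D) • dirD u w + (-(u 1) / D) • dirD v w := by
    ext x
    simp only [dirD, Pi.add_apply, Pi.smul_apply, smul_eq_mul]
    field_simp
    rw [hD']
    ring
  have e1 : pd 1 w = (-(v 0) / D) • dirD u w + (u 0 / D) • dirD v w := by
    ext x
    simp only [dirD, Pi.add_apply, Pi.smul_apply, smul_eq_mul]
    field_simp
    rw [hD']
    ring
  have h2 : pS (m + 1) K w = pS m K (pd 0 w) + pS m K (pd 1 w) := by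
    simp [pS, Fin.sum_univ_two]
  have l0 := pS_lincomb_le hb (contDiff_dirD hw u) (contDiff_dirD hw v) (v 1 / D) (-(u 1) / D) m
  have l1 := pS_lincomb_le hb (contDiff_dirD hw u) (contDiff_dirD hw v) (-(v 0) / D) (u 0 / D) m
  rw [← e0] at l0
  rw [← e1] at l1
  have hsq : ∀ {z : Plane}, ‖z‖ ≤ h → z 0 ^ 2 + z 1 ^ 2 ≤ h ^ 2 := by
    intro z hz
    have := EuclideanSpace.norm_sq_eq z
    simp only [Fin.sum_univ_two, Real.norm_eq_abs, sq_abs] at this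
    rw [← this]
    gcongr
  have hc : ((v 1 / D) ^ 2 + (-(u 1) / D) ^ 2) + ((-(v 0) / D) ^ 2 + (u 0 / D) ^ 2) ≤
      2 * (h / D) ^ 2 := by
    have : ((v 1 / D) ^ 2 + (-(u 1) / D) ^ 2) + ((-(v 0) / D) ^ 2 + (u 0 / D) ^ 2) =
        ((u 0 ^ 2 + u 1 ^ 2) + (v 0 ^ 2 + v 1 ^ 2)) * (1 / D) ^ 2 := by ring
    rw [this, show 2 * (h / D) ^ 2 = (h ^ 2 + h ^ 2) * (1 / D) ^ 2 by ring]
    gcongr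
    · exact hsq hu
    · exact hsq hv
  rw [h2]
  refine (add_le_add l0 l1).trans ?_
  rw [← add_mul]
  exact mul_le_mul_of_nonneg_right hc (add_nonneg (pS_nonneg _ _ _) (pS_nonneg _ _ _))

end seminorm

/-! ### Values on an edge -/

section edge

variable {w : Plane → ℝ} {a b c : Plane}

lemma hasDerivAt_edgeMap (hw : ContDiff ℝ ∞ w) (a b : Plane) (s : ℝ) :
    HasDerivAt (fun s => w (edgeMap a b s)) (dirD (b - a) w (edgeMap a b s)) s := by
  have h1 : HasDerivAt (edgeMap a b) (b - a) s := by
    unfold edgeMap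
    simpa using ((hasDerivAt_id s).smul_const (b - a)).const_add a
  rw [← fderiv_eq_dirD]
  exact (hw.differentiable (by simp) _).hasFDerivAt.comp_hasDerivAt s h1

@[simp] lemma edgeMap_zero (a b : Plane) : edgeMap a b 0 = a := by simp [edgeMap]

@[simp] lemma edgeMap_one (a b : Plane) : edgeMap a b 1 = b := by simp [edgeMap]

lemma edgeMap_half (a b : Plane) : edgeMap a b (1 / 2) = (1 / 2 : ℝ) • (a + b) := by
  simp only [edgeMap]; module

lemma integral_dirD_edge (hw : ContDiff ℝ ∞ w) (ha : w a = 0) (hb : w b = 0) :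
    ∫ s in (0 : ℝ)..1, 1 * dirD (b - a) w (edgeMap a b s) = 0 := by
  have hc := (contDiff_dirD hw (b - a)).continuous
  have := intervalIntegral.integral_eq_sub_of_hasDerivAt (a := 0) (b := 1)
    (fun s _ => hasDerivAt_edgeMap hw a b s) (Continuous.intervalIntegrable (by fun_prop) _ _)
  simpa [ha, hb] using this

/-- Integrating by parts on both halves, the slopes at the midpoint cancel and a second difference
of the three nodal values remains. The hat has unit mass and maximum `2`, as `edge_poincare`
requires. -/
lemma integral_hat_dirD_edge (hw : ContDiff ℝ ∞ w) (ha : w a = 0) (hb : w b = 0)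
    (hm : w ((1 / 2 : ℝ) • (a + b)) = 0) :
    ∫ s in (0 : ℝ)..1, 4 * min s (1 - s) * dirD (b - a) (dirD (b - a) w) (edgeMap a b s) = 0 := by
  set u := b - a
  set f : ℝ → ℝ := fun s => w (edgeMap a b s) with hf
  set f1 : ℝ → ℝ := fun s => dirD u w (edgeMap a b s) with hf1
  set f2 : ℝ → ℝ := fun s => dirD u (dirD u w) (edgeMap a b s) with hf2
  have h1 : ∀ s, HasDerivAt f (f1 s) s := hasDerivAt_edgeMap hw a b
  have h2 : ∀ s, HasDerivAt f1 (f2 s) s := hasDerivAt_edgeMap (contDiff_dirD hw u) a b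
  have hc1 : Continuous f1 := (contDiff_dirD hw u).continuous.comp (continuous_edgeMap a b)
  have hc2 : Continuous f2 :=
    (contDiff_dirD (contDiff_dirD hw u) u).continuous.comp (continuous_edgeMap a b)
  have hint : ∀ p q : ℝ, IntervalIntegrable (fun s => 4 * min s (1 - s) * f2 s) volume p q :=
    fun p q => Continuous.intervalIntegrable (by fun_prop) _ _
  have f0 : f 0 = 0 := by simp [hf, ha]
  have fh : f (1 / 2) = 0 := by simp only [hf, edgeMap_half, hm]
  have fo : f 1 = 0 := by simp [hf, hb]
  rw [← intervalIntegral.integral_add_adjacent_intervals (hint 0 (1 / 2)) (hint (1 / 2) 1)]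
  have i1 : ∫ s in (0 : ℝ)..(1 / 2), 4 * min s (1 - s) * f2 s = 2 * f1 (1 / 2) := by
    have hd : ∀ s, HasDerivAt (fun s => 4 * (s * f1 s - f s)) (4 * s * f2 s) s := fun s =>
      ((((hasDerivAt_id s).fun_mul (h2 s)).fun_sub (h1 s)).const_mul 4).congr_deriv (by simp; ring)
    have := intervalIntegral.integral_eq_sub_of_hasDerivAt (a := 0) (b := 1 / 2)
      (fun s _ => hd s) (Continuous.intervalIntegrable (by fun_prop) _ _)
    rw [intervalIntegral.integral_congr (g := fun s => 4 * s * f2 s), this, fh, f0]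
    · ring
    · intro s hs
      rw [uIcc_of_le (by norm_num)] at hs
      simp only
      rw [min_eq_left (by linarith [hs.2])]
  have i2 : ∫ s in (1 / 2 : ℝ)..1, 4 * min s (1 - s) * f2 s = - (2 * f1 (1 / 2)) := by
    have hd : ∀ s, HasDerivAt (fun s => 4 * ((1 - s) * f1 s + f s)) (4 * (1 - s) * f2 s) s :=
      fun s => (((((hasDerivAt_id s).const_sub 1).fun_mul (h2 s)).fun_add (h1 s)).const_mul
        4).congr_deriv (by simp; ring)
    have := intervalIntegral.integral_eq_sub_of_hasDerivAt (a := 1 / 2) (b := 1)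
      (fun s _ => hd s) (Continuous.intervalIntegrable (by fun_prop) _ _)
    rw [intervalIntegral.integral_congr (g := fun s => 4 * (1 - s) * f2 s), this, fh, fo]
    · ring
    · intro s hs
      rw [uIcc_of_le (by norm_num)] at hs
      simp only
      rw [min_eq_right (by linarith [hs.1])]
  rw [i1, i2]
  ring

lemma integral_hat : ∫ s in (0 : ℝ)..1, 4 * min s (1 - s) = 1 := by
  have hint : ∀ p q : ℝ, IntervalIntegrable (fun s : ℝ => 4 * min s (1 - s)) volume p q :=
    fun p q => Continuous.intervalIntegrable (by fun_prop) _ _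
  rw [← intervalIntegral.integral_add_adjacent_intervals (hint 0 (1 / 2)) (hint (1 / 2) 1)]
  rw [intervalIntegral.integral_congr (g := fun s => 4 * s),
    intervalIntegral.integral_congr (a := 1 / 2) (g := fun s => 4 - 4 * s)]
  · rw [intervalIntegral.integral_sub (by simp) (Continuous.intervalIntegrable (by fun_prop) _ _),
      intervalIntegral.integral_const_mul, intervalIntegral.integral_const_mul, integral_id,
      integral_id, intervalIntegral.integral_const]
    norm_num
  · intro s hs
    rw [uIcc_of_le (by norm_num)] at hs
    simp only
    rw [min_eq_right (by linarith [hs.1])]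
    ring
  · intro s hs
    rw [uIcc_of_le (by norm_num)] at hs
    simp only
    rw [min_eq_left (by linarith [hs.2])]

/-! ### Estimates for functions vanishing at the nodes of a triangle -/

lemma tri_swap (a b c : Plane) : tri a c b = tri a b c := by
  rw [tri, tri]
  congr 1
  ext x; simp; tauto

lemma tri_rotate (a b c : Plane) : tri b c a = tri a b c := by
  rw [tri, tri]
  congr 1
  ext x; simp; tauto

lemma det2_swap (u v : Plane) : det2 v u = - det2 u v := by simp only [det2]; ring

lemma det2_rotate (a b c : Plane) : det2 (c - b) (a - b) = det2 (b - a) (c - a) := by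
  simp only [det2, PiLp.sub_apply]; ring

lemma isBounded_interior_tri (a b c : Plane) : Bornology.IsBounded (interior (tri a b c)) :=
  (isCompact_tri a b c).isBounded.subset interior_subset

/-- The tangential derivative has zero mean on the edge because `w` vanishes at both ends, so the
mean term in `edge_poincare` drops out. -/
lemma pS_dirD_edge_le (hD : det2 (b - a) (c - a) ≠ 0) {h : ℝ}
    (hh : ∀ x ∈ tri a b c, ∀ y ∈ tri a b c, ‖y - x‖ ≤ h) (hw : ContDiff ℝ ∞ w)
    (ha : w a = 0) (hb : w b = 0) :
    pS 0 (interior (tri a b c)) (dirD (b - a) w) ≤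
      60 * h ^ 2 * (h ^ 2 * pS 2 (interior (tri a b c)) w) := by
  have hab : ‖b - a‖ ≤ h := hh a (subset_convexHull ℝ _ (by simp)) b (subset_convexHull ℝ _ (by simp))
  have h1 := edge_poincare hD hh (k := fun _ => 1) continuous_const (by simp) (by simp) (by simp)
    (contDiff_dirD hw (b - a))
  rw [integral_dirD_edge hw ha hb] at h1
  have h2 := pS_dirD_le (isBounded_interior_tri a b c) hw hab 1
  have h3 : 0 ≤ 60 * h ^ 2 := by positivity
  nlinarith [mul_le_mul_of_nonneg_left h2 h3]

lemma pS_dirD_dirD_edge_le (hD : det2 (b - a) (c - a) ≠ 0) {h : ℝ}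
    (hh : ∀ x ∈ tri a b c, ∀ y ∈ tri a b c, ‖y - x‖ ≤ h) (hw : ContDiff ℝ ∞ w)
    (ha : w a = 0) (hb : w b = 0) (hm : w ((1 / 2 : ℝ) • (a + b)) = 0) :
    pS 0 (interior (tri a b c)) (dirD (b - a) (dirD (b - a) w)) ≤
      60 * h ^ 6 * pS 3 (interior (tri a b c)) w := by
  have hab : ‖b - a‖ ≤ h := hh a (subset_convexHull ℝ _ (by simp)) b (subset_convexHull ℝ _ (by simp))
  have h1 := edge_poincare hD hh (k := fun s => 4 * min s (1 - s)) (by fun_prop)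
    (fun s hs => mul_nonneg (by norm_num) (le_min hs.1 (sub_nonneg.2 hs.2)))
    (fun s _ => by
      rcases le_total s (1 - s) with h | h
      · rw [min_eq_left h]; linarith
      · rw [min_eq_right h]; linarith) integral_hat
    (contDiff_dirD (contDiff_dirD hw (b - a)) (b - a))
  rw [integral_hat_dirD_edge hw ha hb hm] at h1
  have h2 := pS_dirD_le (isBounded_interior_tri a b c) (contDiff_dirD hw (b - a)) hab 1
  have h3 := pS_dirD_le (isBounded_interior_tri a b c) hw hab 2
  have h4 : 0 ≤ h ^ 2 := by positivity
  have h5 := mul_le_mul_of_nonneg_left h3 h4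
  have h6 : 0 ≤ 60 * h ^ 2 := by positivity
  calc _ ≤ 60 * h ^ 2 * pS 1 (interior (tri a b c)) (dirD (b - a) (dirD (b - a) w)) := by
        simpa using h1
    _ ≤ 60 * h ^ 2 * (h ^ 2 * (h ^ 2 * pS 3 (interior (tri a b c)) w)) :=
        mul_le_mul_of_nonneg_left (h2.trans h5) h6
    _ = _ := by ring

/-- `w` vanishes at the six nodes of the triangle `a b c`. -/
structure VanishesAtNodes (w : Plane → ℝ) (a b c : Plane) : Prop where
  va : w a = 0
  vb : w b = 0
  vc : w c = 0
  mab : w ((1 / 2 : ℝ) • (a + b)) = 0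
  mbc : w ((1 / 2 : ℝ) • (b + c)) = 0
  mac : w ((1 / 2 : ℝ) • (a + c)) = 0

/-- Polarization: when `u` and `v` are two sides of a triangle, `v - u` is the third, so pure second
derivatives along the sides determine the mixed one. -/
lemma dirD_dirD_mixed (hw : ContDiff ℝ ∞ w) (u v : Plane) :
    dirD u (dirD v w) = (1 / 2 : ℝ) • ((1 : ℝ) • dirD u (dirD u w) + (1 : ℝ) • dirD v (dirD v w)) +
      (-(1 / 2) : ℝ) • dirD (v - u) (dirD (v - u) w) := by
  have e : ∀ u v : Plane, dirD u (dirD v w) = fun x => v 0 * (u 0 * pd 0 (pd 0 w) x +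
      u 1 * pd 0 (pd 1 w) x) + v 1 * (u 0 * pd 0 (pd 1 w) x + u 1 * pd 1 (pd 1 w) x) := by
    intro u v
    ext x
    simp only [dirD, pd_lincomb (contDiff_pd hw 0) (contDiff_pd hw 1), pd_comm hw 1 0,
      Pi.add_apply, Pi.smul_apply, smul_eq_mul]
    ring
  ext x
  simp only [e, Pi.add_apply, Pi.smul_apply, smul_eq_mul, PiLp.sub_apply]
  ring

/-- Second derivatives along the three sides are controlled by third derivatives, and polarization
followed by two changes of basis yields the full Hessian. The parameter `κ` measures shape
regularity. -/
lemma pS_two_le (hD : det2 (b - a) (c - a) ≠ 0) {h κ : ℝ} (hκ : h ^ 2 ≤ κ * |det2 (b - a) (c - a)|)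
    (hh : ∀ x ∈ tri a b c, ∀ y ∈ tri a b c, ‖y - x‖ ≤ h) (hw : ContDiff ℝ ∞ w)
    (hv : VanishesAtNodes w a b c) :
    pS 2 (interior (tri a b c)) w ≤ 1920 * κ ^ 4 * h ^ 2 * pS 3 (interior (tri a b c)) w := by
  have ma : a ∈ tri a b c := subset_convexHull ℝ _ (by simp)
  have mb : b ∈ tri a b c := subset_convexHull ℝ _ (by simp)
  have mc : c ∈ tri a b c := subset_convexHull ℝ _ (by simp)
  have q1 := pS_dirD_dirD_edge_le hD hh hw hv.va hv.vb hv.mab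
  have q2 := pS_dirD_dirD_edge_le (a := a) (b := c) (c := b)
    (by rw [det2_swap]; exact neg_ne_zero.2 hD) (by rwa [tri_swap]) hw hv.va hv.vc hv.mac
  have q3 := pS_dirD_dirD_edge_le (a := b) (b := c) (c := a)
    (by rwa [det2_rotate]) (by rwa [tri_rotate]) hw hv.vb hv.vc hv.mbc
  rw [tri_swap] at q2
  rw [tri_rotate] at q3
  have hbd := isBounded_interior_tri a b c
  set K := interior (tri a b c)
  set u := b - a with hu
  set v := c - a with hv'
  have huv : c - b = v - u := by rw [hu, hv']; abel
  rw [huv] at q3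
  have hun : ‖u‖ ≤ h := hh a ma b mb
  have hvn : ‖v‖ ≤ h := hh a ma c mc
  have suu := contDiff_dirD (contDiff_dirD hw u) u
  have svv := contDiff_dirD (contDiff_dirD hw v) v
  have sww := contDiff_dirD (contDiff_dirD hw (v - u)) (v - u)
  set Q := 60 * h ^ 6 * pS 3 K w with hQ
  -- Polarization gives `(1/4 + 1/4)(2 · 2Q + Q)`, which is below `3Q`.
  have q12 : pS 0 K (dirD u (dirD v w)) ≤ 3 * Q := by
    rw [dirD_dirD_mixed hw u v]
    have l1 := pS_lincomb_le hbd suu svv 1 1 0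
    have l2 := pS_lincomb_le hbd ((suu.const_smul (1 : ℝ)).add (svv.const_smul (1 : ℝ))) sww
      (1 / 2) (-(1 / 2)) 0
    change pS 0 K ((1 / 2 : ℝ) • ((1 : ℝ) • dirD u (dirD u w) + (1 : ℝ) • dirD v (dirD v w)) +
      (-(1 / 2) : ℝ) • dirD (v - u) (dirD (v - u) w)) ≤ _ * (pS 0 K
        ((1 : ℝ) • dirD u (dirD u w) + (1 : ℝ) • dirD v (dirD v w)) + _) at l2
    linarith [pS_nonneg 0 K (dirD u (dirD u w))]
  have hcomm : dirD v (dirD u w) = dirD u (dirD v w) := by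
    ext x
    simp only [dirD, pd_lincomb (contDiff_pd hw 0) (contDiff_pd hw 1), pd_comm hw 1 0,
      Pi.add_apply, Pi.smul_apply, smul_eq_mul]
    ring
  have s1 := pS_succ_le_dirD hbd hw hun hvn hD 1
  have s2 := pS_succ_le_dirD hbd (contDiff_dirD hw u) hun hvn hD 0
  have s3 := pS_succ_le_dirD hbd (contDiff_dirD hw v) hun hvn hD 0
  rw [hcomm] at s2
  set r := 2 * (h / det2 u v) ^ 2 with hr
  have hr0 : 0 ≤ r := by positivity
  have hQ0 : 0 ≤ Q := mul_nonneg (by positivity) (pS_nonneg _ _ _)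
  have t2 : pS 1 K (dirD u w) ≤ r * (4 * Q) :=
    s2.trans (mul_le_mul_of_nonneg_left (by linarith) hr0)
  have t3 : pS 1 K (dirD v w) ≤ r * (4 * Q) :=
    s3.trans (mul_le_mul_of_nonneg_left (by linarith) hr0)
  have t1 : pS 2 K w ≤ r * (8 * (r * Q)) :=
    s1.trans (mul_le_mul_of_nonneg_left (by linarith) hr0)
  have hDp : 0 < |det2 u v| := abs_pos.2 hD
  have hκ' : h ^ 2 / |det2 u v| ≤ κ := by rwa [div_le_iff₀ hDp]
  -- The constant is `8 · 2² · 60 = 1920`.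
  have hfin : r * (8 * (r * Q)) = 1920 * (h ^ 2 / |det2 u v|) ^ 4 * h ^ 2 * pS 3 K w := by
    have : (h ^ 2 / |det2 u v|) ^ 4 = h ^ 8 / (det2 u v) ^ 4 := by
      rw [div_pow, ← abs_pow, abs_of_nonneg (by positivity)]
      ring
    rw [this, hr, hQ]
    ring
  rw [hfin] at t1
  refine t1.trans ?_
  have := pS_nonneg 3 K w
  gcongr

/-- The derivatives along two sides, each of zero mean on its edge, already span the gradient. -/
lemma pS_one_le (hD : det2 (b - a) (c - a) ≠ 0) {h κ : ℝ} (hκ : h ^ 2 ≤ κ * |det2 (b - a) (c - a)|)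
    (hh : ∀ x ∈ tri a b c, ∀ y ∈ tri a b c, ‖y - x‖ ≤ h) (hw : ContDiff ℝ ∞ w)
    (hv : VanishesAtNodes w a b c) :
    pS 1 (interior (tri a b c)) w ≤ 240 * κ ^ 2 * h ^ 2 * pS 2 (interior (tri a b c)) w := by
  have ma : a ∈ tri a b c := subset_convexHull ℝ _ (by simp)
  have mb : b ∈ tri a b c := subset_convexHull ℝ _ (by simp)
  have mc : c ∈ tri a b c := subset_convexHull ℝ _ (by simp)
  have q1 := pS_dirD_edge_le hD hh hw hv.va hv.vb
  have q2 := pS_dirD_edge_le (a := a) (b := c) (c := b)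
    (by rw [det2_swap]; exact neg_ne_zero.2 hD) (by rwa [tri_swap]) hw hv.va hv.vc
  rw [tri_swap] at q2
  have hbd := isBounded_interior_tri a b c
  set K := interior (tri a b c)
  have s1 := pS_succ_le_dirD hbd hw (hh a ma b mb) (hh a ma c mc) hD 0
  have hDp : 0 < |det2 (b - a) (c - a)| := abs_pos.2 hD
  have hκ' : h ^ 2 / |det2 (b - a) (c - a)| ≤ κ := by rwa [div_le_iff₀ hDp]
  have hr0 : 0 ≤ 2 * (h / det2 (b - a) (c - a)) ^ 2 := by positivity
  refine s1.trans ((mul_le_mul_of_nonneg_left (add_le_add q1 q2) hr0).trans ?_)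
  have hfin : 2 * (h / det2 (b - a) (c - a)) ^ 2 *
      (60 * h ^ 2 * (h ^ 2 * pS 2 K w) + 60 * h ^ 2 * (h ^ 2 * pS 2 K w)) =
      240 * (h ^ 2 / |det2 (b - a) (c - a)|) ^ 2 * h ^ 2 * pS 2 K w := by
    rw [div_pow, div_pow, sq_abs]
    ring
  rw [hfin]
  have := pS_nonneg 2 K w
  gcongr

/-- The mean of `w` on an edge is bounded by the tangential derivative there, since `w` vanishes at
an end point; the trace inequality returns that derivative to the triangle. -/
lemma pS_zero_le (hD : det2 (b - a) (c - a) ≠ 0) {h : ℝ}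
    (hh : ∀ x ∈ tri a b c, ∀ y ∈ tri a b c, ‖y - x‖ ≤ h) (hw : ContDiff ℝ ∞ w)
    (hv : VanishesAtNodes w a b c) :
    pS 0 (interior (tri a b c)) w ≤ 66 * h ^ 2 * pS 1 (interior (tri a b c)) w +
      2 * h ^ 4 * pS 2 (interior (tri a b c)) w := by
  have ma : a ∈ tri a b c := subset_convexHull ℝ _ (by simp)
  have mb : b ∈ tri a b c := subset_convexHull ℝ _ (by simp)
  have mc : c ∈ tri a b c := subset_convexHull ℝ _ (by simp)
  have hbd := isBounded_interior_tri a b c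
  have h1 := edge_poincare hD hh (k := fun _ => 1) continuous_const (by simp) (by simp) (by simp) hw
  have htr := trace_inequality hD (hh a ma c mc) (hh b mb c mc) (contDiff_dirD hw (b - a))
  have d0 := pS_dirD_le hbd hw (hh a ma b mb) 0
  have d1 := pS_dirD_le hbd hw (hh a ma b mb) 1
  set K := interior (tri a b c)
  set D := |det2 (b - a) (c - a)|
  have hDp : 0 < D := abs_pos.2 hD
  set g : ℝ → ℝ := fun s => dirD (b - a) w (edgeMap a b s) with hg
  have hgc : Continuous g := (contDiff_dirD hw (b - a)).continuous.comp (continuous_edgeMap a b)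
  have hwc : Continuous fun s => w (edgeMap a b s) := hw.continuous.comp (continuous_edgeMap a b)
  -- Integration by parts against `1 - s`: the boundary terms vanish as `w a = 0` and the weight is
  -- zero at `b`.
  have hm : (∫ s in (0 : ℝ)..1, 1 * w (edgeMap a b s)) = ∫ s in (0 : ℝ)..1, (1 - s) * g s := by
    have hd : ∀ s, HasDerivAt (fun s => (1 - s) * w (edgeMap a b s))
        (-(1 * w (edgeMap a b s)) + (1 - s) * g s) s := fun s =>
      (((hasDerivAt_id s).const_sub 1).fun_mul (hasDerivAt_edgeMap hw a b s)).congr_deriv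
        (by simp [hg])
    have := intervalIntegral.integral_eq_sub_of_hasDerivAt (a := 0) (b := 1)
      (fun s _ => hd s) (Continuous.intervalIntegrable (by fun_prop) _ _)
    rw [intervalIntegral.integral_add (Continuous.intervalIntegrable (by fun_prop) _ _)
      (Continuous.intervalIntegrable (by fun_prop) _ _), intervalIntegral.integral_neg] at this
    simp only [edgeMap_zero, hv.va, mul_zero, sub_self, zero_mul] at this
    linarith
  have hm2 : (∫ s in (0 : ℝ)..1, 1 * w (edgeMap a b s)) ^ 2 ≤ ∫ s in (0 : ℝ)..1, g s ^ 2 := by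
    rw [hm]
    refine (sq_integral_le (f := fun s => (1 - s) * g s) (by fun_prop)).trans ?_
    refine intervalIntegral.integral_mono_on zero_le_one
      (Continuous.intervalIntegrable (by fun_prop) _ _)
      (Continuous.intervalIntegrable (by fun_prop) _ _) fun s hs => ?_
    rw [mul_pow]
    have : (1 - s) ^ 2 ≤ 1 := by nlinarith [hs.1, hs.2]
    nlinarith [sq_nonneg (g s)]
  have h2 : D * (∫ s in (0 : ℝ)..1, 1 * w (edgeMap a b s)) ^ 2 ≤
      3 * pS 0 K (dirD (b - a) w) + h ^ 2 * pS 1 K (dirD (b - a) w) := by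
    refine (mul_le_mul_of_nonneg_left (hm2.trans htr) hDp.le).trans (le_of_eq ?_)
    rw [← mul_assoc, mul_one_div_cancel hDp.ne', one_mul]
  have h4 : h ^ 2 * pS 1 K (dirD (b - a) w) ≤ h ^ 2 * (h ^ 2 * pS 2 K w) := by gcongr
  simp only [zero_add] at d0
  nlinarith

/-- The interpolation error estimate on a triangle. -/
lemma interpolation_estimate (hD : det2 (b - a) (c - a) ≠ 0) {h κ : ℝ}
    (hκ : h ^ 2 ≤ κ * |det2 (b - a) (c - a)|)
    (hh : ∀ x ∈ tri a b c, ∀ y ∈ tri a b c, ‖y - x‖ ≤ h) (hw : ContDiff ℝ ∞ w)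
    (hv : VanishesAtNodes w a b c) :
    pS 2 (interior (tri a b c)) w ≤ 1920 * κ ^ 4 * h ^ 2 * pS 3 (interior (tri a b c)) w ∧
    pS 1 (interior (tri a b c)) w ≤
      240 * κ ^ 2 * (1920 * κ ^ 4) * h ^ 4 * pS 3 (interior (tri a b c)) w ∧
    pS 0 (interior (tri a b c)) w ≤
      (66 * (240 * κ ^ 2) + 2) * (1920 * κ ^ 4) * h ^ 6 * pS 3 (interior (tri a b c)) w := by
  have e2 := pS_two_le hD hκ hh hw hv
  have e1 := pS_one_le hD hκ hh hw hv
  have e0 := pS_zero_le hD hh hw hv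
  set K := interior (tri a b c)
  have e1' : pS 1 K w ≤ 240 * κ ^ 2 * (1920 * κ ^ 4) * h ^ 4 * pS 3 K w := by
    refine e1.trans ((mul_le_mul_of_nonneg_left e2 (by positivity)).trans (le_of_eq ?_))
    ring
  refine ⟨e2, e1', e0.trans ?_⟩
  have f1 := mul_le_mul_of_nonneg_left e1' (show 0 ≤ 66 * h ^ 2 by positivity)
  have f2 := mul_le_mul_of_nonneg_left e2 (show 0 ≤ 2 * h ^ 4 by positivity)
  refine (add_le_add f1 f2).trans (le_of_eq ?_)
  ring

end edge

/-! ### Quadratic functions -/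

/-- The quadratic function with the given coefficients. -/
def quad (c : Fin 6 → ℝ) (x : Plane) : ℝ :=
  c 0 + c 1 * x 0 + c 2 * x 1 + c 3 * x 0 ^ 2 + c 4 * (x 0 * x 1) + c 5 * x 1 ^ 2

/-- The coefficients of the partial derivatives of a quadratic function. -/
def quadPd : Fin 2 → (Fin 6 → ℝ) → Fin 6 → ℝ
  | 0, c => ![c 1, 2 * c 3, c 4, 0, 0, 0]
  | 1, c => ![c 2, c 4, 2 * c 5, 0, 0, 0]

lemma contDiff_quad (c : Fin 6 → ℝ) : ContDiff ℝ ∞ (quad c) := by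
  have h : ∀ i : Fin 2, ContDiff ℝ ∞ fun x : Plane => x i := fun i =>
    (EuclideanSpace.proj i : Plane →L[ℝ] ℝ).contDiff
  have h0 := h 0
  have h1 := h 1
  unfold quad
  fun_prop

lemma pd_quad (i : Fin 2) (c : Fin 6 → ℝ) : pd i (quad c) = quad (quadPd i c) := by
  ext x
  have h0 : HasFDerivAt (fun x : Plane => x 0) (EuclideanSpace.proj 0 : Plane →L[ℝ] ℝ) x :=
    (EuclideanSpace.proj 0 : Plane →L[ℝ] ℝ).hasFDerivAt
  have h1 : HasFDerivAt (fun x : Plane => x 1) (EuclideanSpace.proj 1 : Plane →L[ℝ] ℝ) x :=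
    (EuclideanSpace.proj 1 : Plane →L[ℝ] ℝ).hasFDerivAt
  have e : quad c = fun x => c 0 + c 1 * x 0 + c 2 * x 1 + c 3 * (x 0 * x 0) +
      c 4 * (x 0 * x 1) + c 5 * (x 1 * x 1) := by
    ext x; simp only [quad]; ring
  have h := (((((hasFDerivAt_const (c 0) x).fun_add (h0.const_mul (c 1))).fun_add
      (h1.const_mul (c 2))).fun_add ((h0.fun_mul h0).const_mul (c 3))).fun_add
      ((h0.fun_mul h1).const_mul (c 4))).fun_add ((h1.fun_mul h1).const_mul (c 5))
  rw [pd, e, h.fderiv]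
  fin_cases i
  · simp [quad, quadPd]; ring
  · simp [quad, quadPd]; ring

lemma quadPd_three (i j k : Fin 2) (c : Fin 6 → ℝ) : quadPd k (quadPd j (quadPd i c)) = 0 := by
  ext m
  fin_cases i <;> fin_cases j <;> fin_cases k <;> fin_cases m <;> simp [quadPd]

lemma quad_zero : quad 0 = 0 := by ext x; simp [quad]

lemma pS_three_quad (K : Set Plane) (c : Fin 6 → ℝ) : pS 3 K (quad c) = 0 := by
  simp [pS, pd_quad, quadPd_three, quad_zero]

lemma pd_three_quad (i j k : Fin 2) (c : Fin 6 → ℝ) : pd k (pd j (pd i (quad c))) = 0 := by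
  simp [pd_quad, quadPd_three, quad_zero]

/-- Subtracting the interpolant leaves third derivatives unchanged, so the interpolation bound
involves `φ` alone. -/
lemma pS_three_sub_quad (K : Set Plane) {φ : Plane → ℝ} (hφ : ContDiff ℝ ∞ φ) (c : Fin 6 → ℝ) :
    pS 3 K (φ - quad c) = pS 3 K φ := by
  have hq := contDiff_quad c
  have h : ∀ i j k, pd k (pd j (pd i (φ - quad c))) = pd k (pd j (pd i φ)) := by
    intro i j k
    rw [pd_sub hφ hq, pd_sub (contDiff_pd hφ i) (contDiff_pd hq i),
      pd_sub (contDiff_pd (contDiff_pd hφ i) j) (contDiff_pd (contDiff_pd hq i) j), pd_three_quad,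
      sub_zero]
  simp only [pS, h]

/-- `quad` as a linear map. -/
def quadL : (Fin 6 → ℝ) →ₗ[ℝ] Plane → ℝ where
  toFun := quad
  map_add' c d := by ext x; simp [quad]; ring
  map_smul' r c := by ext x; simp [quad]; ring

lemma exists_quad_of_totalDegree_le {p : MvPolynomial (Fin 2) ℝ} (hp : p.totalDegree ≤ 2) :
    ∃ c, ∀ x : Plane, MvPolynomial.eval (fun i => x i) p = quad c x := by
  suffices h : (fun x : Plane => MvPolynomial.eval (fun i => x i) p) ∈ LinearMap.range quadL by
    obtain ⟨c, hc⟩ := h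
    exact ⟨c, fun x => (congrFun hc x).symm⟩
  have e : (fun x : Plane => MvPolynomial.eval (fun i => x i) p) =
      ∑ d ∈ p.support, fun x : Plane => p.coeff d * ∏ i, x i ^ d i := by
    ext x
    rw [MvPolynomial.eval_eq', Finset.sum_apply]
  rw [e]
  refine Submodule.sum_mem _ fun d hd => ?_
  have hdeg : d 0 + d 1 ≤ 2 := by
    have := MvPolynomial.le_totalDegree hd
    rw [Finsupp.sum_fintype _ _ (by simp), Fin.sum_univ_two] at this
    exact this.trans hp
  set t := p.coeff d
  simp only [Fin.prod_univ_two]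
  have h0 : d 0 ≤ 2 := by omega
  have h1 : d 1 ≤ 2 := by omega
  generalize d 0 = m at *
  generalize d 1 = n at *
  have key : ∀ c : Fin 6 → ℝ, (∀ x : Plane, quad c x = t * (x 0 ^ m * x 1 ^ n)) →
      (fun x : Plane => t * (x 0 ^ m * x 1 ^ n)) ∈ LinearMap.range quadL :=
    fun c hc => ⟨c, funext hc⟩
  interval_cases m <;> interval_cases n <;> first | omega | skip
  · exact key ![t, 0, 0, 0, 0, 0] fun x => by simp [quad]
  · exact key ![0, 0, t, 0, 0, 0] fun x => by simp [quad]
  · exact key ![0, 0, 0, 0, 0, t] fun x => by simp [quad]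
  · exact key ![0, t, 0, 0, 0, 0] fun x => by simp [quad]
  · exact key ![0, 0, 0, 0, t, 0] fun x => by simp [quad]
  · exact key ![0, 0, 0, t, 0, 0] fun x => by simp [quad]

lemma exists_totalDegree_le_of_quad (c : Fin 6 → ℝ) :
    ∃ p : MvPolynomial (Fin 2) ℝ, p.totalDegree ≤ 2 ∧
      ∀ x : Plane, quad c x = MvPolynomial.eval (fun i => x i) p := by
  have hm : ∀ (r : ℝ) (m n : ℕ), m + n ≤ 2 →
      (MvPolynomial.C r * (MvPolynomial.X 0 ^ m * MvPolynomial.X 1 ^ n) :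
        MvPolynomial (Fin 2) ℝ).totalDegree ≤ 2 := by
    intro r m n h
    refine (MvPolynomial.totalDegree_mul _ _).trans ?_
    rw [MvPolynomial.totalDegree_C, zero_add]
    refine (MvPolynomial.totalDegree_mul _ _).trans ?_
    rw [MvPolynomial.totalDegree_X_pow, MvPolynomial.totalDegree_X_pow]
    exact h
  have ha : ∀ {p q : MvPolynomial (Fin 2) ℝ}, p.totalDegree ≤ 2 → q.totalDegree ≤ 2 →
      (p + q).totalDegree ≤ 2 := fun hp hq =>
    (MvPolynomial.totalDegree_add _ _).trans (max_le hp hq)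
  refine ⟨_, ha (ha (ha (ha (ha (hm (c 0) 0 0 (by simp)) (hm (c 1) 1 0 (by simp)))
    (hm (c 2) 0 1 (by simp))) (hm (c 3) 2 0 (by simp))) (hm (c 4) 1 1 (by simp)))
    (hm (c 5) 0 2 (by simp)), fun x => ?_⟩
  simp [quad]

/-- A quadratic function on a segment is determined by its values at the end points and the
midpoint. -/
lemma quad_edgeMap (c : Fin 6 → ℝ) (p q : Plane) (s : ℝ) :
    quad c (edgeMap p q s) = (1 - s) * (1 - 2 * s) * quad c p + s * (2 * s - 1) * quad c q +
      4 * s * (1 - s) * quad c ((1 / 2 : ℝ) • (p + q)) := by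
  simp only [quad, edgeMap, PiLp.add_apply, PiLp.smul_apply, PiLp.sub_apply, smul_eq_mul]
  ring

/-! ### Triangles given by their vertex sets -/

/-- The product of two affine functions is quadratic. -/
lemma exists_quad_affine_mul (p q r p' q' r' : ℝ) :
    ∃ c, ∀ x : Plane, (p + q * x 0 + r * x 1) * (p' + q' * x 0 + r' * x 1) = quad c x :=
  ⟨![p * p', p * q' + q * p', p * r' + r * p', q * q', q * r' + r * q', r * r'], fun x => by
    simp [quad]; ring⟩

lemma exists_quad_interpolation_tri {a b c : Plane} (hD : det2 (b - a) (c - a) ≠ 0)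
    (φ : Plane → ℝ) : ∃ d, quad d a = φ a ∧ quad d b = φ b ∧ quad d c = φ c ∧
      quad d ((1 / 2 : ℝ) • (a + b)) = φ ((1 / 2 : ℝ) • (a + b)) ∧
      quad d ((1 / 2 : ℝ) • (b + c)) = φ ((1 / 2 : ℝ) • (b + c)) ∧
      quad d ((1 / 2 : ℝ) • (a + c)) = φ ((1 / 2 : ℝ) • (a + c)) := by
  set D := det2 (b - a) (c - a) with hDd
  have hD' : D = (b 0 - a 0) * (c 1 - a 1) - (b 1 - a 1) * (c 0 - a 0) := rfl
  -- `lb` and `lc` are the barycentric coordinates belonging to `b` and `c`; that of `a` is `1 - lb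
  -- - lc`.
  let lb : Plane → ℝ := fun x => (-(a 0 * (c 1 - a 1) - a 1 * (c 0 - a 0)) / D) +
    ((c 1 - a 1) / D) * x 0 + (-(c 0 - a 0) / D) * x 1
  let lc : Plane → ℝ := fun x => ((a 0 * (b 1 - a 1) - a 1 * (b 0 - a 0)) / D) +
    (-(b 1 - a 1) / D) * x 0 + ((b 0 - a 0) / D) * x 1
  have one_eq : ∀ x : Plane, (1 : ℝ) = 1 + 0 * x 0 + 0 * x 1 := fun x => by ring
  have haff : ∀ (t u v w : ℝ), ∃ α β γ : ℝ, ∀ x : Plane,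
      t + u * lb x + v * lc x + w = α + β * x 0 + γ * x 1 := by
    intro t u v w
    exact ⟨t + w + u * (-(a 0 * (c 1 - a 1) - a 1 * (c 0 - a 0)) / D) +
      v * ((a 0 * (b 1 - a 1) - a 1 * (b 0 - a 0)) / D),
      u * ((c 1 - a 1) / D) + v * (-(b 1 - a 1) / D),
      u * (-(c 0 - a 0) / D) + v * ((b 0 - a 0) / D), fun x => by simp only [lb, lc]; ring⟩
  have hprod : ∀ (t u v t' u' v' : ℝ), ∃ d, ∀ x,
      (t + u * lb x + v * lc x) * (t' + u' * lb x + v' * lc x) = quad d x := by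
    intro t u v t' u' v'
    obtain ⟨α, β, γ, h⟩ := haff t u v 0
    obtain ⟨α', β', γ', h'⟩ := haff t' u' v' 0
    obtain ⟨d, hd⟩ := exists_quad_affine_mul α β γ α' β' γ'
    refine ⟨d, fun x => ?_⟩
    rw [← hd x, ← h x, ← h' x, add_zero, add_zero]
  -- These six products are the Lagrange basis `λ(2λ - 1)` at the vertices and `4λλ'` at the edge
  -- midpoints.
  obtain ⟨d1, h1⟩ := hprod 1 (-1) (-1) 1 (-2) (-2)
  obtain ⟨d2, h2⟩ := hprod 0 1 0 (-1) 2 0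
  obtain ⟨d3, h3⟩ := hprod 0 0 1 (-1) 0 2
  obtain ⟨d4, h4⟩ := hprod 1 (-1) (-1) 0 4 0
  obtain ⟨d5, h5⟩ := hprod 0 1 0 0 0 4
  obtain ⟨d6, h6⟩ := hprod 1 (-1) (-1) 0 0 4
  set d := φ a • d1 + φ b • d2 + φ c • d3 + φ ((1 / 2 : ℝ) • (a + b)) • d4 +
    φ ((1 / 2 : ℝ) • (b + c)) • d5 + φ ((1 / 2 : ℝ) • (a + c)) • d6 with hd
  have hq : ∀ x, quad d x = φ a * quad d1 x + φ b * quad d2 x + φ c * quad d3 x +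
      φ ((1 / 2 : ℝ) • (a + b)) * quad d4 x + φ ((1 / 2 : ℝ) • (b + c)) * quad d5 x +
      φ ((1 / 2 : ℝ) • (a + c)) * quad d6 x := by
    intro x
    simp only [hd, quad, Pi.add_apply, Pi.smul_apply, smul_eq_mul]
    ring
  have lba : lb a = 0 := by simp only [lb]; field_simp; ring
  have lca : lc a = 0 := by simp only [lc]; field_simp; ring
  have lbb : lb b = 1 := by simp only [lb]; field_simp; rw [hD']; ring
  have lcb : lc b = 0 := by simp only [lc]; field_simp; ring
  have lbc : lb c = 0 := by simp only [lb]; field_simp; ring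
  have lcc : lc c = 1 := by simp only [lc]; field_simp; rw [hD']; ring
  have hmid : ∀ x y, lb ((1 / 2 : ℝ) • (x + y)) = (lb x + lb y) / 2 ∧
      lc ((1 / 2 : ℝ) • (x + y)) = (lc x + lc y) / 2 := by
    intro x y
    simp only [lb, lc, PiLp.smul_apply, PiLp.add_apply, smul_eq_mul]
    constructor <;> ring
  refine ⟨d, ?_, ?_, ?_, ?_, ?_, ?_⟩ <;> rw [hq, ← h1, ← h2, ← h3, ← h4, ← h5, ← h6] <;>
    simp only [(hmid _ _).1, (hmid _ _).2, lba, lbb, lbc, lca, lcb, lcc] <;> norm_num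

lemma det2_ne_zero_of_affineIndependent {a b c : Plane} (h : AffineIndependent ℝ ![a, b, c]) :
    det2 (b - a) (c - a) ≠ 0 := by
  rw [affineIndependent_iff] at h
  have key : ∀ p q r : ℝ, p + q + r = 0 → p • a + q • b + r • c = 0 → p = 0 ∧ q = 0 ∧ r = 0 := by
    intro p q r h1 h2
    have := h Finset.univ ![p, q, r] (by simpa [Fin.sum_univ_three] using h1)
      (by simpa [Fin.sum_univ_three] using h2)
    exact ⟨this 0 (by simp), this 1 (by simp), this 2 (by simp)⟩
  intro hD
  have hD' : (b 0 - a 0) * (c 1 - a 1) - (b 1 - a 1) * (c 0 - a 0) = 0 := hD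
  -- The relation `(c - a)ᵢ (b - a) = (b - a)ᵢ (c - a)` is trivial in coordinate `i` and is the
  -- vanishing determinant in the other. Affine independence forces its coefficients to be zero, so
  -- `b = a`.
  have k0 := key (-(c 0 - a 0) + (b 0 - a 0)) (c 0 - a 0) (-(b 0 - a 0)) (by ring) (by
    ext i
    fin_cases i
    · simp; ring
    · simp; linarith)
  have k1 := key (-(c 1 - a 1) + (b 1 - a 1)) (c 1 - a 1) (-(b 1 - a 1)) (by ring) (by
    ext i
    fin_cases i
    · simp; linarith
    · simp; ring)
  have hab : b = a := by
    ext i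
    fin_cases i
    · simpa [sub_eq_zero] using neg_eq_zero.1 k0.2.2
    · simpa [sub_eq_zero] using neg_eq_zero.1 k1.2.2
  have := key 1 (-1) 0 (by ring) (by simp [hab])
  norm_num at this

lemma exists_vertices {s : Finset Plane} (hs : s.card = 3)
    (hi : AffineIndependent ℝ ((↑) : s → Plane)) {e : Finset Plane} (he : e ⊆ s)
    (hec : e.card = 2) : ∃ a b c : Plane, a ≠ b ∧ c ∉ e ∧ e = {a, b} ∧ s = {a, b, c} ∧
      det2 (b - a) (c - a) ≠ 0 := by
  obtain ⟨a, b, hab, rfl⟩ := Finset.card_eq_two.1 hec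
  have h1 : (s \ {a, b}).card = 1 := by
    rw [Finset.card_sdiff_of_subset he, hs, hec]
  obtain ⟨c, hc⟩ := Finset.card_eq_one.1 h1
  have hcs : c ∈ s \ {a, b} := by simp [hc]
  have hs' : s = {a, b, c} := by
    rw [← Finset.union_sdiff_of_subset he, hc]
    ext x; simp
  have hce := (Finset.mem_sdiff.1 hcs).2
  refine ⟨a, b, c, hab, hce, rfl, hs', det2_ne_zero_of_affineIndependent ?_⟩
  have ha : a ∈ s := he (by simp)
  have hb : b ∈ s := he (by simp)
  have hc' : c ∈ s := (Finset.mem_sdiff.1 hcs).1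
  have hca : a ≠ c := fun h => hce (by simp [h])
  have hcb : b ≠ c := fun h => hce (by simp [h])
  let f : Fin 3 ↪ s := ⟨![⟨a, ha⟩, ⟨b, hb⟩, ⟨c, hc'⟩], by
    intro i j hij
    fin_cases i <;> fin_cases j <;> simp_all [Subtype.ext_iff]⟩
  have := hi.comp_embedding f
  convert this using 1
  ext i
  fin_cases i <;> rfl

lemma cell_insert (a b c : Plane) : cell {a, b, c} = tri a b c := by
  simp [cell, tri]

lemma cell_pair (a b : Plane) : cell {a, b} = segment ℝ a b := by
  simp [cell, convexHull_pair]

/-! ### Elementary properties of cells. -/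

lemma isCompact_cell (s : Finset Plane) : IsCompact (cell s) :=
  s.finite_toSet.isCompact_convexHull ℝ

lemma convex_cell (s : Finset Plane) : Convex ℝ (cell s) := convex_convexHull ℝ _

lemma subset_cell (s : Finset Plane) : (s : Set Plane) ⊆ cell s := subset_convexHull ℝ _

lemma norm_sub_le_size {s : Finset Plane} {x y : Plane} (hx : x ∈ cell s) (hy : y ∈ cell s) :
    ‖y - x‖ ≤ size s := by
  rw [← dist_eq_norm]
  exact Metric.dist_le_diam_of_mem (isCompact_cell s).isBounded hy hx

lemma size_pair (a b : Plane) : size {a, b} = ‖b - a‖ := by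
  rw [size, cell_pair, ← convexHull_pair, convexHull_diam, Metric.diam_pair, dist_comm,
    dist_eq_norm]

/-! ### Traces on the edges of a triangle -/

/-- `e` is an edge of the nondegenerate triangle `s`. -/
def IsTriEdge (s e : Finset Plane) : Prop :=
  ∃ a b c : Plane, a ≠ b ∧ c ∉ e ∧ e = {a, b} ∧ s = {a, b, c} ∧ det2 (b - a) (c - a) ≠ 0

/-- The arc length measure on an edge. -/
def edgeMeasure (e : Finset Plane) : Measure Plane := (μH[1]).restrict (cell e)

lemma isBounded_interior_cell (s : Finset Plane) : Bornology.IsBounded (interior (cell s)) :=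
  (isCompact_cell s).isBounded.subset interior_subset

section

variable {s e : Finset Plane}

lemma IsTriEdge.isFiniteMeasure (h : IsTriEdge s e) : IsFiniteMeasure (edgeMeasure e) := by
  obtain ⟨a, b, c, -, -, rfl, -⟩ := h
  refine ⟨?_⟩
  rw [edgeMeasure, Measure.restrict_apply_univ, cell_pair, hausdorffMeasure_segment]
  exact edist_lt_top a b

lemma IsTriEdge.memLp (h : IsTriEdge s e) {ψ : Plane → ℝ} (hψ : Continuous ψ) :
    MemLp ψ 2 (edgeMeasure e) := by
  have := h.isFiniteMeasure
  obtain ⟨C, hC⟩ := (isCompact_cell e).exists_bound_of_continuousOn hψ.continuousOn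
  refine MemLp.of_bound hψ.aestronglyMeasurable C ?_
  exact (ae_restrict_iff' (isCompact_cell e).isClosed.measurableSet).2 (Eventually.of_forall hC)

lemma IsTriEdge.area_pos (h : IsTriEdge s e) : 0 < volume.real (cell s) := by
  obtain ⟨a, b, c, -, -, -, rfl, hD⟩ := h
  rw [cell_insert, volume_real_tri hD]
  have := abs_pos.2 hD
  positivity

/-- The constant in the trace inequality for the edge `e` of the triangle `s`. -/
def traceConst (s e : Finset Plane) : ℝ := size e / (2 * volume.real (cell s))

/-- Arc length contributes the factor `|e|`, and the determinant is twice the area; this explains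
`traceConst`. -/
lemma IsTriEdge.trace_smooth_le (h : IsTriEdge s e) {ψ : Plane → ℝ} (hψ : ContDiff ℝ ∞ ψ) :
    ∫ x, ψ x ^ 2 ∂(edgeMeasure e) ≤ traceConst s e *
      (3 * pS 0 (interior (cell s)) ψ + size s ^ 2 * pS 1 (interior (cell s)) ψ) := by
  obtain ⟨a, b, c, hab, -, rfl, rfl, hD⟩ := h
  have ha : a ∈ cell {a, b, c} := subset_cell _ (by simp)
  have hb : b ∈ cell {a, b, c} := subset_cell _ (by simp)
  have hc : c ∈ cell {a, b, c} := subset_cell _ (by simp)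
  have h1 := trace_inequality hD (norm_sub_le_size ha hc) (norm_sub_le_size hb hc) hψ
  rw [edgeMeasure, cell_pair, integral_segment hab (fun x => ψ x ^ 2)]
  have h2 := mul_le_mul_of_nonneg_left h1 (norm_nonneg (b - a))
  refine h2.trans (le_of_eq ?_)
  rw [traceConst, size_pair, cell_insert, volume_real_tri hD]
  ring

lemma pS_zero_sub_eq_dist {μ : Measure Plane} {f g : Plane → ℝ} (hf : MemLp f 2 μ)
    (hg : MemLp g 2 μ) : ∫ x, (f x - g x) ^ 2 ∂μ = dist (hf.toLp f) (hg.toLp g) ^ 2 := by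
  rw [dist_eq_norm, ← MemLp.toLp_sub hf hg, ← real_inner_self_eq_norm_sq, L2.inner_def]
  refine integral_congr_ae ?_
  filter_upwards [(hf.sub hg).coeFn_toLp] with x hx
  rw [hx]
  simp [sq]

lemma ConvL2.tendsto_pS_zero_sub {K : Set Plane} {φ ψ : ℕ → Plane → ℝ} {w : Plane → ℝ}
    (h : ConvL2 (volume.restrict K) φ w) (h' : ConvL2 (volume.restrict K) ψ w) :
    Tendsto (fun n : ℕ × ℕ => pS 0 K (φ n.1 - ψ n.2)) atTop (𝓝 0) := by
  have t1 : Tendsto (fun n : ℕ × ℕ => (h.memLp n.1).toLp (φ n.1)) (atTop ×ˢ atTop) (𝓝 _) :=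
    h.tendsto_toLp.comp tendsto_fst
  have t2 : Tendsto (fun n : ℕ × ℕ => (h'.memLp n.2).toLp (ψ n.2)) (atTop ×ˢ atTop) (𝓝 _) :=
    h'.tendsto_toLp.comp tendsto_snd
  have t3 := (t1.dist t2).pow 2
  rw [dist_self, prod_atTop_atTop_eq, zero_pow two_ne_zero] at t3
  exact t3.congr fun n => (pS_zero_sub_eq_dist (h.memLp n.1) (h'.memLp n.2)).symm

lemma Conv.cauchy_pS {K : Set Plane} (hK : IsOpen K) {φ ψ : ℕ → Plane → ℝ} {w : Plane → ℝ}
    (hφ : ∀ n, ContDiff ℝ ∞ (φ n)) (hψ : ∀ n, ContDiff ℝ ∞ (ψ n)) (h : Conv 1 K φ w)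
    (h' : Conv 1 K ψ w) (p q : ℝ) :
    Tendsto (fun n : ℕ × ℕ => p * pS 0 K (φ n.1 - ψ n.2) + q * pS 1 K (φ n.1 - ψ n.2)) atTop
      (𝓝 0) := by
  have h0 : Tendsto (fun n : ℕ × ℕ => pS 0 K (φ n.1 - ψ n.2)) atTop (𝓝 0) :=
    h.1.tendsto_pS_zero_sub h'.1
  have hi : ∀ i, Tendsto (fun n : ℕ × ℕ => pS 0 K (pd i (φ n.1) - pd i (ψ n.2))) atTop (𝓝 0) :=
    fun i => ConvL2.tendsto_pS_zero_sub (φ := fun n => pd i (φ n)) (ψ := fun n => pd i (ψ n))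
      (h.wD hK hφ i).convL2 (h'.wD hK hψ i).convL2
  have h1 : Tendsto (fun n : ℕ × ℕ => pS 1 K (φ n.1 - ψ n.2)) atTop (𝓝 0) := by
    have := tendsto_finsetSum Finset.univ fun i _ => hi i
    rw [Finset.sum_const_zero] at this
    refine this.congr fun n => ?_
    simp only [pS, pd_sub (hφ n.1) (hψ n.2)]
  simpa using (h0.const_mul p).add (h1.const_mul q)

/-- The trace inequality is applied to `φ m - ψ n`. With `φ = ψ` it says that the restrictions are
Cauchy in `L²(e)`, and for two sequences it says that the trace is independent of the approximation.
-/
lemma IsTriEdge.tendsto_dist (he : IsTriEdge s e) {φ ψ : ℕ → Plane → ℝ} {w : Plane → ℝ}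
    (hφ : ∀ n, ContDiff ℝ ∞ (φ n)) (hψ : ∀ n, ContDiff ℝ ∞ (ψ n))
    (h : Conv 1 (interior (cell s)) φ w) (h' : Conv 1 (interior (cell s)) ψ w) :
    Tendsto (fun n : ℕ × ℕ => dist ((he.memLp (hφ n.1).continuous).toLp (φ n.1))
      ((he.memLp (hψ n.2).continuous).toLp (ψ n.2))) atTop (𝓝 0) := by
  have h1 := h.cauchy_pS isOpen_interior hφ hψ h' (traceConst s e * 3)
    (traceConst s e * size s ^ 2)
  have h2 := (Real.continuous_sqrt.tendsto 0).comp h1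
  rw [Real.sqrt_zero] at h2
  refine squeeze_zero (fun n => dist_nonneg) (fun n => ?_) h2
  refine Real.le_sqrt_of_sq_le ?_
  rw [← pS_zero_sub_eq_dist]
  refine (he.trace_smooth_le ((hφ n.1).sub (hψ n.2))).trans (le_of_eq ?_)
  change traceConst s e * (3 * pS 0 (interior (cell s)) (φ n.1 - ψ n.2) +
    size s ^ 2 * pS 1 (interior (cell s)) (φ n.1 - ψ n.2)) = _
  ring

lemma IsTriEdge.exists_trace (he : IsTriEdge s e) {φ : ℕ → Plane → ℝ} {w : Plane → ℝ}
    (hφ : ∀ n, ContDiff ℝ ∞ (φ n)) (h : Conv 1 (interior (cell s)) φ w) :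
    ∃ g, ConvL2 (edgeMeasure e) φ g := by
  have hc : CauchySeq fun n => (he.memLp (hφ n).continuous).toLp (φ n) := by
    rw [cauchySeq_iff_tendsto_dist_atTop_0]
    exact he.tendsto_dist hφ hφ h h
  obtain ⟨g, hg⟩ := cauchySeq_tendsto_of_complete hc
  refine ⟨g, fun n => he.memLp (hφ n).continuous, Lp.memLp g, ?_⟩
  exact (Lp.tendsto_Lp_iff_tendsto_eLpNorm'' φ _ g (Lp.memLp g)).1 (by simpa using hg)

lemma IsTriEdge.trace_unique (he : IsTriEdge s e) {φ ψ : ℕ → Plane → ℝ} {w g g' : Plane → ℝ}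
    (hφ : ∀ n, ContDiff ℝ ∞ (φ n)) (hψ : ∀ n, ContDiff ℝ ∞ (ψ n))
    (h : Conv 1 (interior (cell s)) φ w) (h' : Conv 1 (interior (cell s)) ψ w)
    (hg : ConvL2 (edgeMeasure e) φ g) (hg' : ConvL2 (edgeMeasure e) ψ g') :
    g =ᵐ[edgeMeasure e] g' := by
  have hd : Tendsto (fun n : ℕ => (n, n)) atTop (atTop : Filter (ℕ × ℕ)) := by
    rw [← prod_atTop_atTop_eq]
    exact tendsto_id.prodMk tendsto_id
  have h1 := (he.tendsto_dist hφ hψ h h').comp hd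
  have h2 := hg.tendsto_toLp.dist hg'.tendsto_toLp
  have h3 := tendsto_nhds_unique h1 h2
  exact (MemLp.toLp_eq_toLp_iff _ _).1 (dist_eq_zero.1 h3.symm)

/-- For an approximable `w` the required square integrability is automatic, so the definition of a
trace becomes convergence in the sense of `Conv` and `ConvL2`. -/
lemma IsTriEdge.isTrace_iff (he : IsTriEdge s e) {w g : Plane → ℝ}
    (hw : Approx 1 (interior (cell s)) w) : IsTrace s e w g ↔
      ∃ φ : ℕ → Plane → ℝ, (∀ n, ContDiff ℝ ∞ (φ n)) ∧ Conv 1 (interior (cell s)) φ w ∧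
        ConvL2 (edgeMeasure e) φ g := by
  have hb := isBounded_interior_cell s
  constructor
  · rintro ⟨hg, φ, hφ, h1, h2, h3⟩
    refine ⟨φ, hφ, ⟨⟨fun n => memLp_of_contDiff hb (hφ n), hw.memLp, h1⟩, fun i => ⟨_,
      fun n => memLp_of_contDiff hb (contDiff_pd (hφ n) i), (hw.wD isOpen_interior i).memLp,
      h2 i⟩⟩, fun n => he.memLp (hφ n).continuous, hg, h3⟩
  · rintro ⟨φ, hφ, h, hg⟩
    exact ⟨hg.memLp_lim, φ, hφ, h.1.tendsto,
      fun i => (h.wD isOpen_interior hφ i).convL2.tendsto, hg.tendsto⟩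

/-- The trace is the limit in `L²(e)` of the restrictions of smooth approximations. -/
lemma Conv.trace (he : IsTriEdge s e) {φ : ℕ → Plane → ℝ} {w : Plane → ℝ}
    (hφ : ∀ n, ContDiff ℝ ∞ (φ n)) (h : Conv 1 (interior (cell s)) φ w) :
    ConvL2 (edgeMeasure e) φ (trace s e w) := by
  have hw : Approx 1 (interior (cell s)) w := ⟨φ, hφ, h⟩
  obtain ⟨g, hg⟩ := he.exists_trace hφ h
  have hex : ∃ g, IsTrace s e w g := ⟨g, (he.isTrace_iff hw).2 ⟨φ, hφ, h, hg⟩⟩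
  have ht : IsTrace s e w (C0IP.trace s e w) := by
    rw [C0IP.trace, dif_pos hex]
    exact hex.choose_spec
  obtain ⟨ψ, hψ, h', hg'⟩ := (he.isTrace_iff hw).1 ht
  exact hg.congr (fun n => ae_eq_rfl) (he.trace_unique hφ hψ h h' hg hg')

lemma Approx.memLp_trace (he : IsTriEdge s e) {w : Plane → ℝ}
    (hw : Approx 1 (interior (cell s)) w) : MemLp (C0IP.trace s e w) 2 (edgeMeasure e) := by
  obtain ⟨φ, hφ, h⟩ := hw
  exact (h.trace he hφ).memLp_lim

lemma Approx.trace_le (he : IsTriEdge s e) {w : Plane → ℝ}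
    (hw : Approx 1 (interior (cell s)) w) :
    ∫ x, C0IP.trace s e w x ^ 2 ∂(edgeMeasure e) ≤ traceConst s e *
      (3 * nS 0 (interior (cell s)) w + size s ^ 2 * nS 1 (interior (cell s)) w) := by
  obtain ⟨φ, hφ, h⟩ := hw
  have t0 := h.of_succ.tendsto_pS isOpen_interior hφ
  have t1 := h.tendsto_pS isOpen_interior hφ
  exact le_of_tendsto_of_tendsto' (h.trace he hφ).tendsto_integral_sq
    (((t0.const_mul 3).add (t1.const_mul (size s ^ 2))).const_mul (traceConst s e))
    fun n => he.trace_smooth_le (hφ n)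

lemma Approx.trace_congr (he : IsTriEdge s e) {w w' : Plane → ℝ}
    (hw : Approx 1 (interior (cell s)) w) (h : w =ᵐ[volume.restrict (interior (cell s))] w') :
    C0IP.trace s e w =ᵐ[edgeMeasure e] C0IP.trace s e w' := by
  obtain ⟨φ, hφ, hc⟩ := hw
  exact (hc.trace he hφ).unique ((hc.congr_lim h).trace he hφ)

lemma Approx.trace_add (he : IsTriEdge s e) {w w' : Plane → ℝ}
    (hw : Approx 1 (interior (cell s)) w) (hw' : Approx 1 (interior (cell s)) w') :
    C0IP.trace s e (w + w') =ᵐ[edgeMeasure e] C0IP.trace s e w + C0IP.trace s e w' := by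
  obtain ⟨φ, hφ, h⟩ := hw
  obtain ⟨ψ, hψ, h'⟩ := hw'
  exact ((h.add hφ hψ h').trace he fun n => (hφ n).add (hψ n)).unique
    ((h.trace he hφ).add (h'.trace he hψ))

lemma Approx.trace_smul (he : IsTriEdge s e) {w : Plane → ℝ}
    (hw : Approx 1 (interior (cell s)) w) (c : ℝ) :
    C0IP.trace s e (c • w) =ᵐ[edgeMeasure e] c • C0IP.trace s e w := by
  obtain ⟨φ, hφ, h⟩ := hw
  exact ((h.smul hφ c).trace he fun n => (hφ n).const_smul c).unique
    ((h.trace he hφ).const_smul c)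

/-! ### Normal derivatives -/

/-- The normal is picked by `Classical.epsilon`, so an outward unit normal has to be exhibited
before its properties are available. The estimates rely on its length alone. -/
lemma IsTriEdge.norm_normal (he : IsTriEdge s e) : ‖normal s e‖ = 1 := by
  have hex : ∃ n, IsOutwardNormal s e n := by
    obtain ⟨a, b, c, hab, hce, rfl, rfl, hD⟩ := he
    -- This is `b - a` rotated by a right angle, so its inner product with `v` is `det2 (b - a) v`;
    -- it is normalised and given the sign that points away from `c`.
    set m : Plane := !₂[-(b - a) 1, (b - a) 0] with hm
    have hin : ∀ v : Plane, inner ℝ m v = det2 (b - a) v := by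
      intro v
      simp only [PiLp.inner_apply, Fin.sum_univ_two, hm, det2]
      simp
      ring
    have hm0 : m ≠ 0 := by
      intro h0
      have := hin (c - a)
      rw [h0, inner_zero_left] at this
      exact hD this.symm
    have hmn : 0 < ‖m‖ := norm_pos_iff.2 hm0
    set r : ℝ := -(SignType.sign (det2 (b - a) (c - a)) : ℝ) * ‖m‖⁻¹ with hr
    have hab0 : det2 (b - a) (b - a) = 0 := by simp only [det2]; ring
    have hba0 : det2 (b - a) (a - b) = 0 := by
      simp only [det2, PiLp.sub_apply]; ring
    have hcb : det2 (b - a) (c - b) = det2 (b - a) (c - a) := by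
      simp only [det2, PiLp.sub_apply]; ring
    have hneg : r * det2 (b - a) (c - a) < 0 := by
      have : r * det2 (b - a) (c - a) = -(|det2 (b - a) (c - a)| * ‖m‖⁻¹) := by
        rw [hr, ← sign_mul_self (det2 (b - a) (c - a))]
        ring
      rw [this]
      have := abs_pos.2 hD
      exact neg_neg_of_pos (by positivity)
    refine ⟨r • m, ?_, ?_, ?_⟩
    · rw [norm_smul, hr, norm_mul, norm_neg, norm_inv, norm_norm]
      rcases lt_or_gt_of_ne hD with h | h
      · simp [sign_neg h, hmn.ne']
      · simp [sign_pos h, hmn.ne']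
    · intro x hx y hy
      rw [inner_smul_left, hin]
      simp only [Finset.mem_insert, Finset.mem_singleton] at hx hy
      rcases hx with rfl | rfl <;> rcases hy with rfl | rfl <;> simp [det2]
      all_goals (right; ring)
    · intro x hx z hz hze
      rw [inner_smul_left, hin]
      simp only [Finset.mem_insert, Finset.mem_singleton] at hx hz hze
      have hzc : z = c := by tauto
      subst hzc
      rcases hx with rfl | rfl
      · simpa using hneg
      · simpa [hcb] using hneg
  exact (Classical.epsilon_spec hex).1

lemma IsTriEdge.normal_sq (he : IsTriEdge s e) : normal s e 0 ^ 2 + normal s e 1 ^ 2 = 1 := by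
  have := EuclideanSpace.norm_sq_eq (normal s e)
  rw [he.norm_normal] at this
  simpa [Fin.sum_univ_two] using this.symm

end

/-! ### Combinatorics of triangulations of plane domains -/

lemma volume_cell_of_card_le_two {s : Finset Plane} (hs : s.card ≤ 2) : volume (cell s) = 0 := by
  have h : affineSpan ℝ (s : Set Plane) ≠ ⊤ := by
    intro h
    have h1 : Module.finrank ℝ (vectorSpan ℝ (s : Set Plane)) ≤ 1 := by
      rcases s.eq_empty_or_nonempty with hs0 | hne
      · rw [hs0, Finset.coe_empty, vectorSpan_empty, finrank_bot]
        exact Nat.zero_le 1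
      · have h2 := finrank_vectorSpan_image_finset_le ℝ (fun x : Plane => x) s
          (n := s.card - 1) (by have := hne.card_pos; omega)
        rw [Finset.coe_image, image_id'] at h2
        omega
    rw [← direction_affineSpan, h, AffineSubspace.direction_top, finrank_top,
      finrank_euclideanSpace_fin] at h1
    omega
  exact measure_mono_null (convexHull_subset_affineSpan _)
    (Measure.addHaar_affineSubspace volume _ h)

section

variable {Ω : Set Plane} {T : Geometry.SimplicialComplex ℝ Plane} {s t e : Finset Plane}

lemma exists_vertices_of_mem_triangles (hs : s ∈ triangles T) :
    ∃ a b c : Plane, s = {a, b, c} ∧ det2 (b - a) (c - a) ≠ 0 := by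
  obtain ⟨e, he, hc⟩ := Finset.exists_subset_card_eq (show 2 ≤ s.card by rw [hs.2]; omega)
  obtain ⟨a, b, c, -, -, -, h, hD⟩ := exists_vertices hs.2 (T.indep hs.1) he hc
  exact ⟨a, b, c, h, hD⟩

lemma isTriEdge_of_mem_adjacent (he : e ∈ edges T) (hs : s ∈ adjacent T e) : IsTriEdge s e :=
  exists_vertices hs.1.2 (T.indep hs.1.1) hs.2 he.2

lemma cell_inter_cell (hs : s ∈ triangles T) (ht : t ∈ triangles T) :
    cell s ∩ cell t = cell (s ∩ t) := by
  simpa [cell] using T.convexHull_inter_convexHull hs.1 ht.1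

lemma card_inter_le_two (hs : s ∈ triangles T) (ht : t ∈ triangles T) (hst : s ≠ t) :
    (s ∩ t).card ≤ 2 := by
  by_contra! h
  have h1 := Finset.eq_of_subset_of_card_le (Finset.inter_subset_left : s ∩ t ⊆ s)
    (by rw [hs.2]; omega)
  have h2 := Finset.eq_of_subset_of_card_le (Finset.inter_subset_right : s ∩ t ⊆ t)
    (by rw [ht.2]; omega)
  exact hst (h1.symm.trans h2)

/-- Two distinct triangles meet in a face with at most two vertices, which has measure zero; an open
null set is empty. -/
lemma pairwiseDisjoint_interior_cell :
    (triangles T).PairwiseDisjoint fun s => interior (cell s) := by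
  intro s hs t ht hst
  rw [Function.onFun, Set.disjoint_iff_inter_eq_empty]
  refine (isOpen_interior.inter isOpen_interior).eq_empty_of_measure_zero (μ := volume)
    (measure_mono_null ?_ (volume_cell_of_card_le_two (card_inter_le_two hs ht hst)))
  rw [← cell_inter_cell hs ht]
  exact inter_subset_inter interior_subset interior_subset

lemma IsTriangulation.finite_triangles (hT : IsTriangulation Ω T) : (triangles T).Finite :=
  hT.finite.subset fun _ h => h.1

lemma IsTriangulation.finite_edges (hT : IsTriangulation Ω T) : (edges T).Finite :=
  hT.finite.subset fun _ h => h.1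

lemma IsTriangulation.finite_adjacent (hT : IsTriangulation Ω T) (e : Finset Plane) :
    (adjacent T e).Finite :=
  hT.finite_triangles.subset fun _ h => h.1

lemma IsTriangulation.cell_subset (hT : IsTriangulation Ω T) (hs : s ∈ triangles T) :
    cell s ⊆ closure Ω :=
  hT.space_eq ▸ T.convexHull_subset_space hs.1

lemma IsTriangulation.interior_cell_subset (hT : IsTriangulation Ω T) (hΩ : IsPolygonalDomain Ω)
    (hs : s ∈ triangles T) : interior (cell s) ⊆ Ω := by
  rw [← hΩ.lipschitz.interior_closure hΩ.isOpen]
  exact interior_mono (hT.cell_subset hs)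

lemma IsTriangulation.isClosed_iUnion (hT : IsTriangulation Ω T) :
    IsClosed (⋃ s ∈ triangles T, cell s) :=
  hT.finite_triangles.isClosed_biUnion fun s _ => (isCompact_cell s).isClosed

/-- Affine independence in the plane limits faces to three vertices, and faces with fewer have
measure zero. -/
lemma IsTriangulation.volume_diff (hT : IsTriangulation Ω T) :
    volume (closure Ω \ ⋃ s ∈ triangles T, cell s) = 0 := by
  refine measure_mono_null (t := ⋃ s ∈ {s ∈ T.faces | s.card ≤ 2}, cell s) ?_ ?_
  · rintro x ⟨hx, hx'⟩
    rw [← hT.space_eq, Geometry.SimplicialComplex.mem_space_iff] at hx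
    obtain ⟨s, hs, hxs⟩ := hx
    have hc : s.card ≤ 3 := by
      have := (T.indep hs).card_le_finrank_succ
      have h2 : Module.finrank ℝ (vectorSpan ℝ (range ((↑) : s → Plane))) ≤ 2 := by
        have := Submodule.finrank_le (vectorSpan ℝ (range ((↑) : s → Plane)))
        simpa using this
      rw [Fintype.card_coe] at this
      omega
    have : s.card ≠ 3 := fun h => hx' (mem_iUnion₂.2 ⟨s, ⟨hs, h⟩, hxs⟩)
    exact mem_iUnion₂.2 ⟨s, ⟨hs, by omega⟩, hxs⟩
  · exact (measure_biUnion_null_iff (hT.finite.subset fun s hs => hs.1).countable).2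
      fun s hs => volume_cell_of_card_le_two hs.2

/-- The part of `Ω` outside the closed union of the triangles is open and null, hence empty; so
faces lying in no triangle add nothing. -/
lemma IsTriangulation.closure_eq (hT : IsTriangulation Ω T) (hΩ : IsPolygonalDomain Ω) :
    closure Ω = ⋃ s ∈ triangles T, cell s := by
  refine Subset.antisymm (closure_minimal ?_ hT.isClosed_iUnion)
    (iUnion₂_subset fun s hs => hT.cell_subset hs)
  rw [← sdiff_eq_empty]
  exact (hΩ.isOpen.sdiff hT.isClosed_iUnion).eq_empty_of_measure_zero
    (measure_mono_null (sdiff_subset_sdiff_left subset_closure) hT.volume_diff)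

lemma IsTriangulation.ae_mem_interior (hT : IsTriangulation Ω T) (hΩ : IsPolygonalDomain Ω) :
    (Ω : Set Plane) =ᵐ[volume] ⋃ s ∈ hT.finite_triangles.toFinset, interior (cell s) := by
  have h0 : volume (⋃ s ∈ triangles T, cell s \ interior (cell s)) = 0 := by
    refine (measure_biUnion_null_iff hT.finite_triangles.countable).2 fun s _ => ?_
    rw [← (isCompact_cell s).isClosed.frontier_eq]
    exact (convex_cell s).addHaar_frontier volume
  refine Filter.EventuallyEq.symm (Filter.eventuallyLE_antisymm_iff.2 ⟨?_, ?_⟩)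
  · refine (LE.le.eventuallyLE ?_)
    intro x hx
    simp only [Finite.mem_toFinset, mem_iUnion] at hx
    obtain ⟨s, hs, hx⟩ := hx
    exact hT.interior_cell_subset hΩ hs hx
  · rw [ae_le_set]
    refine measure_mono_null ?_ h0
    rintro x ⟨hx, hx'⟩
    have := subset_closure hx
    rw [hT.closure_eq hΩ] at this
    obtain ⟨s, hs, hxs⟩ := mem_iUnion₂.1 this
    refine mem_iUnion₂.2 ⟨s, hs, hxs, fun h => hx' ?_⟩
    exact mem_iUnion₂.2 ⟨s, by simpa using hs, h⟩

lemma IsTriangulation.setIntegral_eq_sum (hT : IsTriangulation Ω T) (hΩ : IsPolygonalDomain Ω)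
    {F : Plane → ℝ} (hF : IntegrableOn F Ω) :
    ∫ x in Ω, F x = ∑ s ∈ hT.finite_triangles.toFinset, ∫ x in interior (cell s), F x := by
  rw [setIntegral_congr_set (hT.ae_mem_interior hΩ), integral_biUnion_finset]
  · exact fun s _ => isOpen_interior.measurableSet
  · rw [Finite.coe_toFinset]
    exact pairwiseDisjoint_interior_cell
  · exact fun s hs => hF.mono_set (hT.interior_cell_subset hΩ (by simpa using hs))

/-! ### Mesh size and shape regularity. -/

lemma size_nonneg (s : Finset Plane) : 0 ≤ size s := Metric.diam_nonneg

lemma IsTriEdge.size_le (h : IsTriEdge s e) : size e ≤ size s := by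
  obtain ⟨a, b, c, -, -, rfl, rfl, -⟩ := h
  refine Metric.diam_mono (convexHull_mono ?_) (isCompact_cell _).isBounded
  simp [insert_subset_iff]

lemma IsTriEdge.size_pos (h : IsTriEdge s e) : 0 < size e := by
  obtain ⟨a, b, c, hab, -, rfl, -⟩ := h
  rw [size_pair]
  exact norm_pos_iff.2 (sub_ne_zero.2 hab.symm)

lemma IsTriangulation.size_le_meshSize (hT : IsTriangulation Ω T) (hs : s ∈ triangles T) :
    size s ≤ meshSize T :=
  le_csSup (hT.finite_triangles.image _).bddAbove (mem_image_of_mem _ hs)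

lemma IsTriangulation.meshSize_nonneg : 0 ≤ meshSize T :=
  Real.sSup_nonneg (by rintro _ ⟨s, -, rfl⟩; exact size_nonneg s)

lemma IsTriangulation.meshSize_le (hT : IsTriangulation Ω T) (hΩ : IsPolygonalDomain Ω) :
    meshSize T ≤ Metric.diam (closure Ω) :=
  Real.sSup_le (by
    rintro _ ⟨s, hs, rfl⟩
    exact Metric.diam_mono (hT.cell_subset hs) hΩ.bounded.closure) Metric.diam_nonneg

/-- The triangle contains a disc of area `π r²`, while `size s ≤ 2σr`; `π ≥ 2` would already
suffice. -/
lemma ShapeRegular.size_sq_le {σ : ℝ} (h : ShapeRegular σ T) (hs : s ∈ triangles T) :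
    size s ^ 2 ≤ 2 * σ ^ 2 * volume.real (cell s) := by
  obtain ⟨x, r, hr, hsub, hle⟩ := h s hs
  have hv : Real.pi * r ^ 2 ≤ volume.real (cell s) := by
    have h1 := measureReal_mono (μ := volume) hsub (isCompact_cell s).measure_lt_top.ne
    have h2 : volume.real (Metric.closedBall x r) = Real.pi * r ^ 2 := by
      rw [measureReal_def, EuclideanSpace.volume_closedBall_fin_two, ENNReal.toReal_mul,
        ENNReal.toReal_pow, ENNReal.toReal_ofReal hr.le]
      simp [mul_comm, Real.pi_pos.le]
    rwa [h2] at h1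
  have h1 : size s ^ 2 ≤ (σ * (2 * r)) ^ 2 := pow_le_pow_left₀ (size_nonneg s) hle 2
  nlinarith [Real.pi_gt_three, sq_nonneg σ, mul_le_mul_of_nonneg_left hv (sq_nonneg σ),
    mul_nonneg (sq_nonneg σ) (sq_nonneg r)]

/-! ### At most two triangles share an edge -/

/-- If `c` and `d` lie on the same side of the line `a b`, a point slightly above the midpoint of
the edge belongs to both triangles. -/
lemma exists_mem_tri_inter {a b c d : Plane}
    (h : 0 < det2 (b - a) (c - a) * det2 (b - a) (d - a)) :
    ∃ x ∈ tri a b c ∩ tri a b d, det2 (b - a) (x - a) ≠ 0 := by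
  have hc : det2 (b - a) (c - a) ≠ 0 := left_ne_zero_of_mul h.ne'
  have hd : det2 (b - a) (d - a) ≠ 0 := right_ne_zero_of_mul h.ne'
  set C := det2 (b - a) (c - a) with hC
  set D := det2 (b - a) (d - a) with hDd
  set μ := C / D with hμ
  have hμ0 : 0 < μ := by
    rw [hμ, div_eq_mul_inv, ← mul_pos_iff_of_pos_right (sq_pos_of_ne_zero hd)]
    field_simp; linarith
  set l := det2 (c - a) (d - a) / D with hl
  have hdec : c - a = l • (b - a) + μ • (d - a) := by
    ext i
    have e : det2 (b - a) (d - a) = D := rfl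
    simp only [PiLp.add_apply, PiLp.smul_apply, smul_eq_mul, hl, hμ]
    rw [div_mul_eq_mul_div, div_mul_eq_mul_div, ← add_div, eq_div_iff hd, ← e, hC]
    simp only [det2, PiLp.sub_apply]
    fin_cases i <;> simp <;> ring
  -- This choice makes `q`, `|q l|` and `q μ` sum to `1/4`, so the coordinates `(1/2, q)` and `(1/2
  -- + q l, q μ)` are admissible in the two triangles.
  set q := 1 / (4 * (1 + |l| + μ)) with hq
  have hden : 0 < 1 + |l| + μ := by positivity
  have hq0 : 0 < q := by positivity
  have hqs : q * (1 + |l| + μ) = 1 / 4 := by rw [hq]; field_simp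
  have hql : |q * l| ≤ 1 / 4 := by
    rw [abs_mul, abs_of_pos hq0]; nlinarith [mul_pos hq0 hμ0]
  have hqm : q * μ ≤ 1 / 4 := by nlinarith [mul_nonneg hq0.le (abs_nonneg l)]
  have hqq : q ≤ 1 / 4 := by nlinarith [mul_nonneg hq0.le (abs_nonneg l), mul_pos hq0 hμ0]
  have := abs_le.1 hql
  have hqm0 := mul_pos hq0 hμ0
  refine ⟨refMap a b c (1 / 2) q, ⟨mem_tri_iff.2 ⟨1 / 2, q, by norm_num, hq0.le, by linarith, rfl⟩,
    mem_tri_iff.2 ⟨1 / 2 + q * l, q * μ, by linarith, hqm0.le, ?_, ?_⟩⟩, ?_⟩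
  · have h4 : q * l ≤ |q * l| := le_abs_self _
    rw [abs_mul, abs_of_pos hq0] at h4
    nlinarith
  · rw [refMap, refMap, hdec]
    module
  · have : det2 (b - a) (refMap a b c (1 / 2) q - a) = q * C := by
      simp only [hC, refMap, det2, PiLp.sub_apply, PiLp.add_apply, PiLp.smul_apply, smul_eq_mul]
      ring
    rw [this]
    exact mul_ne_zero hq0.ne' hc

lemma det2_eq_zero_of_mem_segment {a b x : Plane} (hx : x ∈ segment ℝ a b) :
    det2 (b - a) (x - a) = 0 := by
  rw [segment_eq_image'] at hx
  obtain ⟨r, -, rfl⟩ := hx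
  simp only [det2, PiLp.sub_apply, PiLp.add_apply, PiLp.smul_apply, smul_eq_mul]
  ring

/-- Were `c` and `d` different, conformity would confine the intersection of the triangles to the
common edge, contrary to the point off the line `a b` found above. -/
lemma eq_of_same_side {a b c d : Plane} (hs : {a, b, c} ∈ triangles T)
    (ht : {a, b, d} ∈ triangles T)
    (h : 0 < det2 (b - a) (c - a) * det2 (b - a) (d - a)) : c = d := by
  by_contra hcd
  obtain ⟨x, ⟨hx1, hx2⟩, hx⟩ := exists_mem_tri_inter h
  refine hx (det2_eq_zero_of_mem_segment ?_)
  rw [← cell_insert] at hx1 hx2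
  have hx3 : x ∈ cell ({a, b, c} ∩ {a, b, d}) := by
    rw [← cell_inter_cell hs ht]; exact ⟨hx1, hx2⟩
  rw [← cell_pair]
  refine convexHull_mono ?_ hx3
  have hc := left_ne_zero_of_mul h.ne'
  have hca : c ≠ a := by rintro rfl; simp [det2] at hc
  have hcb : c ≠ b := by
    rintro rfl
    exact hc (by simp only [det2]; ring)
  intro y hy
  simp only [Finset.coe_inter, Finset.coe_insert, Finset.coe_singleton, mem_inter_iff,
    mem_insert_iff, mem_singleton_iff] at hy ⊢
  rcases hy with ⟨rfl | rfl | rfl, h2⟩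
  · simp
  · simp
  · tauto

/-- Each side of the line through the edge accommodates at most one triangle; among three, two would
share a side. -/
lemma IsTriangulation.ncard_adjacent_le (hT : IsTriangulation Ω T) (he : e ∈ edges T) :
    (adjacent T e).ncard ≤ 2 := by
  obtain ⟨a, b, hab, rfl⟩ := Finset.card_eq_two.1 he.2
  have hv : ∀ s ∈ adjacent T {a, b}, ∃ c, s = {a, b, c} ∧ det2 (b - a) (c - a) ≠ 0 := by
    intro s hs
    obtain ⟨a', b', c, -, hc, hab', rfl, hD⟩ := isTriEdge_of_mem_adjacent he hs
    have hset : ({a', b'} : Set Plane) = {a, b} := by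
      have := congrArg (fun u : Finset Plane => (u : Set Plane)) hab'
      simpa using this.symm
    refine ⟨c, ?_, ?_⟩
    · have : ({a', b', c} : Finset Plane) = {a', b'} ∪ {c} := by ext; simp
      rw [this, ← hab']; ext; simp
    · rcases Set.pair_eq_pair_iff.1 hset with ⟨rfl, rfl⟩ | ⟨rfl, rfl⟩
      · exact hD
      · rw [det2] at hD ⊢
        intro h
        apply hD
        simp only [PiLp.sub_apply] at h ⊢
        linarith
  by_contra! h
  rw [ncard_eq_toFinset_card _ (hT.finite_adjacent _), Finset.two_lt_card] at h
  obtain ⟨s₁, h₁, s₂, h₂, s₃, h₃, h12, h13, h23⟩ := h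
  rw [Finite.mem_toFinset] at h₁ h₂ h₃
  obtain ⟨c₁, rfl, d₁⟩ := hv _ h₁
  obtain ⟨c₂, rfl, d₂⟩ := hv _ h₂
  obtain ⟨c₃, rfl, d₃⟩ := hv _ h₃
  have key : ∀ {c d}, ({a, b, c} : Finset Plane) ∈ adjacent T {a, b} →
      ({a, b, d} : Finset Plane) ∈ adjacent T {a, b} →
      ({a, b, c} : Finset Plane) ≠ {a, b, d} →
      det2 (b - a) (c - a) * det2 (b - a) (d - a) ≤ 0 := by
    intro c d hc hd hne
    by_contra! hpos
    exact hne (by rw [eq_of_same_side hc.1 hd.1 hpos])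
  have k12 := key h₁ h₂ h12
  have k13 := key h₁ h₃ h13
  have k23 := key h₂ h₃ h23
  rcases lt_or_gt_of_ne d₁ with p₁ | p₁ <;> rcases lt_or_gt_of_ne d₂ with p₂ | p₂ <;>
    rcases lt_or_gt_of_ne d₃ with p₃ | p₃ <;>
    first
      | exact absurd (mul_pos_of_neg_of_neg p₁ p₂) k12.not_gt
      | exact absurd (mul_pos_of_neg_of_neg p₁ p₃) k13.not_gt
      | exact absurd (mul_pos_of_neg_of_neg p₂ p₃) k23.not_gt
      | exact absurd (mul_pos p₁ p₂) k12.not_gt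
      | exact absurd (mul_pos p₁ p₃) k13.not_gt
      | exact absurd (mul_pos p₂ p₃) k23.not_gt

/-! ### The Lagrange interpolant -/

/-- The six nodes are written uniformly as midpoints of pairs of vertices, with `p = q` giving the
vertices themselves. -/
lemma exists_quad_interpolation (hs : s ∈ triangles T) (φ : Plane → ℝ) :
    ∃ c, ∀ p ∈ s, ∀ q ∈ s, quad c ((1 / 2 : ℝ) • (p + q)) = φ ((1 / 2 : ℝ) • (p + q)) := by
  obtain ⟨a, b, c, rfl, hD⟩ := exists_vertices_of_mem_triangles hs
  obtain ⟨d, ha, hb, hc, hab, hbc, hac⟩ := exists_quad_interpolation_tri hD φ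
  have hself : ∀ x : Plane, (1 / 2 : ℝ) • (x + x) = x := fun x => by module
  refine ⟨d, fun p hp q hq => ?_⟩
  simp only [Finset.mem_insert, Finset.mem_singleton] at hp hq
  rcases hp with rfl | rfl | rfl <;> rcases hq with rfl | rfl | rfl <;>
    first | (rw [hself]; assumption) | assumption | (rw [add_comm]; assumption)

/-- By conformity the common points lie on a common vertex or edge, where the shared nodal values
determine a quadratic. This makes the interpolant well defined and continuous. -/
lemma quad_eq_of_agree (hs : s ∈ triangles T) (ht : t ∈ triangles T) {φ : Plane → ℝ}
    {c d : Fin 6 → ℝ}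
    (hc : ∀ p ∈ s, ∀ q ∈ s, quad c ((1 / 2 : ℝ) • (p + q)) = φ ((1 / 2 : ℝ) • (p + q)))
    (hd : ∀ p ∈ t, ∀ q ∈ t, quad d ((1 / 2 : ℝ) • (p + q)) = φ ((1 / 2 : ℝ) • (p + q)))
    (hst : s ≠ t) {x : Plane} (hxs : x ∈ cell s) (hxt : x ∈ cell t) : quad c x = quad d x := by
  have hx : x ∈ cell (s ∩ t) := by rw [← cell_inter_cell hs ht]; exact ⟨hxs, hxt⟩
  have hpq : ∃ p q, s ∩ t = {p, q} := by
    have hne : (s ∩ t).Nonempty := by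
      rw [← Finset.coe_nonempty, ← convexHull_nonempty_iff (𝕜 := ℝ)]
      exact ⟨x, hx⟩
    have h1 := hne.card_pos
    have h2 := card_inter_le_two hs ht hst
    interval_cases h : (s ∩ t).card
    · obtain ⟨p, hp⟩ := Finset.card_eq_one.1 h
      exact ⟨p, p, by simpa using hp⟩
    · obtain ⟨p, q, -, hp⟩ := Finset.card_eq_two.1 h
      exact ⟨p, q, hp⟩
  obtain ⟨p, q, hpq⟩ := hpq
  have hp : p ∈ s ∩ t := by simp [hpq]
  have hq : q ∈ s ∩ t := by simp [hpq]
  rw [Finset.mem_inter] at hp hq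
  rw [hpq, cell_pair, segment_eq_image'] at hx
  obtain ⟨r, -, rfl⟩ := hx
  have key : ∀ u ∈ s, ∀ v ∈ s, u ∈ t → v ∈ t →
      quad c ((1 / 2 : ℝ) • (u + v)) = quad d ((1 / 2 : ℝ) • (u + v)) :=
    fun u hu v hv hu' hv' => (hc u hu v hv).trans (hd u hu' v hv').symm
  have hself : ∀ x : Plane, (1 / 2 : ℝ) • (x + x) = x := fun x => by module
  have k1 := key p hp.1 p hp.1 hp.2 hp.2
  have k2 := key q hq.1 q hq.1 hq.2 hq.2
  have k3 := key p hp.1 q hq.1 hp.2 hq.2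
  rw [hself] at k1 k2
  have e := quad_edgeMap c p q r
  have e' := quad_edgeMap d p q r
  rw [edgeMap] at e e'
  change quad c (p + r • (q - p)) = quad d (p + r • (q - p))
  rw [e, e', k1, k2, k3]

/-- A function that is quadratic on every triangle is in `Z_h`, as soon as it is well defined. -/
lemma IsTriangulation.memZh_of_eqOn_quad (hT : IsTriangulation Ω T) (hΩ : IsPolygonalDomain Ω)
    {z : Plane → ℝ} {c : Finset Plane → Fin 6 → ℝ}
    (hz : ∀ s ∈ triangles T, EqOn z (quad (c s)) (cell s)) : MemZh Ω T z := by
  refine ⟨?_, fun s hs => ?_⟩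
  · have hf := hT.finite_triangles.to_subtype
    rw [hT.closure_eq hΩ, biUnion_eq_iUnion]
    refine (locallyFinite_of_finite _).continuousOn_iUnion
      (fun s => (isCompact_cell s.1).isClosed) fun s => ?_
    exact (contDiff_quad (c s)).continuous.continuousOn.congr (hz s s.2)
  · obtain ⟨p, hp, h⟩ := exists_totalDegree_le_of_quad (c s)
    exact ⟨p, hp, fun x hx => (hz s hs hx).trans (h x)⟩

lemma IsTriangulation.exists_interpolant (hT : IsTriangulation Ω T) (hΩ : IsPolygonalDomain Ω)
    (φ : Plane → ℝ) : ∃ z, MemZh Ω T z ∧ ∀ s ∈ triangles T, ∃ c, EqOn z (quad c) (cell s) ∧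
      ∀ p ∈ s, ∀ q ∈ s, quad c ((1 / 2 : ℝ) • (p + q)) = φ ((1 / 2 : ℝ) • (p + q)) := by
  classical
  have hc : ∀ s : Finset Plane, ∃ c : Fin 6 → ℝ, s ∈ triangles T → ∀ p ∈ s, ∀ q ∈ s,
      quad c ((1 / 2 : ℝ) • (p + q)) = φ ((1 / 2 : ℝ) • (p + q)) := by
    intro s
    by_cases hs : s ∈ triangles T
    · exact (exists_quad_interpolation hs φ).imp fun c h _ => h
    · exact ⟨0, fun h => absurd h hs⟩
  choose c hc using hc
  let z : Plane → ℝ := fun x =>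
    if h : ∃ s, s ∈ triangles T ∧ x ∈ cell s then quad (c h.choose) x else 0
  have hz : ∀ s ∈ triangles T, EqOn z (quad (c s)) (cell s) := by
    intro s hs x hx
    have h : ∃ s, s ∈ triangles T ∧ x ∈ cell s := ⟨s, hs, hx⟩
    simp only [z, dif_pos h]
    by_cases hst : h.choose = s
    · rw [hst]
    · exact quad_eq_of_agree h.choose_spec.1 hs (hc _ h.choose_spec.1) (hc s hs) hst
        h.choose_spec.2 hx
  exact ⟨z, hT.memZh_of_eqOn_quad hΩ hz, fun s hs => ⟨c s, hz s hs, hc s hs⟩⟩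

/-- The interpolation error on a triangle of a shape regular triangulation. -/
lemma ShapeRegular.interpolation_estimate {σ : ℝ} (h : ShapeRegular σ T) (hs : s ∈ triangles T)
    {φ : Plane → ℝ} (hφ : ContDiff ℝ ∞ φ) {c : Fin 6 → ℝ}
    (hc : ∀ p ∈ s, ∀ q ∈ s, quad c ((1 / 2 : ℝ) • (p + q)) = φ ((1 / 2 : ℝ) • (p + q))) :
    pS 2 (interior (cell s)) (φ - quad c) ≤
        1920 * (σ ^ 2) ^ 4 * size s ^ 2 * pS 3 (interior (cell s)) φ ∧
      pS 1 (interior (cell s)) (φ - quad c) ≤ 240 * (σ ^ 2) ^ 2 * (1920 * (σ ^ 2) ^ 4) *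
        size s ^ 4 * pS 3 (interior (cell s)) φ ∧
      pS 0 (interior (cell s)) (φ - quad c) ≤ (66 * (240 * (σ ^ 2) ^ 2) + 2) *
        (1920 * (σ ^ 2) ^ 4) * size s ^ 6 * pS 3 (interior (cell s)) φ := by
  have hκ := h.size_sq_le hs
  rw [← pS_three_sub_quad _ hφ c]
  obtain ⟨a, b, d, rfl, hD⟩ := exists_vertices_of_mem_triangles hs
  rw [cell_insert, volume_real_tri hD] at hκ
  rw [cell_insert]
  have hself : ∀ x : Plane, (1 / 2 : ℝ) • (x + x) = x := fun x => by module
  have hv : ∀ p ∈ ({a, b, d} : Finset Plane), ∀ q ∈ ({a, b, d} : Finset Plane),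
      (φ - quad c) ((1 / 2 : ℝ) • (p + q)) = 0 := fun p hp q hq =>
    sub_eq_zero.2 (hc p hp q hq).symm
  have hv' : ∀ p ∈ ({a, b, d} : Finset Plane), (φ - quad c) p = 0 := fun p hp => by
    have := hv p hp p hp
    rwa [hself] at this
  -- Since the determinant is twice the area, shape regularity gives `κ = σ²`.
  exact C0IP.interpolation_estimate hD (κ := σ ^ 2) (by linarith)
    (fun x hx y hy => norm_sub_le_size (by rwa [cell_insert]) (by rwa [cell_insert]))
    (hφ.sub (contDiff_quad c))
    ⟨hv' a (by simp), hv' b (by simp), hv' d (by simp), hv a (by simp) b (by simp),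
      hv b (by simp) d (by simp), hv a (by simp) d (by simp)⟩

end

/-! ### The interior penalty method in abstract form -/

lemma norm_add_sq_le_two_mul {X : Type*} [SeminormedAddCommGroup X] (x y : X) :
    ‖x + y‖ ^ 2 ≤ 2 * ‖x‖ ^ 2 + 2 * ‖y‖ ^ 2 := by
  have := pow_le_pow_left₀ (norm_nonneg _) (norm_add_le x y) 2
  nlinarith [sq_nonneg (‖x‖ - ‖y‖)]

lemma norm_sub_sq_le_two_mul {X : Type*} [SeminormedAddCommGroup X] (x y : X) :
    ‖x - y‖ ^ 2 ≤ 2 * ‖x‖ ^ 2 + 2 * ‖y‖ ^ 2 := by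
  simpa [sub_eq_add_neg] using norm_add_sq_le_two_mul x (-y)

section

open scoped RealInnerProductSpace

variable {V E F G : Type*} [AddCommGroup V] [Module ℝ V]
  [NormedAddCommGroup E] [InnerProductSpace ℝ E] [NormedAddCommGroup F] [InnerProductSpace ℝ F]
  [NormedAddCommGroup G] [InnerProductSpace ℝ G]
  (H : V →ₗ[ℝ] E) (A J : V →ₗ[ℝ] F) (M : V →ₗ[ℝ] G) (α κ : ℝ)

/-- The abstract interior penalty form, with a multiple of a mass term. -/
def ipForm : V →ₗ[ℝ] V →ₗ[ℝ] ℝ :=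
  LinearMap.mk₂ ℝ (fun w v => ⟪H w, H v⟫ + ⟪A w, J v⟫ + ⟪A v, J w⟫ + α * ⟪J w, J v⟫ +
      κ * ⟪M w, M v⟫)
    (fun w w' v => by simp only [map_add, inner_add_left, inner_add_right]; ring)
    (fun r w v => by
      simp only [map_smul, real_inner_smul_left, real_inner_smul_right, smul_eq_mul]; ring)
    (fun w v v' => by simp only [map_add, inner_add_left, inner_add_right]; ring)
    (fun r w v => by
      simp only [map_smul, real_inner_smul_left, real_inner_smul_right, smul_eq_mul]; ring)

lemma ipForm_apply (w v : V) : ipForm H A J M α κ w v = ⟪H w, H v⟫ + ⟪A w, J v⟫ + ⟪A v, J w⟫ +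
    α * ⟪J w, J v⟫ + κ * ⟪M w, M v⟫ := rfl

/-- The square of the norm in which the approximation error is measured. -/
def errSq (w : V) : ℝ := ‖H w‖ ^ 2 + ‖A w‖ ^ 2 + α * ‖J w‖ ^ 2 + κ * ‖M w‖ ^ 2

variable {H A J M α κ} {c : ℝ}

lemma errSq_add_le (hα : 0 ≤ α) (hκ : 0 ≤ κ) (w v : V) :
    errSq H A J M α κ (w + v) ≤ 2 * errSq H A J M α κ w + 2 * errSq H A J M α κ v := by
  simp only [errSq, map_add]
  have h1 := norm_add_sq_le_two_mul (H w) (H v)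
  have h2 := norm_add_sq_le_two_mul (A w) (A v)
  have h3 := mul_le_mul_of_nonneg_left (norm_add_sq_le_two_mul (J w) (J v)) hα
  have h4 := mul_le_mul_of_nonneg_left (norm_add_sq_le_two_mul (M w) (M v)) hκ
  linarith

/-- The mixed term `2⟪Aξ,Jξ⟫` is at most `(‖Hξ‖² + α‖Jξ‖²)/2` by Young's inequality, because `4‖Aξ‖²
≤ α‖Hξ‖²`; the penalty thus pays for it. -/
lemma ipForm_coercive (hα : 1 ≤ α) (hc : 4 * c ≤ α) {ξ : V} (hA : ‖A ξ‖ ^ 2 ≤ c * ‖H ξ‖ ^ 2) :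
    (‖H ξ‖ ^ 2 + α * ‖J ξ‖ ^ 2) / 2 + κ * ‖M ξ‖ ^ 2 ≤ ipForm H A J M α κ ξ ξ := by
  rw [ipForm_apply]
  simp only [real_inner_self_eq_norm_sq]
  have h1 := neg_le_of_abs_le (abs_real_inner_le_norm (A ξ) (J ξ))
  have h2 : α * (2 * (‖A ξ‖ * ‖J ξ‖)) ≤ α * (‖H ξ‖ ^ 2 / 2 + α * ‖J ξ‖ ^ 2 / 2) := by
    have h3 : 4 * ‖A ξ‖ ^ 2 ≤ α * ‖H ξ‖ ^ 2 := by
      nlinarith [mul_le_mul_of_nonneg_right hc (sq_nonneg ‖H ξ‖)]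
    nlinarith [sq_nonneg (2 * ‖A ξ‖ - α * ‖J ξ‖)]
  have h3 := le_of_mul_le_mul_left h2 (by linarith)
  linarith

/-- Continuity in a form ready for absorption: `η` is arbitrary, so its averages must appear in
`errSq`, whereas `Aξ` is bounded by `Hξ`. The coefficient of `‖Mξ‖²` matches the one in
`ipForm_coercive` and cancels against it. -/
lemma ipForm_le (hα : 1 ≤ α) (hκ : 0 ≤ κ) (hc : 4 * c ≤ α) (η : V) {ξ : V}
    (hA : ‖A ξ‖ ^ 2 ≤ c * ‖H ξ‖ ^ 2) :
    ipForm H A J M α κ η ξ ≤ (‖H ξ‖ ^ 2 + α * ‖J ξ‖ ^ 2) / 8 + κ * ‖M ξ‖ ^ 2 +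
      5 * errSq H A J M α κ η := by
  rw [ipForm_apply, errSq]
  have h1 := real_inner_le_norm (H η) (H ξ)
  have h2 := real_inner_le_norm (A η) (J ξ)
  have h3 := real_inner_le_norm (A ξ) (J η)
  have h4 := mul_le_mul_of_nonneg_left (real_inner_le_norm (J η) (J ξ)) (zero_le_one.trans hα)
  have h5 := mul_le_mul_of_nonneg_left (real_inner_le_norm (M η) (M ξ)) hκ
  have y1 : ‖H η‖ * ‖H ξ‖ ≤ ‖H ξ‖ ^ 2 / 16 + 4 * ‖H η‖ ^ 2 := by
    nlinarith [sq_nonneg (‖H ξ‖ - 8 * ‖H η‖)]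
  have y2 : ‖A η‖ * ‖J ξ‖ ≤ α * ‖J ξ‖ ^ 2 / 16 + 4 * ‖A η‖ ^ 2 := by
    nlinarith [sq_nonneg (‖J ξ‖ - 8 * ‖A η‖), mul_le_mul_of_nonneg_right hα (sq_nonneg ‖J ξ‖)]
  have y3 : ‖A ξ‖ * ‖J η‖ ≤ ‖H ξ‖ ^ 2 / 16 + α * ‖J η‖ ^ 2 := by
    have h3 : 4 * ‖A ξ‖ ^ 2 ≤ α * ‖H ξ‖ ^ 2 := by
      nlinarith [mul_le_mul_of_nonneg_right hc (sq_nonneg ‖H ξ‖)]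
    have : α * (‖A ξ‖ * ‖J η‖) ≤ α * (‖H ξ‖ ^ 2 / 16 + α * ‖J η‖ ^ 2) := by
      nlinarith [sq_nonneg (‖A ξ‖ - 2 * α * ‖J η‖)]
    exact le_of_mul_le_mul_left this (by linarith)
  have y4 : α * (‖J η‖ * ‖J ξ‖) ≤ α * (‖J ξ‖ ^ 2 / 16 + 4 * ‖J η‖ ^ 2) :=
    mul_le_mul_of_nonneg_left (by nlinarith [sq_nonneg (‖J ξ‖ - 8 * ‖J η‖)]) (by linarith)
  have y5 : κ * (‖M η‖ * ‖M ξ‖) ≤ κ * (‖M ξ‖ ^ 2 + ‖M η‖ ^ 2) :=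
    mul_le_mul_of_nonneg_left (by nlinarith [sq_nonneg (‖M ξ‖ - ‖M η‖)]) hκ
  have p1 := mul_nonneg hκ (sq_nonneg ‖M η‖)
  have p2 := sq_nonneg ‖H η‖
  have p3 := sq_nonneg ‖A η‖
  linarith

/-- Quasi-optimality of the Galerkin projection. -/
lemma norm_sub_le_errSq (hα : 1 ≤ α) (hκ : 0 ≤ κ) (hc : 4 * c ≤ α) {Z : Submodule ℝ V}
    (hA : ∀ ξ ∈ Z, ‖A ξ‖ ^ 2 ≤ c * ‖H ξ‖ ^ 2) {u p z : V} (hp : p ∈ Z) (hz : z ∈ Z)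
    (horth : ∀ ξ ∈ Z, ipForm H A J M α κ (p - u) ξ = 0) :
    ‖H (u - p)‖ ^ 2 + α * ‖J (u - p)‖ ^ 2 ≤ 30 * errSq H A J M α κ (u - z) := by
  have hξ : p - z ∈ Z := Z.sub_mem hp hz
  have h1 := ipForm_coercive (J := J) (M := M) (κ := κ) hα hc (hA _ hξ)
  have h2 := ipForm_le (J := J) (M := M) hα hκ hc (u - z) (hA _ hξ)
  have h3 : ipForm H A J M α κ (p - z) (p - z) = ipForm H A J M α κ (u - z) (p - z) := by
    rw [← sub_eq_zero, ← LinearMap.sub_apply, ← map_sub, sub_sub_sub_cancel_right]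
    exact horth _ hξ
  have i1 := norm_sub_sq_le_two_mul (H (u - z)) (H (p - z))
  have i2 := mul_le_mul_of_nonneg_left (norm_sub_sq_le_two_mul (J (u - z)) (J (p - z)))
    (zero_le_one.trans hα)
  rw [← map_sub, sub_sub_sub_cancel_right] at i1 i2
  rw [h3] at h1
  have hE : ‖H (u - z)‖ ^ 2 + α * ‖J (u - z)‖ ^ 2 ≤ errSq H A J M α κ (u - z) := by
    have := mul_nonneg hκ (sq_nonneg ‖M (u - z)‖)
    have := sq_nonneg ‖A (u - z)‖
    rw [errSq]
    linarith
  -- Coercivity minus continuity leaves `1/2 - 1/8 = 3/8` on the left and `5` on the right. Adding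
  -- `u - z` by the triangle inequality gives `2 + 80/3 ≤ 30`.
  have h4 : 3 * (‖H (p - z)‖ ^ 2 + α * ‖J (p - z)‖ ^ 2) ≤ 40 * errSq H A J M α κ (u - z) := by
    linarith
  have h5 : 0 ≤ errSq H A J M α κ (u - z) := by
    have := mul_nonneg (zero_le_one.trans hα) (sq_nonneg ‖J (u - z)‖)
    have := sq_nonneg ‖H (u - z)‖
    linarith
  linarith

lemma eq_zero_of_ipForm_self (hα : 1 ≤ α) (hκ : 0 < κ) (hc : 4 * c ≤ α) {ξ : V}
    (hA : ‖A ξ‖ ^ 2 ≤ c * ‖H ξ‖ ^ 2) (h : ipForm H A J M α κ ξ ξ = 0) : M ξ = 0 := by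
  have h1 := ipForm_coercive (J := J) (M := M) (κ := κ) hα hc hA
  rw [h] at h1
  have h2 : κ * ‖M ξ‖ ^ 2 ≤ 0 := by
    have := mul_nonneg (zero_le_one.trans hα) (sq_nonneg ‖J ξ‖)
    have := sq_nonneg ‖H ξ‖
    linarith
  have h3 : ‖M ξ‖ ^ 2 = 0 := le_antisymm (nonpos_of_mul_nonpos_right h2 hκ) (sq_nonneg _)
  exact norm_eq_zero.1 (pow_eq_zero_iff two_ne_zero |>.1 h3)

/-- Definiteness makes the map from `Z` to its dual injective, hence surjective in finite dimension.
-/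
lemma exists_galerkin (hα : 1 ≤ α) (hκ : 0 < κ) (hc : 4 * c ≤ α) (Z : Submodule ℝ V)
    [FiniteDimensional ℝ Z] (hA : ∀ ξ ∈ Z, ‖A ξ‖ ^ 2 ≤ c * ‖H ξ‖ ^ 2)
    (hM : ∀ ξ ∈ Z, M ξ = 0 → ξ = 0) (u : V) :
    ∃ p ∈ Z, ∀ ξ ∈ Z, ipForm H A J M α κ (p - u) ξ = 0 := by
  let B : Z →ₗ[ℝ] Module.Dual ℝ Z := (ipForm H A J M α κ).domRestrict₁₂ Z Z
  have hinj : Function.Injective B := by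
    rw [← LinearMap.ker_eq_bot, LinearMap.ker_eq_bot']
    intro ξ hξ
    have h0 : ipForm H A J M α κ ξ ξ = 0 := LinearMap.congr_fun hξ ξ
    exact Subtype.ext (hM _ ξ.2 (eq_zero_of_ipForm_self hα hκ hc (hA _ ξ.2) h0))
  have hsurj : Function.Surjective B :=
    (LinearMap.injective_iff_surjective_of_finrank_eq_finrank
      (Subspace.dual_finrank_eq (K := ℝ) (V := Z)).symm).1 hinj
  obtain ⟨p, hp⟩ := hsurj ((ipForm H A J M α κ u).domRestrict Z)
  refine ⟨p, p.2, fun ξ hξ => ?_⟩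
  have := LinearMap.congr_fun hp ⟨ξ, hξ⟩
  rw [map_sub, LinearMap.sub_apply, sub_eq_zero]
  exact this

end

/-! ### Operators that are linear up to null sets -/

/-- `L` maps `V` to `L²(μ)` and is linear up to null sets. -/
structure AELinear (V : Submodule ℝ (Plane → ℝ)) (μ : Measure Plane)
    (L : (Plane → ℝ) → Plane → ℝ) : Prop where
  memLp : ∀ w ∈ V, MemLp (L w) 2 μ
  add : ∀ w ∈ V, ∀ v ∈ V, L (w + v) =ᵐ[μ] L w + L v
  smul : ∀ (c : ℝ), ∀ w ∈ V, L (c • w) =ᵐ[μ] c • L w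

namespace AELinear

variable {V : Submodule ℝ (Plane → ℝ)} {μ : Measure Plane} {L L' : (Plane → ℝ) → Plane → ℝ}

lemma const_smul (h : AELinear V μ L) (r : ℝ) : AELinear V μ fun w => r • L w where
  memLp w hw := (h.memLp w hw).const_smul r
  add w hw v hv := by
    filter_upwards [h.add w hw v hv] with x hx
    simp only [Pi.smul_apply, Pi.add_apply, smul_eq_mul] at hx ⊢
    rw [hx]; ring
  smul c w hw := by
    filter_upwards [h.smul c w hw] with x hx
    simp only [Pi.smul_apply, smul_eq_mul] at hx ⊢
    rw [hx]; ring

lemma zero : AELinear V μ fun _ => 0 where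
  memLp w hw := MemLp.zero'
  add w hw v hv := by simp
  smul c w hw := by simp

lemma add' (h : AELinear V μ L) (h' : AELinear V μ L') : AELinear V μ fun w => L w + L' w where
  memLp w hw := (h.memLp w hw).add (h'.memLp w hw)
  add w hw v hv := by
    filter_upwards [h.add w hw v hv, h'.add w hw v hv] with x hx hx'
    simp only [Pi.add_apply] at hx hx' ⊢
    rw [hx, hx']; ring
  smul c w hw := by
    filter_upwards [h.smul c w hw, h'.smul c w hw] with x hx hx'
    simp only [Pi.smul_apply, Pi.add_apply, smul_eq_mul] at hx hx' ⊢
    rw [hx, hx']; ring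

lemma sum {ι : Type*} (S : Finset ι) {L : ι → (Plane → ℝ) → Plane → ℝ}
    (h : ∀ i ∈ S, AELinear V μ (L i)) : AELinear V μ fun w => ∑ i ∈ S, L i w := by
  classical
  induction S using Finset.induction_on with
  | empty => simpa using zero
  | insert a S ha ih =>
    simp only [Finset.sum_insert ha]
    exact (h a (by simp)).add' (ih fun i hi => h i (by simp [hi]))

/-- The induced linear map to `L²(μ)`. -/
def toLp (h : AELinear V μ L) : V →ₗ[ℝ] Lp ℝ 2 μ where
  toFun w := (h.memLp w w.2).toLp (L w)
  map_add' w v := by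
    rw [← MemLp.toLp_add, MemLp.toLp_eq_toLp_iff]
    exact h.add w w.2 v v.2
  map_smul' c w := by
    rw [RingHom.id_apply, ← MemLp.toLp_const_smul, MemLp.toLp_eq_toLp_iff]
    exact h.smul c w w.2

lemma inner_toLp (h : AELinear V μ L) (h' : AELinear V μ L') (w v : V) :
    inner ℝ (h.toLp w) (h'.toLp v) = ∫ x, L w x * L' v x ∂μ := by
  rw [L2.inner_def]
  refine integral_congr_ae ?_
  filter_upwards [(h.memLp w w.2).coeFn_toLp, (h'.memLp v v.2).coeFn_toLp] with x hx hx'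
  change inner ℝ (((h.memLp w w.2).toLp (L w) : Lp ℝ 2 μ) x)
    (((h'.memLp v v.2).toLp (L' v) : Lp ℝ 2 μ) x) = _
  rw [hx, hx', real_inner_eq_re_inner]
  simp [mul_comm]

lemma integrable_mul (h : AELinear V μ L) (h' : AELinear V μ L') (w v : V) :
    Integrable (fun x => L w x * L' v x) μ :=
  (h.memLp w w.2).integrable_mul (h'.memLp v v.2)

end AELinear

/-- The linear map to an `ℓ²` sum of `L²` spaces induced by a weighted family of operators. -/
def piLpMap {ι : Type*} [Fintype ι] {V : Submodule ℝ (Plane → ℝ)} {μ : ι → Measure Plane}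
    {L : ι → (Plane → ℝ) → Plane → ℝ} (h : ∀ i, AELinear V (μ i) (L i)) (r : ι → ℝ) :
    V →ₗ[ℝ] PiLp 2 fun i => Lp ℝ 2 (μ i) :=
  (WithLp.linearEquiv 2 ℝ (∀ i, Lp ℝ 2 (μ i))).symm.toLinearMap ∘ₗ
    LinearMap.pi fun i => r i • (h i).toLp

lemma inner_piLpMap {ι : Type*} [Fintype ι] {V : Submodule ℝ (Plane → ℝ)}
    {μ : ι → Measure Plane} {L L' : ι → (Plane → ℝ) → Plane → ℝ}
    (h : ∀ i, AELinear V (μ i) (L i)) (h' : ∀ i, AELinear V (μ i) (L' i)) (r r' : ι → ℝ) (w v : V) :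
    inner ℝ (piLpMap h r w) (piLpMap h' r' v) =
      ∑ i, r i * r' i * ∫ x, L i w x * L' i v x ∂(μ i) := by
  rw [PiLp.inner_apply]
  refine Finset.sum_congr rfl fun i _ => ?_
  change inner ℝ (r i • (h i).toLp w) (r' i • (h' i).toLp v) = _
  rw [real_inner_smul_left, real_inner_smul_right, AELinear.inner_toLp, mul_assoc]

/-! ### Broken Sobolev spaces -/

/-- Square integrable functions on `Ω` that are of class `H³` on every triangle of `T`. -/
def brokenH3 (Ω : Set Plane) (T : Geometry.SimplicialComplex ℝ Plane) :
    Submodule ℝ (Plane → ℝ) where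
  carrier := {w | MemLp w 2 (volume.restrict Ω) ∧
    ∀ s ∈ triangles T, Approx 3 (interior (cell s)) w}
  add_mem' h h' := ⟨h.1.add h'.1, fun s hs => (h.2 s hs).add (h'.2 s hs)⟩
  zero_mem' := ⟨MemLp.zero', fun s _ =>
    Approx.of_contDiff (isBounded_interior_cell s) contDiff_const 3⟩
  smul_mem' c _ h := ⟨h.1.const_smul c, fun s hs => (h.2 s hs).smul c⟩

section

variable {Ω : Set Plane} {T : Geometry.SimplicialComplex ℝ Plane} {s e : Finset Plane}

lemma aeLinear_mass : AELinear (brokenH3 Ω T) (volume.restrict Ω) fun w => w where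
  memLp _ hw := hw.1
  add _ _ _ _ := ae_eq_rfl
  smul _ _ _ := ae_eq_rfl

lemma Approx.hess {w : Plane → ℝ} {k : ℕ} (h : Approx (k + 2) (interior (cell s)) w)
    (i j : Fin 2) : Approx k (interior (cell s)) (hess (interior (cell s)) i j w) :=
  (h.wD isOpen_interior i).wD isOpen_interior j

lemma Approx.hess_add {w v : Plane → ℝ} {k : ℕ} (h : Approx (k + 2) (interior (cell s)) w)
    (h' : Approx (k + 2) (interior (cell s)) v) (i j : Fin 2) :
    C0IP.hess (interior (cell s)) i j (w + v) =ᵐ[volume.restrict (interior (cell s))]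
      C0IP.hess (interior (cell s)) i j w + C0IP.hess (interior (cell s)) i j v :=
  (wD_congr isOpen_interior (h.wD_add isOpen_interior h' i)).trans
    ((h.wD isOpen_interior i).wD_add isOpen_interior (h'.wD isOpen_interior i) j)

lemma Approx.hess_smul {w : Plane → ℝ} {k : ℕ} (h : Approx (k + 2) (interior (cell s)) w)
    (c : ℝ) (i j : Fin 2) :
    C0IP.hess (interior (cell s)) i j (c • w) =ᵐ[volume.restrict (interior (cell s))]
      c • C0IP.hess (interior (cell s)) i j w :=
  (wD_congr isOpen_interior (h.wD_smul isOpen_interior c i)).trans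
    ((h.wD isOpen_interior i).wD_smul isOpen_interior c j)

lemma aeLinear_hess (hs : s ∈ triangles T) (i j : Fin 2) :
    AELinear (brokenH3 Ω T) (volume.restrict (interior (cell s)))
      (hess (interior (cell s)) i j) where
  memLp _ hw := ((hw.2 s hs).hess i j).memLp
  add _ hw _ hv := (hw.2 s hs).hess_add (hv.2 s hs) i j
  smul c _ hw := (hw.2 s hs).hess_smul c i j

lemma aeLinear_trace_wD (hs : s ∈ triangles T) (he : IsTriEdge s e) (i : Fin 2) :
    AELinear (brokenH3 Ω T) (edgeMeasure e)
      fun w => trace s e (wD (interior (cell s)) i w) where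
  memLp _ hw := ((hw.2 s hs).of_succ.wD isOpen_interior i).memLp_trace he
  add w hw v hv := by
    have h := (hw.2 s hs).of_succ
    have h' := (hv.2 s hs).of_succ
    exact (((h.add h').wD isOpen_interior i).trace_congr he
      (h.wD_add isOpen_interior h' i)).trans
      ((h.wD isOpen_interior i).trace_add he (h'.wD isOpen_interior i))
  smul c w hw := by
    have h := (hw.2 s hs).of_succ
    exact (((h.smul c).wD isOpen_interior i).trace_congr he
      (h.wD_smul isOpen_interior c i)).trans ((h.wD isOpen_interior i).trace_smul he c)

lemma aeLinear_trace_hess (hs : s ∈ triangles T) (he : IsTriEdge s e) (i j : Fin 2) :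
    AELinear (brokenH3 Ω T) (edgeMeasure e)
      fun w => trace s e (hess (interior (cell s)) i j w) where
  memLp _ hw := ((hw.2 s hs).hess (k := 1) i j).memLp_trace he
  add w hw v hv := by
    have h := hw.2 s hs
    have h' := hv.2 s hs
    exact (((h.add h').hess (k := 1) i j).trace_congr he (h.hess_add h' i j)).trans
      ((h.hess (k := 1) i j).trace_add he (h'.hess i j))
  smul c w hw := by
    have h := hw.2 s hs
    exact (((h.smul c).hess (k := 1) i j).trace_congr he (h.hess_smul c i j)).trans
      ((h.hess (k := 1) i j).trace_smul he c)

lemma aeLinear_dn (hs : s ∈ triangles T) (he : IsTriEdge s e) :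
    AELinear (brokenH3 Ω T) (edgeMeasure e) (dn s e) := by
  have : dn s e = fun w => ∑ i, normal s e i • trace s e (wD (interior (cell s)) i w) := by
    ext w x; simp [dn]
  rw [this]
  exact AELinear.sum _ fun i _ => (aeLinear_trace_wD hs he i).const_smul _

lemma aeLinear_d2n (hs : s ∈ triangles T) (he : IsTriEdge s e) :
    AELinear (brokenH3 Ω T) (edgeMeasure e) (d2n s e) := by
  have : d2n s e = fun w => ∑ i, ∑ j, (normal s e i * normal s e j) •
      trace s e (hess (interior (cell s)) i j w) := by
    ext w x; simp [d2n]
  rw [this]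
  exact AELinear.sum _ fun i _ => AELinear.sum _ fun j _ =>
    (aeLinear_trace_hess hs he i j).const_smul _

lemma IsTriangulation.jump_eq (hT : IsTriangulation Ω T) (e : Finset Plane) (w : Plane → ℝ)
    (x : Plane) : jump T e w x = -∑ s ∈ (hT.finite_adjacent e).toFinset, dn s e w x := by
  rw [jump, finsum_mem_eq_finite_toFinset_sum _ (hT.finite_adjacent e)]

lemma IsTriangulation.avg_eq (hT : IsTriangulation Ω T) (e : Finset Plane) (w : Plane → ℝ)
    (x : Plane) : avg T e w x = (∑ s ∈ (hT.finite_adjacent e).toFinset, d2n s e w x) /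
      ((hT.finite_adjacent e).toFinset.card : ℝ) := by
  rw [avg, finsum_mem_eq_finite_toFinset_sum _ (hT.finite_adjacent e),
    ncard_eq_toFinset_card _ (hT.finite_adjacent e)]

lemma aeLinear_jump (hT : IsTriangulation Ω T) (he : e ∈ edges T) :
    AELinear (brokenH3 Ω T) (edgeMeasure e) (jump T e) := by
  have : jump T e = fun w => (-1 : ℝ) • ∑ s ∈ (hT.finite_adjacent e).toFinset, dn s e w := by
    ext w x; simp [hT.jump_eq]
  rw [this]
  refine AELinear.const_smul (AELinear.sum _ fun s hs => ?_) _
  rw [Finite.mem_toFinset] at hs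
  exact aeLinear_dn hs.1 (isTriEdge_of_mem_adjacent he hs)

lemma aeLinear_avg (hT : IsTriangulation Ω T) (he : e ∈ edges T) :
    AELinear (brokenH3 Ω T) (edgeMeasure e) (avg T e) := by
  have : avg T e = fun w => ((hT.finite_adjacent e).toFinset.card : ℝ)⁻¹ •
      ∑ s ∈ (hT.finite_adjacent e).toFinset, d2n s e w := by
    ext w x; simp [hT.avg_eq, div_eq_inv_mul]
  rw [this]
  refine AELinear.const_smul (AELinear.sum _ fun s hs => ?_) _
  rw [Finite.mem_toFinset] at hs
  exact aeLinear_d2n hs.1 (isTriEdge_of_mem_adjacent he hs)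

/-! ### The interior penalty form in terms of linear maps to Hilbert spaces -/

namespace IsTriangulation

variable (hT : IsTriangulation Ω T)

/-- The triangles of a triangulation as a finite set. -/
abbrev triFin : Finset (Finset Plane) := hT.finite_triangles.toFinset

/-- The edges of a triangulation as a finite set. -/
abbrev edgeFin : Finset (Finset Plane) := hT.finite_edges.toFinset

lemma mem_triangles (s : hT.triFin) : s.1 ∈ triangles T :=
  (Finite.mem_toFinset _).1 s.2

lemma mem_edges (e : hT.edgeFin) : e.1 ∈ edges T :=
  (Finite.mem_toFinset _).1 e.2

/-- The piecewise Hessian. -/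
def hessMap : brokenH3 Ω T →ₗ[ℝ] PiLp 2 fun i : hT.triFin × Fin 2 × Fin 2 =>
    Lp ℝ 2 (volume.restrict (interior (cell i.1.1))) :=
  piLpMap (fun i => aeLinear_hess (hT.mem_triangles i.1) i.2.1 i.2.2) fun _ => 1

/-- The weighted averages of second normal derivatives. -/
def avgMap : brokenH3 Ω T →ₗ[ℝ] PiLp 2 fun e : hT.edgeFin => Lp ℝ 2 (edgeMeasure e.1) :=
  piLpMap (fun e => aeLinear_avg hT (hT.mem_edges e)) fun e => Real.sqrt (size e.1)

/-- The weighted jumps of normal derivatives. -/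
def jumpMap : brokenH3 Ω T →ₗ[ℝ] PiLp 2 fun e : hT.edgeFin => Lp ℝ 2 (edgeMeasure e.1) :=
  piLpMap (fun e => aeLinear_jump hT (hT.mem_edges e)) fun e => (Real.sqrt (size e.1))⁻¹

/-- The inclusion into `L²(Ω)`. -/
def massMap (Ω : Set Plane) (T : Geometry.SimplicialComplex ℝ Plane) :
    brokenH3 Ω T →ₗ[ℝ] Lp ℝ 2 (volume.restrict Ω) :=
  aeLinear_mass.toLp

lemma inner_massMap (w v : brokenH3 Ω T) :
    inner ℝ (massMap Ω T w) (massMap Ω T v) = ∫ x in Ω, w.1 x * v.1 x :=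
  AELinear.inner_toLp _ _ w v

lemma inner_hessMap (w v : brokenH3 Ω T) :
    inner ℝ (hT.hessMap w) (hT.hessMap v) = ∑ s ∈ hT.triFin, hessInner s w v := by
  rw [hessMap, inner_piLpMap, Fintype.sum_prod_type, ← Finset.sum_coe_sort hT.triFin]
  refine Finset.sum_congr rfl fun s _ => ?_
  have hs := hT.mem_triangles s
  have hint : ∀ i j, Integrable (fun x => hess (interior (cell s.1)) i j w.1 x *
      hess (interior (cell s.1)) i j v.1 x) (volume.restrict (interior (cell s.1))) :=
    fun i j => (aeLinear_hess hs i j).integrable_mul (aeLinear_hess hs i j) w v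
  rw [hessInner, integral_finsetSum _ fun i _ => integrable_finsetSum _ fun j _ => hint i j,
    Fintype.sum_prod_type]
  refine Finset.sum_congr rfl fun i _ => ?_
  rw [integral_finsetSum _ fun j _ => hint i j]
  simp

/-- The weights of `avgMap` and `jumpMap` are reciprocal, so their inner product is the unweighted
consistency term of the form. -/
lemma sqrt_size_mul_inv (e : hT.edgeFin) (r : ℝ) :
    Real.sqrt (size e.1) * (Real.sqrt (size e.1))⁻¹ * r = r := by
  have he := (hT.mem_edges e).2
  obtain ⟨a, b, hab, h⟩ := Finset.card_eq_two.1 he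
  have : 0 < size e.1 := by
    rw [h, size_pair]
    exact norm_pos_iff.2 (sub_ne_zero.2 hab.symm)
  rw [mul_inv_cancel₀ (Real.sqrt_pos.2 this).ne', one_mul]

lemma inner_avgMap_jumpMap (w v : brokenH3 Ω T) :
    inner ℝ (hT.avgMap w) (hT.jumpMap v) =
      ∑ e ∈ hT.edgeFin, edgeInt e fun x => avg T e w x * jump T e v x := by
  rw [avgMap, jumpMap, inner_piLpMap, ← Finset.sum_coe_sort hT.edgeFin]
  exact Finset.sum_congr rfl fun e _ => hT.sqrt_size_mul_inv e _

lemma inner_jumpMap (w v : brokenH3 Ω T) :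
    inner ℝ (hT.jumpMap w) (hT.jumpMap v) =
      ∑ e ∈ hT.edgeFin, 1 / size e * edgeInt e fun x => jump T e w x * jump T e v x := by
  rw [jumpMap, inner_piLpMap, ← Finset.sum_coe_sort hT.edgeFin]
  refine Finset.sum_congr rfl fun e _ => ?_
  rw [← mul_inv, Real.mul_self_sqrt (size_nonneg _), one_div]
  rfl

lemma norm_sq_avgMap (w : brokenH3 Ω T) :
    ‖hT.avgMap w‖ ^ 2 = ∑ e ∈ hT.edgeFin, size e * ∫ x, avg T e w x ^ 2 ∂(edgeMeasure e) := by
  rw [← real_inner_self_eq_norm_sq, avgMap, inner_piLpMap, ← Finset.sum_coe_sort hT.edgeFin]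
  refine Finset.sum_congr rfl fun e _ => ?_
  rw [Real.mul_self_sqrt (size_nonneg _)]
  simp only [sq]

lemma norm_sq_jumpMap (w : brokenH3 Ω T) :
    ‖hT.jumpMap w‖ ^ 2 =
      ∑ e ∈ hT.edgeFin, 1 / size e * ∫ x, jump T e w x ^ 2 ∂(edgeMeasure e) := by
  rw [← real_inner_self_eq_norm_sq, inner_jumpMap]
  simp only [edgeInt, edgeMeasure, sq]

lemma norm_sq_hessMap (w : brokenH3 Ω T) :
    ‖hT.hessMap w‖ ^ 2 = ∑ s ∈ hT.triFin, nS 2 (interior (cell s)) w := by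
  rw [← real_inner_self_eq_norm_sq, hessMap, inner_piLpMap, Fintype.sum_prod_type,
    ← Finset.sum_coe_sort hT.triFin]
  refine Finset.sum_congr rfl fun s _ => ?_
  rw [Fintype.sum_prod_type]
  simp [nS, hess, sq]

lemma aIP_add_eq_ipForm (α κ : ℝ) (w v : brokenH3 Ω T) :
    aIP T α w v + κ * ∫ x in Ω, w.1 x * v.1 x =
      ipForm hT.hessMap hT.avgMap hT.jumpMap (massMap Ω T) α κ w v := by
  rw [ipForm_apply, aIP, inner_massMap, inner_hessMap, inner_avgMap_jumpMap,
    inner_avgMap_jumpMap, inner_jumpMap,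
    finsum_mem_eq_finite_toFinset_sum _ hT.finite_triangles,
    finsum_mem_eq_finite_toFinset_sum _ hT.finite_edges,
    finsum_mem_eq_finite_toFinset_sum _ hT.finite_edges,
    finsum_mem_eq_finite_toFinset_sum _ hT.finite_edges]

lemma norm2h_eq (α : ℝ) (w : brokenH3 Ω T) :
    norm2h T α w = Real.sqrt (‖hT.hessMap w‖ ^ 2 + α * ‖hT.jumpMap w‖ ^ 2) := by
  rw [norm2h, norm_sq_jumpMap, ← real_inner_self_eq_norm_sq, inner_hessMap,
    finsum_mem_eq_finite_toFinset_sum _ hT.finite_triangles,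
    finsum_mem_eq_finite_toFinset_sum _ hT.finite_edges, Finset.mul_sum]
  simp only [edgeInt, edgeMeasure, ← mul_assoc, mul_one_div]

end IsTriangulation

/-! ### Bounds for jumps and averages -/

lemma sum_mul_sq_le_of_sum_sq {n : Fin 2 → ℝ} (hn : n 0 ^ 2 + n 1 ^ 2 = 1) (f : Fin 2 → ℝ) :
    (∑ i, n i * f i) ^ 2 ≤ ∑ i, f i ^ 2 := by
  have := Finset.sum_mul_sq_le_sq_mul_sq Finset.univ n f
  rwa [Fin.sum_univ_two (fun i => n i ^ 2), hn, one_mul] at this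

lemma integral_dn_sq_le (hs : s ∈ triangles T) (he : IsTriEdge s e) {w : Plane → ℝ}
    (hw : w ∈ brokenH3 Ω T) :
    ∫ x, dn s e w x ^ 2 ∂(edgeMeasure e) ≤ traceConst s e *
      (3 * nS 1 (interior (cell s)) w + size s ^ 2 * nS 2 (interior (cell s)) w) := by
  have hi : ∀ i, Integrable (fun x => trace s e (wD (interior (cell s)) i w) x ^ 2)
      (edgeMeasure e) := fun i => ((aeLinear_trace_wD (Ω := Ω) hs he i).memLp w hw).integrable_sq
  calc ∫ x, dn s e w x ^ 2 ∂(edgeMeasure e)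
      ≤ ∫ x, ∑ i, trace s e (wD (interior (cell s)) i w) x ^ 2 ∂(edgeMeasure e) :=
        integral_mono (((aeLinear_dn (Ω := Ω) hs he).memLp w hw).integrable_sq)
          (integrable_finsetSum _ fun i _ => hi i)
          fun x => sum_mul_sq_le_of_sum_sq he.normal_sq _
    _ = ∑ i, ∫ x, trace s e (wD (interior (cell s)) i w) x ^ 2 ∂(edgeMeasure e) :=
        integral_finsetSum _ fun i _ => hi i
    _ ≤ ∑ i, traceConst s e * (3 * nS 0 (interior (cell s)) (wD (interior (cell s)) i w) +
          size s ^ 2 * nS 1 (interior (cell s)) (wD (interior (cell s)) i w)) :=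
        Finset.sum_le_sum fun i _ =>
          ((hw.2 s hs).of_succ.wD isOpen_interior i).trace_le he
    _ = _ := by
      rw [← Finset.mul_sum, Finset.sum_add_distrib, ← Finset.mul_sum, ← Finset.mul_sum]
      rfl

lemma integral_d2n_sq_le (hs : s ∈ triangles T) (he : IsTriEdge s e) {w : Plane → ℝ}
    (hw : w ∈ brokenH3 Ω T) :
    ∫ x, d2n s e w x ^ 2 ∂(edgeMeasure e) ≤ traceConst s e *
      (3 * nS 2 (interior (cell s)) w + size s ^ 2 * nS 3 (interior (cell s)) w) := by
  have hi : ∀ i j, Integrable (fun x => trace s e (hess (interior (cell s)) i j w) x ^ 2)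
      (edgeMeasure e) := fun i j =>
    ((aeLinear_trace_hess (Ω := Ω) hs he i j).memLp w hw).integrable_sq
  calc ∫ x, d2n s e w x ^ 2 ∂(edgeMeasure e)
      ≤ ∫ x, ∑ i, ∑ j, trace s e (hess (interior (cell s)) i j w) x ^ 2 ∂(edgeMeasure e) :=
        integral_mono (((aeLinear_d2n (Ω := Ω) hs he).memLp w hw).integrable_sq)
          (integrable_finsetSum _ fun i _ => integrable_finsetSum _ fun j _ => hi i j)
          fun x => by
            simp only [d2n, mul_assoc, ← Finset.mul_sum]
            exact (sum_mul_sq_le_of_sum_sq he.normal_sq _).trans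
              (Finset.sum_le_sum fun i _ => sum_mul_sq_le_of_sum_sq he.normal_sq _)
    _ = ∑ i, ∑ j, ∫ x, trace s e (hess (interior (cell s)) i j w) x ^ 2 ∂(edgeMeasure e) := by
        rw [integral_finsetSum _ fun i _ => integrable_finsetSum _ fun j _ => hi i j]
        exact Finset.sum_congr rfl fun i _ => integral_finsetSum _ fun j _ => hi i j
    _ ≤ ∑ i, ∑ j, traceConst s e *
          (3 * nS 0 (interior (cell s)) (hess (interior (cell s)) i j w) +
          size s ^ 2 * nS 1 (interior (cell s)) (hess (interior (cell s)) i j w)) :=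
        Finset.sum_le_sum fun i _ => Finset.sum_le_sum fun j _ =>
          ((hw.2 s hs).hess (k := 1) i j).trace_le he
    _ = _ := by
      simp only [← Finset.mul_sum, Finset.sum_add_distrib]
      rfl

namespace IsTriangulation

variable (hT : IsTriangulation Ω T)

/-- The factor `2` bounds the number of triangles at an edge, in the Cauchy–Schwarz inequality for
the sum. -/
lemma integral_jump_sq_le (he : e ∈ edges T) {w : Plane → ℝ} (hw : w ∈ brokenH3 Ω T) :
    ∫ x, jump T e w x ^ 2 ∂(edgeMeasure e) ≤
      2 * ∑ s ∈ (hT.finite_adjacent e).toFinset, traceConst s e *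
        (3 * nS 1 (interior (cell s)) w + size s ^ 2 * nS 2 (interior (cell s)) w) := by
  set S := (hT.finite_adjacent e).toFinset with hS
  have hmem : ∀ s ∈ S, s ∈ adjacent T e := fun s hs => by simpa [hS] using hs
  have hi : ∀ s ∈ S, Integrable (fun x => dn s e w x ^ 2) (edgeMeasure e) := fun s hs =>
    ((aeLinear_dn (Ω := Ω) (hmem s hs).1
      (isTriEdge_of_mem_adjacent he (hmem s hs))).memLp w hw).integrable_sq
  have hcard : (S.card : ℝ) ≤ 2 := by
    have := hT.ncard_adjacent_le he
    rw [ncard_eq_toFinset_card _ (hT.finite_adjacent e)] at this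
    exact_mod_cast this
  calc ∫ x, jump T e w x ^ 2 ∂(edgeMeasure e)
      ≤ ∫ x, 2 * ∑ s ∈ S, dn s e w x ^ 2 ∂(edgeMeasure e) :=
        integral_mono (((aeLinear_jump hT he).memLp w hw).integrable_sq)
          ((integrable_finsetSum _ hi).const_mul 2) fun x => by
            simp only [hT.jump_eq, neg_sq]
            exact sq_sum_le_card_mul_sum_sq.trans
              (mul_le_mul_of_nonneg_right hcard (Finset.sum_nonneg fun s _ => sq_nonneg _))
    _ = 2 * ∑ s ∈ S, ∫ x, dn s e w x ^ 2 ∂(edgeMeasure e) := by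
        rw [integral_const_mul, integral_finsetSum _ hi]
    _ ≤ _ := mul_le_mul_of_nonneg_left (Finset.sum_le_sum fun s hs =>
        integral_dn_sq_le (hmem s hs).1 (isTriEdge_of_mem_adjacent he (hmem s hs)) hw) zero_le_two

lemma integral_avg_sq_le (he : e ∈ edges T) {w : Plane → ℝ} (hw : w ∈ brokenH3 Ω T) :
    ∫ x, avg T e w x ^ 2 ∂(edgeMeasure e) ≤
      ∑ s ∈ (hT.finite_adjacent e).toFinset, traceConst s e *
        (3 * nS 2 (interior (cell s)) w + size s ^ 2 * nS 3 (interior (cell s)) w) := by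
  set S := (hT.finite_adjacent e).toFinset with hS
  have hmem : ∀ s ∈ S, s ∈ adjacent T e := fun s hs => by simpa [hS] using hs
  have hi : ∀ s ∈ S, Integrable (fun x => d2n s e w x ^ 2) (edgeMeasure e) := fun s hs =>
    ((aeLinear_d2n (Ω := Ω) (hmem s hs).1
      (isTriEdge_of_mem_adjacent he (hmem s hs))).memLp w hw).integrable_sq
  calc ∫ x, avg T e w x ^ 2 ∂(edgeMeasure e)
      ≤ ∫ x, ∑ s ∈ S, d2n s e w x ^ 2 ∂(edgeMeasure e) :=
        integral_mono (((aeLinear_avg hT he).memLp w hw).integrable_sq)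
          (integrable_finsetSum _ hi) fun x => by
            have h0 : 0 ≤ ∑ s ∈ S, d2n s e w x ^ 2 := Finset.sum_nonneg fun s _ => sq_nonneg _
            simp only [hT.avg_eq, div_pow]
            -- With no adjacent triangle the average is `0 / 0 = 0`; otherwise dividing by the
            -- number of triangles more than compensates the Cauchy–Schwarz factor.
            rcases S.eq_empty_or_nonempty with h | h
            · simp [← hS, h]
            · have h1 : (1 : ℝ) ≤ S.card := by exact_mod_cast h.card_pos
              have h2 : (∑ s ∈ S, d2n s e w x) ^ 2 ≤ S.card * ∑ s ∈ S, d2n s e w x ^ 2 :=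
                sq_sum_le_card_mul_sum_sq
              rw [← hS, div_le_iff₀ (by positivity)]
              nlinarith [mul_nonneg (mul_nonneg (zero_le_one.trans h1) (sub_nonneg.2 h1)) h0]
    _ = ∑ s ∈ S, ∫ x, d2n s e w x ^ 2 ∂(edgeMeasure e) := integral_finsetSum _ hi
    _ ≤ _ := Finset.sum_le_sum fun s hs =>
        integral_d2n_sq_le (hmem s hs).1 (isTriEdge_of_mem_adjacent he (hmem s hs)) hw

/-- Exchanging the sums, every triangle is counted once for each of its three edges. -/
lemma sum_edges_adjacent_le {F : Finset Plane → Finset Plane → ℝ} {b : Finset Plane → ℝ}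
    (h : ∀ s e, s ∈ triangles T → IsTriEdge s e → F s e ≤ b s) :
    ∑ e ∈ hT.edgeFin, ∑ s ∈ (hT.finite_adjacent e).toFinset, F s e ≤
      ∑ s ∈ hT.triFin, 3 * b s := by
  rw [Finset.sum_comm' (t' := hT.triFin) (s' := fun s => s.powersetCard 2)]
  · refine Finset.sum_le_sum fun s hs => ?_
    rw [Finite.mem_toFinset] at hs
    have : (s.powersetCard 2).card = 3 := by rw [Finset.card_powersetCard, hs.2]; rfl
    refine (Finset.sum_le_card_nsmul _ _ (b s) fun e he => ?_).trans (by simp [this])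
    rw [Finset.mem_powersetCard] at he
    exact h s e hs (exists_vertices hs.2 (T.indep hs.1) he.1 he.2)
  · intro e s
    simp only [Finite.mem_toFinset, Finset.mem_powersetCard]
    constructor
    · rintro ⟨he, hs⟩
      exact ⟨⟨hs.2, he.2⟩, hs.1⟩
    · rintro ⟨⟨h1, h2⟩, hs⟩
      exact ⟨⟨T.down_closed hs.1 h1 (Finset.card_pos.1 (by omega)), h2⟩, hs, h1⟩

/-- The weight `|e|` times the trace constant is `|e|² / (2 area) ≤ σ²`. -/
lemma norm_sq_avgMap_le {σ : ℝ} (hσ : ShapeRegular σ T) (w : brokenH3 Ω T) :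
    ‖hT.avgMap w‖ ^ 2 ≤ ∑ s ∈ hT.triFin, 3 * (σ ^ 2 *
      (3 * nS 2 (interior (cell s)) w + size s ^ 2 * nS 3 (interior (cell s)) w)) := by
  rw [norm_sq_avgMap]
  refine le_trans (Finset.sum_le_sum fun e he => ?_) (hT.sum_edges_adjacent_le
    (F := fun s e => size e * (traceConst s e *
      (3 * nS 2 (interior (cell s)) w + size s ^ 2 * nS 3 (interior (cell s)) w))) ?_)
  · rw [← Finset.mul_sum]
    exact mul_le_mul_of_nonneg_left (hT.integral_avg_sq_le (by simpa using he) w.2) (size_nonneg e)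
  · intro s e hs he
    rw [← mul_assoc]
    refine mul_le_mul_of_nonneg_right ?_ ?_
    · have ha := he.area_pos
      have h1 := hσ.size_sq_le hs
      have h2 := pow_le_pow_left₀ (size_nonneg e) he.size_le 2
      rw [traceConst, ← mul_div_assoc, div_le_iff₀ (by positivity)]
      nlinarith
    · have := nS_nonneg 2 (interior (cell s)) w
      have := nS_nonneg 3 (interior (cell s)) w
      positivity

/-- The weight `1/|e|` cancels the edge length in the trace constant, leaving the inverse area. -/
lemma norm_sq_jumpMap_le (w : brokenH3 Ω T) :
    ‖hT.jumpMap w‖ ^ 2 ≤ ∑ s ∈ hT.triFin, 3 * ((volume.real (cell s))⁻¹ *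
      (3 * nS 1 (interior (cell s)) w + size s ^ 2 * nS 2 (interior (cell s)) w)) := by
  rw [norm_sq_jumpMap]
  refine le_trans (Finset.sum_le_sum fun e he => ?_) (hT.sum_edges_adjacent_le
    (F := fun s e => 1 / size e * (2 * (traceConst s e *
      (3 * nS 1 (interior (cell s)) w + size s ^ 2 * nS 2 (interior (cell s)) w)))) ?_)
  · rw [← Finset.mul_sum, ← Finset.mul_sum]
    exact mul_le_mul_of_nonneg_left (hT.integral_jump_sq_le (by simpa using he) w.2)
      (by have := size_nonneg e; positivity)
  · intro s e hs he
    have ha := he.area_pos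
    have hp := he.size_pos
    refine le_of_eq ?_
    rw [traceConst]
    field_simp

lemma norm_sq_massMap (hΩ : IsPolygonalDomain Ω) (w : brokenH3 Ω T) :
    ‖massMap Ω T w‖ ^ 2 = ∑ s ∈ hT.triFin, nS 0 (interior (cell s)) w := by
  rw [← real_inner_self_eq_norm_sq, inner_massMap, hT.setIntegral_eq_sum hΩ]
  · simp only [nS, sq]
  · exact w.2.1.integrable_mul w.2.1

end IsTriangulation

end

/-! ### The finite element space -/

section

variable {Ω : Set Plane} {T : Geometry.SimplicialComplex ℝ Plane} {z w : Plane → ℝ}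

lemma MemZh.add (hz : MemZh Ω T z) (hw : MemZh Ω T w) : MemZh Ω T (z + w) := by
  refine ⟨hz.1.add hw.1, fun s hs => ?_⟩
  obtain ⟨p, hp, h⟩ := hz.2 s hs
  obtain ⟨q, hq, h'⟩ := hw.2 s hs
  exact ⟨p + q, (MvPolynomial.totalDegree_add p q).trans (max_le hp hq), fun x hx => by
    rw [Pi.add_apply, h x hx, h' x hx, map_add]⟩

lemma MemZh.smul (hz : MemZh Ω T z) (r : ℝ) : MemZh Ω T (r • z) := by
  refine ⟨hz.1.const_smul r, fun s hs => ?_⟩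
  obtain ⟨p, hp, h⟩ := hz.2 s hs
  exact ⟨r • p, (MvPolynomial.totalDegree_smul_le r p).trans hp, fun x hx => by
    rw [Pi.smul_apply, h x hx, MvPolynomial.smul_eval, smul_eq_mul]⟩

lemma memZh_const (r : ℝ) : MemZh Ω T fun _ => r :=
  ⟨continuousOn_const, fun _ _ => ⟨MvPolynomial.C r, by simp, fun _ _ => by simp⟩⟩

lemma MemZh.congr (hz : MemZh Ω T z) (hT : IsTriangulation Ω T) (h : EqOn w z (closure Ω)) :
    MemZh Ω T w := by
  refine ⟨hz.1.congr h, fun s hs => ?_⟩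
  obtain ⟨p, hp, hzp⟩ := hz.2 s hs
  exact ⟨p, hp, fun x hx => (h (hT.cell_subset hs hx)).trans (hzp x hx)⟩

lemma MemZh.exists_quad (hz : MemZh Ω T z) {s : Finset Plane} (hs : s ∈ triangles T) :
    ∃ c, EqOn z (quad c) (cell s) := by
  obtain ⟨p, hp, h⟩ := hz.2 s hs
  obtain ⟨c, hc⟩ := exists_quad_of_totalDegree_le hp
  exact ⟨c, fun x hx => (h x hx).trans (hc x)⟩

lemma ae_eq_restrict_interior_of_eqOn {s : Finset Plane} (h : EqOn z w (cell s)) :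
    z =ᵐ[volume.restrict (interior (cell s))] w :=
  (ae_restrict_iff' isOpen_interior.measurableSet).2
    (Eventually.of_forall fun _ hx => h (interior_subset hx))

lemma memLp_of_continuousOn_closure (hΩ : IsPolygonalDomain Ω) (h : ContinuousOn z (closure Ω)) :
    MemLp z 2 (volume.restrict Ω) := by
  have hc := hΩ.bounded.isCompact_closure
  obtain ⟨C, hC⟩ := hc.exists_bound_of_continuousOn h
  have : IsFiniteMeasure (volume.restrict Ω) :=
    ⟨by rw [Measure.restrict_apply_univ]; exact hΩ.bounded.measure_lt_top⟩
  refine MemLp.of_bound ((h.mono subset_closure).aestronglyMeasurable hΩ.isOpen.measurableSet) C ?_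
  exact (ae_restrict_iff' hΩ.isOpen.measurableSet).2
    (Eventually.of_forall fun x hx => hC x (subset_closure hx))

lemma MemZh.mem_brokenH3 (hz : MemZh Ω T z) (hΩ : IsPolygonalDomain Ω) : z ∈ brokenH3 Ω T := by
  refine ⟨memLp_of_continuousOn_closure hΩ hz.1, fun s hs => ?_⟩
  obtain ⟨c, hc⟩ := hz.exists_quad hs
  exact (Approx.of_contDiff (isBounded_interior_cell s) (contDiff_quad c) 3).congr
    (ae_eq_restrict_interior_of_eqOn hc).symm

lemma MemZh.nS_three (hz : MemZh Ω T z) {s : Finset Plane} (hs : s ∈ triangles T) :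
    nS 3 (interior (cell s)) z = 0 := by
  obtain ⟨c, hc⟩ := hz.exists_quad hs
  rw [nS_eq_pS isOpen_interior (isBounded_interior_cell s) (contDiff_quad c)
    (ae_eq_restrict_interior_of_eqOn hc), pS_three_quad]

/-- The space `Z_h`. -/
def zSpace (Ω : Set Plane) (T : Geometry.SimplicialComplex ℝ Plane) :
    Submodule ℝ (brokenH3 Ω T) where
  carrier := {w | MemZh Ω T w.1}
  add_mem' h h' := h.add h'
  zero_mem' := memZh_const 0
  smul_mem' c _ h := h.smul c

/-- The functions in `Z_h` that vanish outside the closure of the domain. -/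
def zSpace₀ (Ω : Set Plane) (T : Geometry.SimplicialComplex ℝ Plane) :
    Submodule ℝ (brokenH3 Ω T) where
  carrier := {w | w ∈ zSpace Ω T ∧ ∀ x ∉ closure Ω, w.1 x = 0}
  add_mem' {v w} h h' := ⟨add_mem h.1 h'.1, fun x hx => by
    rw [Submodule.coe_add, Pi.add_apply, h.2 x hx, h'.2 x hx, add_zero]⟩
  zero_mem' := ⟨zero_mem _, fun _ _ => rfl⟩
  smul_mem' c w h := ⟨Submodule.smul_mem _ c h.1, fun x hx => by
    rw [Submodule.coe_smul, Pi.smul_apply, h.2 x hx, smul_zero]⟩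

lemma zSpace₀_le : zSpace₀ Ω T ≤ zSpace Ω T := fun _ h => h.1

namespace IsTriangulation

open Classical in
/-- The piecewise quadratic functions, given by their coefficients; every point is assigned to one
of the triangles that contain it. -/
def piecewiseQuad (hT : IsTriangulation Ω T) : (hT.triFin → Fin 6 → ℝ) →ₗ[ℝ] Plane → ℝ :=
  LinearMap.pi fun x =>
    if h : ∃ s : hT.triFin, x ∈ cell s.1 then
      LinearMap.proj x ∘ₗ quadL ∘ₗ LinearMap.proj h.choose
    else 0

/-- Such a function is determined by its six coefficients on each of finitely many triangles. -/
lemma finiteDimensional_zSpace₀ (hT : IsTriangulation Ω T) (hΩ : IsPolygonalDomain Ω) :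
    FiniteDimensional ℝ (zSpace₀ Ω T) := by
  have hmem : ∀ w : zSpace₀ Ω T, w.1.1 ∈ LinearMap.range hT.piecewiseQuad := by
    intro w
    have hq : ∀ s : hT.triFin, ∃ c, EqOn w.1.1 (quad c) (cell s.1) := fun s =>
      MemZh.exists_quad w.2.1 (hT.mem_triangles s)
    choose c hc using hq
    refine ⟨c, funext fun x => ?_⟩
    by_cases h : ∃ s : hT.triFin, x ∈ cell s.1
    · simp only [piecewiseQuad, LinearMap.pi_apply, dif_pos h]
      exact (hc _ h.choose_spec).symm
    · simp only [piecewiseQuad, LinearMap.pi_apply, dif_neg h]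
      refine (w.2.2 x fun hx => h ?_).symm
      rw [hT.closure_eq hΩ] at hx
      obtain ⟨s, hs, hxs⟩ := mem_iUnion₂.1 hx
      exact ⟨⟨s, (Finite.mem_toFinset _).2 hs⟩, hxs⟩
  let f : zSpace₀ Ω T →ₗ[ℝ] LinearMap.range hT.piecewiseQuad :=
    ((brokenH3 Ω T).subtype ∘ₗ (zSpace₀ Ω T).subtype).codRestrict _ hmem
  refine Module.Finite.of_injective f fun v w h => ?_
  have h' := congrArg Subtype.val h
  exact Subtype.ext (Subtype.ext h')

variable {σ α κ : ℝ}

/-- The discrete trace inequality: third derivatives vanish on `Z_h`, and `9` is three edges times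
the `3` of the trace inequality. It fixes the threshold `36 σ²` for `α`. -/
lemma norm_sq_avgMap_le_of_mem (hT : IsTriangulation Ω T)
    (hσ : ShapeRegular σ T) :
    ∀ ξ ∈ zSpace Ω T, ‖hT.avgMap ξ‖ ^ 2 ≤ 9 * σ ^ 2 * ‖hT.hessMap ξ‖ ^ 2 := by
  intro ξ hξ
  refine (hT.norm_sq_avgMap_le hσ ξ).trans (le_of_eq ?_)
  rw [norm_sq_hessMap, Finset.mul_sum]
  refine Finset.sum_congr rfl fun s hs => ?_
  rw [MemZh.nS_three hξ ((Finite.mem_toFinset _).1 hs)]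
  ring

/-- Upper bound for the contribution of a triangle to the error norm. -/
def localErr (σ α κ : ℝ) (s : Finset Plane) (n₀ n₁ n₂ n₃ : ℝ) : ℝ :=
  n₂ + 3 * (σ ^ 2 * (3 * n₂ + size s ^ 2 * n₃)) +
    α * (3 * ((volume.real (cell s))⁻¹ * (3 * n₁ + size s ^ 2 * n₂))) + κ * n₀

lemma errSq_le (hT : IsTriangulation Ω T)
    (hΩ : IsPolygonalDomain Ω) (hσ : ShapeRegular σ T) (hα : 0 ≤ α)
    (w : brokenH3 Ω T) :
    errSq hT.hessMap hT.avgMap hT.jumpMap (massMap Ω T) α κ w ≤ ∑ s ∈ hT.triFin,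
      localErr σ α κ s (nS 0 (interior (cell s)) w) (nS 1 (interior (cell s)) w)
        (nS 2 (interior (cell s)) w) (nS 3 (interior (cell s)) w) := by
  simp only [localErr, Finset.sum_add_distrib, ← Finset.mul_sum]
  rw [errSq, hT.norm_sq_hessMap, hT.norm_sq_massMap hΩ]
  have h1 := hT.norm_sq_avgMap_le hσ w
  have h2 := mul_le_mul_of_nonneg_left (hT.norm_sq_jumpMap_le w) hα
  simp only [Finset.sum_add_distrib, ← Finset.mul_sum] at h1 h2
  linarith

lemma maps_eq_zero (hT : IsTriangulation Ω T)
    (hσ : ShapeRegular σ T) (w : brokenH3 Ω T)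
    (h : ∀ s ∈ triangles T, nS 1 (interior (cell s)) w = 0 ∧ nS 2 (interior (cell s)) w = 0 ∧
      nS 3 (interior (cell s)) w = 0) :
    hT.hessMap w = 0 ∧ hT.avgMap w = 0 ∧ hT.jumpMap w = 0 := by
  have hm : ∀ s ∈ hT.triFin, s ∈ triangles T := fun s hs => (Finite.mem_toFinset _).1 hs
  refine ⟨norm_eq_zero.1 (pow_eq_zero_iff two_ne_zero |>.1 (le_antisymm ?_ (sq_nonneg _))),
    norm_eq_zero.1 (pow_eq_zero_iff two_ne_zero |>.1 (le_antisymm ?_ (sq_nonneg _))),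
    norm_eq_zero.1 (pow_eq_zero_iff two_ne_zero |>.1 (le_antisymm ?_ (sq_nonneg _)))⟩
  · rw [norm_sq_hessMap]
    exact (Finset.sum_eq_zero fun s hs => (h s (hm s hs)).2.1).le
  · refine (hT.norm_sq_avgMap_le hσ w).trans (Finset.sum_eq_zero fun s hs => ?_).le
    rw [(h s (hm s hs)).2.1, (h s (hm s hs)).2.2]
    simp
  · refine (hT.norm_sq_jumpMap_le w).trans (Finset.sum_eq_zero fun s hs => ?_).le
    rw [(h s (hm s hs)).2.1, (h s (hm s hs)).1]
    simp

lemma nS_eq_zero {w : Plane → ℝ} {s : Finset Plane} {c : Fin 6 → ℝ} (h : EqOn w (quad c) (cell s))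
    {k : ℕ} (hk : pS k (interior (cell s)) (quad c) = 0) : nS k (interior (cell s)) w = 0 := by
  rw [nS_eq_pS isOpen_interior (isBounded_interior_cell s) (contDiff_quad c)
    (ae_eq_restrict_interior_of_eqOn h), hk]

lemma pS_quad_const (K : Set Plane) (r : ℝ) :
    pS 1 K (quad ![r, 0, 0, 0, 0, 0]) = 0 ∧ pS 2 K (quad ![r, 0, 0, 0, 0, 0]) = 0 := by
  have h : ∀ i, quadPd i ![r, 0, 0, 0, 0, 0] = 0 := by
    intro i; ext m; fin_cases i <;> fin_cases m <;> simp [quadPd]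
  have h' : ∀ i, quadPd i 0 = 0 := by
    intro i; ext m; fin_cases i <;> fin_cases m <;> simp [quadPd]
  have h2 : ∀ i, pd i (quad ![r, 0, 0, 0, 0, 0]) = quad 0 := fun i => by rw [pd_quad, h]
  have h3 : ∀ i, pd i 0 = 0 := fun i => by rw [← quad_zero, pd_quad, h']
  simp only [pS, h2, quad_zero, h3]
  simp

/-- The form does not see functions that are constant on the closure of the domain, except through
the mass term. -/
lemma ipForm_of_eqOn_const (hT : IsTriangulation Ω T)
    (hσ : ShapeRegular σ T) (w ξ : brokenH3 Ω T) {r : ℝ}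
    (h : ∀ x ∈ closure Ω, ξ.1 x = r) :
    ipForm hT.hessMap hT.avgMap hT.jumpMap (massMap Ω T) α κ w ξ =
      κ * inner ℝ (massMap Ω T w) (massMap Ω T ξ) := by
  have hq : ∀ s ∈ triangles T, EqOn ξ.1 (quad ![r, 0, 0, 0, 0, 0]) (cell s) := fun s hs x hx => by
    rw [h x (hT.cell_subset hs hx)]; simp [quad]
  obtain ⟨h1, h2, h3⟩ := hT.maps_eq_zero hσ ξ fun s hs =>
    ⟨nS_eq_zero (hq s hs) (pS_quad_const _ r).1, nS_eq_zero (hq s hs) (pS_quad_const _ r).2,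
      nS_eq_zero (hq s hs) (pS_three_quad _ _)⟩
  rw [ipForm_apply, h1, h2, h3]
  simp

/-- A continuous function that vanishes almost everywhere on the open set `Ω` vanishes on it, and by
density on its closure. -/
lemma eqOn_zero_of_massMap_eq_zero (hΩ : IsPolygonalDomain Ω) {ξ : brokenH3 Ω T}
    (hξ : ξ ∈ zSpace Ω T) (h : massMap Ω T ξ = 0) : EqOn ξ.1 0 (closure Ω) := by
  have h1 : ξ.1 =ᵐ[volume.restrict Ω] 0 := by
    have := (Lp.eq_zero_iff_ae_eq_zero).1 h
    exact (ξ.2.1.coeFn_toLp.symm.trans this)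
  have hc : ContinuousOn ξ.1 (closure Ω) := hξ.1
  have h2 : EqOn ξ.1 0 Ω := Measure.eqOn_open_of_ae_eq h1 hΩ.isOpen (hc.mono subset_closure)
    continuousOn_const
  exact h2.of_subset_closure hc continuousOn_const subset_closure subset_rfl

/-- The Ritz projection is the Galerkin projection. -/
lemma isRitz_iff (hT : IsTriangulation Ω T)
    (hΩ : IsPolygonalDomain Ω) (hσ : ShapeRegular σ T) {ε : ℝ} (hε : ε < 1)
    (u : brokenH3 Ω T) (p : Plane → ℝ) :
    IsRitz Ω T α ε u p ↔ ∃ p' ∈ zSpace Ω T, p'.1 = p ∧ ∀ ξ ∈ zSpace Ω T,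
      ipForm hT.hessMap hT.avgMap hT.jumpMap (massMap Ω T) α (1 - ε) (p' - u) ξ = 0 := by
  constructor
  · intro h
    refine ⟨⟨p, h.mem.mem_brokenH3 hΩ⟩, h.mem, rfl, fun ξ hξ => ?_⟩
    rw [← hT.aIP_add_eq_ipForm]
    exact h.orth ξ.1 hξ
  · rintro ⟨p, hp, rfl, h⟩
    refine ⟨hp, fun ξ hξ => ?_, ?_⟩
    · have := h ⟨ξ, hξ.mem_brokenH3 hΩ⟩ hξ
      rw [← hT.aIP_add_eq_ipForm] at this
      exact this
    -- With `ξ = 1` only the mass term survives, and `1 - ε ≠ 0` gives the mean value condition.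
    · have h1 := h ⟨_, (memZh_const 1).mem_brokenH3 hΩ⟩ (memZh_const 1)
      rw [hT.ipForm_of_eqOn_const hσ _ _ (r := 1) fun x _ => rfl, inner_massMap] at h1
      exact (mul_eq_zero.1 h1).resolve_left (by linarith)

/-- Values off the closure of `Ω` are unrestricted in `zSpace`, so the Galerkin problem is solved in
`zSpace₀`, which is finite dimensional and on which the mass term is definite. -/
lemma exists_isRitz (hT : IsTriangulation Ω T)
    (hΩ : IsPolygonalDomain Ω) (hσ : ShapeRegular σ T) (hα : 1 ≤ α)
    (hασ : 4 * (9 * σ ^ 2) ≤ α) {ε : ℝ} (hε : ε < 1) (u : brokenH3 Ω T) :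
    ∃ p, IsRitz Ω T α ε u p := by
  have := hT.finiteDimensional_zSpace₀ hΩ
  have hκ : 0 < 1 - ε := by linarith
  obtain ⟨p, hp, h⟩ := exists_galerkin (J := hT.jumpMap) (M := massMap Ω T) hα hκ hασ
    (zSpace₀ Ω T) (fun ξ hξ => hT.norm_sq_avgMap_le_of_mem hσ ξ (zSpace₀_le hξ))
    (fun ξ hξ hM => by
      have h0 := eqOn_zero_of_massMap_eq_zero hΩ (zSpace₀_le hξ) hM
      ext x
      by_cases hx : x ∈ closure Ω
      · exact h0 hx
      · exact hξ.2 x hx) u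
  refine ⟨p.1, (hT.isRitz_iff hΩ hσ hε u p.1).2 ⟨p, hp.1, rfl, fun ξ hξ => ?_⟩⟩
  -- A general test function is cut off outside the closure; the removed part vanishes on the
  -- closure and is invisible to the form.
  have hm : MemZh Ω T ((closure Ω).indicator ξ.1) :=
    MemZh.congr hξ hT fun x hx => indicator_of_mem hx _
  let ξ₀ : brokenH3 Ω T := ⟨_, hm.mem_brokenH3 hΩ⟩
  have h0 : ξ₀ ∈ zSpace₀ Ω T := ⟨hm, fun x hx => indicator_of_notMem hx _⟩
  have hzero : ∀ x ∈ closure Ω, (ξ - ξ₀).1 x = 0 := fun x hx => by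
    change ξ.1 x - (closure Ω).indicator ξ.1 x = 0
    rw [indicator_of_mem hx, sub_self]
  have h1 := hT.ipForm_of_eqOn_const (α := α) (κ := 1 - ε) hσ (p - u) (ξ - ξ₀) hzero
  have h2 : inner ℝ (massMap Ω T (p - u)) (massMap Ω T (ξ - ξ₀)) = 0 := by
    rw [inner_massMap]
    exact integral_eq_zero_of_ae ((ae_restrict_iff' hΩ.isOpen.measurableSet).2
      (Eventually.of_forall fun x hx => mul_eq_zero_of_right _ (hzero x (subset_closure hx))))
  rw [h2, mul_zero, map_sub, h ξ₀ h0, sub_zero] at h1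
  exact h1

lemma isRitz_unique (hT : IsTriangulation Ω T)
    (hΩ : IsPolygonalDomain Ω) (hσ : ShapeRegular σ T) (hα : 1 ≤ α)
    (hασ : 4 * (9 * σ ^ 2) ≤ α) {ε : ℝ} (hε : ε < 1) (u : brokenH3 Ω T) {p q : Plane → ℝ}
    (hp : IsRitz Ω T α ε u p) (hq : IsRitz Ω T α ε u q) : EqOn q p (closure Ω) := by
  obtain ⟨p, hpz, rfl, hp'⟩ := (hT.isRitz_iff hΩ hσ hε u p).1 hp
  obtain ⟨q, hqz, rfl, hq'⟩ := (hT.isRitz_iff hΩ hσ hε u q).1 hq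
  have hd : q - p ∈ zSpace Ω T := sub_mem hqz hpz
  have h0 : ipForm hT.hessMap hT.avgMap hT.jumpMap (massMap Ω T) α (1 - ε) (q - p) (q - p) = 0 := by
    have e : q - p = (q - u) - (p - u) := by abel
    have := (hq' _ hd).trans (hp' _ hd).symm
    rw [← sub_eq_zero, ← LinearMap.sub_apply, ← map_sub, ← e] at this
    exact this
  have h1 := eqOn_zero_of_massMap_eq_zero hΩ hd (eq_zero_of_ipForm_self hα (by linarith) hασ
    (hT.norm_sq_avgMap_le_of_mem hσ _ hd) h0)
  exact fun x hx => sub_eq_zero.1 (h1 hx)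

end IsTriangulation

end

/-! ### The error estimate -/

section

variable {Ω : Set Plane} {T : Geometry.SimplicialComplex ℝ Plane}

lemma hNormSq_nonneg (k : ℕ) (K : Set Plane) (w : Plane → ℝ) : 0 ≤ hNormSq k K w := by
  induction k generalizing w with
  | zero => exact integral_nonneg fun x => sq_nonneg _
  | succ k ih =>
    exact add_nonneg (integral_nonneg fun x => sq_nonneg _) (Finset.sum_nonneg fun i _ => ih _)

lemma nS_le_hNormSq (k : ℕ) (K : Set Plane) (w : Plane → ℝ) : nS k K w ≤ hNormSq k K w := by
  induction k generalizing w with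
  | zero => exact le_rfl
  | succ k ih =>
    exact (Finset.sum_le_sum fun i _ => ih _).trans
      (le_add_of_nonneg_left (integral_nonneg fun x => sq_nonneg _))

/-- The induction moves one derivative inside the difference, using that `wD` is linear almost
everywhere and agrees with `pd` on smooth functions. -/
lemma Conv.tendsto_nS_sub {K : Set Plane} (hK : IsOpen K) (hb : Bornology.IsBounded K) {k : ℕ}
    {φ : ℕ → Plane → ℝ} {w : Plane → ℝ} (hφ : ∀ n, ContDiff ℝ ∞ (φ n)) (h : Conv k K φ w) :
    Tendsto (fun n => nS k K (w - φ n)) atTop (𝓝 0) := by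
  induction k generalizing φ w with
  | zero =>
    have := ((ConvL2.const h.convL2.memLp_lim).sub h.convL2).tendsto_integral_sq
    simpa [nS] using this
  | succ k ih =>
    have h1 := tendsto_finsetSum Finset.univ fun i _ =>
      ih (fun n => contDiff_pd (hφ n) i) (h.wD hK hφ i)
    rw [Finset.sum_const_zero] at h1
    refine h1.congr fun n => Finset.sum_congr rfl fun i _ => nS_congr hK ?_
    have hw : Approx (k + 1) K w := ⟨φ, hφ, h⟩
    have hn : Approx (k + 1) K (φ n) := Approx.of_contDiff hb (hφ n) _
    have e : w - φ n = w + (-1 : ℝ) • φ n := by ext x; simp [sub_eq_add_neg]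
    rw [e]
    filter_upwards [hw.wD_add hK (hn.smul (-1)) i, hn.wD_smul hK (-1) i,
      wD_ae_eq_pd hK hb (hφ n) ae_eq_rfl i] with x h1 h2 h3
    rw [h1, Pi.add_apply, h2, Pi.smul_apply, h3]
    simp [sub_eq_add_neg]

namespace IsTriangulation

/-- The constant in the interpolation error estimate. -/
def interpConst (σ α κ d : ℝ) : ℝ :=
  (1 + 9 * σ ^ 2) * (1920 * (σ ^ 2) ^ 4) + 3 * σ ^ 2 +
    6 * α * σ ^ 2 * (3 * (240 * (σ ^ 2) ^ 2 * (1920 * (σ ^ 2) ^ 4)) + 1920 * (σ ^ 2) ^ 4) +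
    κ * ((66 * (240 * (σ ^ 2) ^ 2) + 2) * (1920 * (σ ^ 2) ^ 4)) * d ^ 4

/-- Every term scales like `h² P`: the inverse area is at most `2σ²/h²`, and the surplus `h⁴` in the
`L²` term is bounded by the diameter of the domain. -/
lemma localErr_le {σ α κ d a h H c₀ c₁ c₂ n₀ n₁ n₂ P : ℝ} (hα : 0 ≤ α) (hκ : 0 ≤ κ) (ha : 0 < a)
    (hh : 0 ≤ h) (hH : h ≤ H) (hd : H ≤ d) (hs : h ^ 2 ≤ 2 * σ ^ 2 * a) (hc₀ : 0 ≤ c₀)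
    (hc₁ : 0 ≤ c₁) (hc₂ : 0 ≤ c₂) (hP : 0 ≤ P) (h₀ : n₀ ≤ c₀ * h ^ 6 * P)
    (h₁ : n₁ ≤ c₁ * h ^ 4 * P) (h₂ : n₂ ≤ c₂ * h ^ 2 * P) :
    n₂ + 3 * (σ ^ 2 * (3 * n₂ + h ^ 2 * P)) + α * (3 * (a⁻¹ * (3 * n₁ + h ^ 2 * n₂))) + κ * n₀ ≤
      ((1 + 9 * σ ^ 2) * c₂ + 3 * σ ^ 2 + 6 * α * σ ^ 2 * (3 * c₁ + c₂) + κ * c₀ * d ^ 4) *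
        H ^ 2 * P := by
  have hHP : h ^ 2 * P ≤ H ^ 2 * P :=
    mul_le_mul_of_nonneg_right (pow_le_pow_left₀ hh hH 2) hP
  have hP2 : 0 ≤ h ^ 2 * P := by positivity
  have e1 : (1 + 9 * σ ^ 2) * n₂ ≤ (1 + 9 * σ ^ 2) * c₂ * (h ^ 2 * P) := by
    calc _ ≤ (1 + 9 * σ ^ 2) * (c₂ * h ^ 2 * P) :=
          mul_le_mul_of_nonneg_left h₂ (by positivity)
      _ = _ := by ring
  have e2 : a⁻¹ * (3 * n₁ + h ^ 2 * n₂) ≤ 2 * σ ^ 2 * (3 * c₁ + c₂) * (h ^ 2 * P) := by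
    rw [inv_mul_le_iff₀ ha]
    calc 3 * n₁ + h ^ 2 * n₂ ≤ 3 * (c₁ * h ^ 4 * P) + h ^ 2 * (c₂ * h ^ 2 * P) := by gcongr
      _ = h ^ 2 * ((3 * c₁ + c₂) * (h ^ 2 * P)) := by ring
      _ ≤ 2 * σ ^ 2 * a * ((3 * c₁ + c₂) * (h ^ 2 * P)) :=
          mul_le_mul_of_nonneg_right hs (by positivity)
      _ = _ := by ring
  have e3 : α * (3 * (a⁻¹ * (3 * n₁ + h ^ 2 * n₂))) ≤
      6 * α * σ ^ 2 * (3 * c₁ + c₂) * (h ^ 2 * P) := by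
    calc _ ≤ α * (3 * (2 * σ ^ 2 * (3 * c₁ + c₂) * (h ^ 2 * P))) := by gcongr
      _ = _ := by ring
  have e4 : κ * n₀ ≤ κ * c₀ * d ^ 4 * (h ^ 2 * P) := by
    calc κ * n₀ ≤ κ * (c₀ * h ^ 6 * P) := mul_le_mul_of_nonneg_left h₀ hκ
      _ = κ * c₀ * (h ^ 2 * P) * h ^ 4 := by ring
      _ ≤ κ * c₀ * (h ^ 2 * P) * d ^ 4 :=
          mul_le_mul_of_nonneg_left (pow_le_pow_left₀ hh (hH.trans hd) 4) (by positivity)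
      _ = _ := by ring
  calc _ ≤ ((1 + 9 * σ ^ 2) * c₂ + 3 * σ ^ 2 + 6 * α * σ ^ 2 * (3 * c₁ + c₂) +
        κ * c₀ * d ^ 4) * (h ^ 2 * P) := by linarith
    _ ≤ _ := by
      rw [mul_assoc _ (H ^ 2)]
      exact mul_le_mul_of_nonneg_left hHP (by positivity)

variable {σ α κ : ℝ}

/-- The interpolation error in the error norm. -/
lemma exists_errSq_sub_le (hT : IsTriangulation Ω T) (hΩ : IsPolygonalDomain Ω)
    (hσ : ShapeRegular σ T) (hα : 0 ≤ α) (hκ : 0 ≤ κ) (φ : brokenH3 Ω T)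
    (hφ : ContDiff ℝ ∞ φ.1) : ∃ z ∈ zSpace Ω T,
      errSq hT.hessMap hT.avgMap hT.jumpMap (massMap Ω T) α κ (φ - z) ≤
        interpConst σ α κ (Metric.diam (closure Ω)) * meshSize T ^ 2 *
          ∑ s ∈ hT.triFin, pS 3 (interior (cell s)) φ.1 := by
  obtain ⟨z, hz, hzs⟩ := hT.exists_interpolant hΩ φ.1
  refine ⟨⟨z, hz.mem_brokenH3 hΩ⟩, hz, (hT.errSq_le hΩ hσ hα _).trans ?_⟩
  rw [Finset.mul_sum]
  refine Finset.sum_le_sum fun s hs => ?_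
  rw [Finite.mem_toFinset] at hs
  obtain ⟨c, hc, hn⟩ := hzs s hs
  have hw : φ.1 - z =ᵐ[volume.restrict (interior (cell s))] φ.1 - quad c :=
    ae_eq_restrict_interior_of_eqOn fun x hx => by
      rw [Pi.sub_apply, Pi.sub_apply, hc hx]
  have e : ∀ k, nS k (interior (cell s)) (φ.1 - z) = pS k (interior (cell s)) (φ.1 - quad c) :=
    nS_eq_pS isOpen_interior (isBounded_interior_cell s) (hφ.sub (contDiff_quad c)) hw
  obtain ⟨h2, h1, h0⟩ := hσ.interpolation_estimate hs hφ hn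
  obtain ⟨a, b, c', rfl, hD⟩ := exists_vertices_of_mem_triangles hs
  have ha : 0 < volume.real (cell {a, b, c'}) := by
    rw [cell_insert, volume_real_tri hD]
    have := abs_pos.2 hD
    positivity
  change localErr σ α κ _ (nS 0 _ (φ.1 - z)) (nS 1 _ (φ.1 - z)) (nS 2 _ (φ.1 - z))
    (nS 3 _ (φ.1 - z)) ≤ _
  rw [localErr, e, e, e, e, pS_three_sub_quad _ hφ]
  exact localErr_le hα hκ ha (size_nonneg _) (hT.size_le_meshSize hs) (hT.meshSize_le hΩ)
    (hσ.size_sq_le hs) (by positivity) (by positivity) (by positivity) (pS_nonneg _ _ _) h0 h1 h2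

/-- The error norm of the difference to smooth approximations tends to zero. -/
lemma tendsto_errSq_sub (hT : IsTriangulation Ω T) (hΩ : IsPolygonalDomain Ω)
    (hσ : ShapeRegular σ T) (hα : 0 ≤ α) (hκ : 0 ≤ κ) (u : brokenH3 Ω T)
    (φ : ℕ → brokenH3 Ω T) (hφ : ∀ n, ContDiff ℝ ∞ (φ n).1)
    (h : Conv 3 Ω (fun n => (φ n).1) u.1) :
    Tendsto (fun n => errSq hT.hessMap hT.avgMap hT.jumpMap (massMap Ω T) α κ (u - φ n)) atTop
      (𝓝 0) := by
  have hn : ∀ s ∈ hT.triFin, ∀ k ≤ 3,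
      Tendsto (fun n => nS k (interior (cell s)) (u.1 - (φ n).1)) atTop (𝓝 0) := by
    intro s hs k hk
    have h3 : Conv 3 (interior (cell s)) (fun n => (φ n).1) u.1 :=
      h.mono (hT.interior_cell_subset hΩ ((Finite.mem_toFinset _).1 hs))
    have h2 := h3.of_succ
    have h1 := h2.of_succ
    have h0 := h1.of_succ
    have hb := isBounded_interior_cell s
    interval_cases k
    · exact h0.tendsto_nS_sub isOpen_interior hb hφ
    · exact h1.tendsto_nS_sub isOpen_interior hb hφ
    · exact h2.tendsto_nS_sub isOpen_interior hb hφ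
    · exact h3.tendsto_nS_sub isOpen_interior hb hφ
  have hlim : Tendsto (fun n => ∑ s ∈ hT.triFin, localErr σ α κ s
      (nS 0 (interior (cell s)) (u.1 - (φ n).1)) (nS 1 (interior (cell s)) (u.1 - (φ n).1))
      (nS 2 (interior (cell s)) (u.1 - (φ n).1)) (nS 3 (interior (cell s)) (u.1 - (φ n).1))) atTop
      (𝓝 (∑ s ∈ hT.triFin, localErr σ α κ s 0 0 0 0)) := by
    refine tendsto_finsetSum _ fun s hs => ?_
    have t0 := hn s hs 0 (by norm_num)
    have t1 := hn s hs 1 (by norm_num)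
    have t2 := hn s hs 2 (by norm_num)
    have t3 := hn s hs 3 le_rfl
    exact ((t2.add ((((t2.const_mul 3).add (t3.const_mul _)).const_mul _).const_mul 3)).add
      (((((t1.const_mul 3).add (t2.const_mul _)).const_mul _).const_mul 3).const_mul α)).add
      (t0.const_mul κ)
  have hz : ∑ s ∈ hT.triFin, localErr σ α κ s 0 0 0 0 = 0 :=
    Finset.sum_eq_zero fun s _ => by simp [localErr]
  rw [hz] at hlim
  refine squeeze_zero (fun n => ?_) (fun n => hT.errSq_le hΩ hσ hα _) hlim
  rw [errSq]
  positivity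

/-- The error estimate for the Ritz projection. -/
lemma norm2h_sub_le (hT : IsTriangulation Ω T) (hΩ : IsPolygonalDomain Ω)
    (hσ : ShapeRegular σ T) (hα : 1 ≤ α) (hασ : 4 * (9 * σ ^ 2) ≤ α) {ε : ℝ} (hε : ε < 1)
    {u p : Plane → ℝ} (hu : MemH 3 Ω u) (huz : u ∈ brokenH3 Ω T) (hp : IsRitz Ω T α ε u p) :
    norm2h T α (u - p) ≤
      Real.sqrt (60 * interpConst σ α (1 - ε) (Metric.diam (closure Ω))) * meshSize T *
        hNorm 3 Ω u := by
  obtain ⟨p, hpz, rfl, horth⟩ := (hT.isRitz_iff hΩ hσ hε ⟨u, huz⟩ p).1 hp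
  have hκ : 0 ≤ 1 - ε := by linarith
  have hα0 : 0 ≤ α := by linarith
  set D := interpConst σ α (1 - ε) (Metric.diam (closure Ω)) with hD
  have hD0 : 0 ≤ D := by rw [hD, interpConst]; positivity
  obtain ⟨φ, hφ, hconv⟩ := hu.approx hΩ.isOpen hΩ.bounded hΩ.lipschitz
  let ψ : ℕ → brokenH3 Ω T := fun n => ⟨φ n, memLp_of_contDiff hΩ.bounded (hφ n), fun s _ =>
    Approx.of_contDiff (isBounded_interior_cell s) (hφ n) 3⟩
  let u' : brokenH3 Ω T := ⟨u, huz⟩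
  have hbound : ∀ n, ‖hT.hessMap (u' - p)‖ ^ 2 + α * ‖hT.jumpMap (u' - p)‖ ^ 2 ≤
      30 * (2 * errSq hT.hessMap hT.avgMap hT.jumpMap (massMap Ω T) α (1 - ε) (u' - ψ n) +
        2 * (D * meshSize T ^ 2 * ∑ s ∈ hT.triFin, pS 3 (interior (cell s)) (φ n))) := by
    intro n
    obtain ⟨z, hz, hzb⟩ := hT.exists_errSq_sub_le hΩ hσ hα0 hκ (ψ n) (hφ n)
    have h1 := norm_sub_le_errSq (J := hT.jumpMap) (M := massMap Ω T) hα hκ hασ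
      (hT.norm_sq_avgMap_le_of_mem hσ) hpz hz horth
    have h2 := errSq_add_le (H := hT.hessMap) (A := hT.avgMap) (J := hT.jumpMap)
      (M := massMap Ω T) hα0 hκ (u' - ψ n) (ψ n - z)
    rw [sub_add_sub_cancel] at h2
    refine h1.trans (mul_le_mul_of_nonneg_left (h2.trans ?_) (by norm_num))
    exact add_le_add le_rfl (mul_le_mul_of_nonneg_left hzb zero_le_two)
  have hdisj : ((hT.triFin : Finset (Finset Plane)) : Set (Finset Plane)).PairwiseDisjoint
      fun s => interior (cell s) := by
    rw [Finite.coe_toFinset]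
    exact pairwiseDisjoint_interior_cell
  have hsub : ∀ s ∈ hT.triFin, interior (cell s) ⊆ Ω := fun s hs =>
    hT.interior_cell_subset hΩ ((Finite.mem_toFinset _).1 hs)
  have hsum : ∑ s ∈ hT.triFin, nS 3 (interior (cell s)) u ≤ hNormSq 3 Ω u :=
    (sum_nS_le _ _ (fun s _ => isOpen_interior) hsub hΩ.isOpen hdisj ⟨φ, hφ, hconv⟩).trans
      (nS_le_hNormSq 3 Ω u)
  have ht1 := hT.tendsto_errSq_sub hΩ hσ hα0 hκ u' ψ hφ hconv
  have ht2 : Tendsto (fun n => ∑ s ∈ hT.triFin, pS 3 (interior (cell s)) (φ n)) atTop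
      (𝓝 (∑ s ∈ hT.triFin, nS 3 (interior (cell s)) u)) :=
    tendsto_finsetSum _ fun s hs => (hconv.mono (hsub s hs)).tendsto_pS isOpen_interior hφ
  -- The mesh is fixed while `n` grows: the approximation error disappears and the smooth seminorms
  -- tend to those of `u`.
  have hlim := ge_of_tendsto' (((ht1.const_mul 2).add
    ((ht2.const_mul (D * meshSize T ^ 2)).const_mul 2)).const_mul 30) hbound
  have hN := hNormSq_nonneg 3 Ω u
  have hm := IsTriangulation.meshSize_nonneg (T := T)
  change norm2h T α (u' - p : brokenH3 Ω T) ≤ _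
  rw [hT.norm2h_eq, hNorm]
  refine Real.sqrt_le_iff.2 ⟨by positivity, ?_⟩
  rw [mul_pow, mul_pow, Real.sq_sqrt (by positivity), Real.sq_sqrt hN]
  refine hlim.trans ?_
  have := mul_le_mul_of_nonneg_left hsum (by positivity : 0 ≤ D * meshSize T ^ 2)
  linarith

end IsTriangulation

lemma MemH.mem_brokenH3 {u : Plane → ℝ} (hu : MemH 3 Ω u) (hT : IsTriangulation Ω T)
    (hΩ : IsPolygonalDomain Ω) : u ∈ brokenH3 Ω T :=
  ⟨hu.1, fun _ hs => (hu.approx hΩ.isOpen hΩ.bounded hΩ.lipschitz).mono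
    (hT.interior_cell_subset hΩ hs)⟩

end

end C0IP

end

theorem mainTheorem5 (σ : ℝ) :
    ∃ α₀ : ℝ, 1 ≤ α₀ ∧ ∀ α : ℝ, α₀ ≤ α → ∀ ε : ℝ, ε < 1 →
      ∀ Ω : Set C0IP.Plane, C0IP.IsPolygonalDomain Ω →
      ∃ C : ℝ, 0 < C ∧
        ∀ T : Geometry.SimplicialComplex ℝ C0IP.Plane,
          C0IP.IsTriangulation Ω T → C0IP.ShapeRegular σ T →
        ∀ f u : C0IP.Plane → ℝ, MemLp f 2 (volume.restrict Ω) →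
          C0IP.SolvesModelProblem Ω ε f u →
          (∃ p, C0IP.IsRitz Ω T α ε u p ∧
            ∀ q, C0IP.IsRitz Ω T α ε u q → EqOn q p (closure Ω)) ∧
          ∀ p, C0IP.IsRitz Ω T α ε u p →
            C0IP.norm2h T α (u - p) ≤ C * C0IP.meshSize T * C0IP.hNorm 3 Ω u := by
  refine ⟨max 1 (4 * (9 * σ ^ 2)), le_max_left _ _, fun α hα ε hε Ω hΩ => ?_⟩
  have hα1 : 1 ≤ α := (le_max_left _ _).trans hα
  have hασ : 4 * (9 * σ ^ 2) ≤ α := (le_max_right _ _).trans hα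
  set D := Real.sqrt (60 * C0IP.IsTriangulation.interpConst σ α (1 - ε)
    (Metric.diam (closure Ω))) with hD
  -- The triangulation enters `D` nowhere, and the added `1` makes the constant strictly positive.
  refine ⟨D + 1, by positivity, fun T hT hσ f u _ hu => ?_⟩
  have huz := hu.mem.mem_brokenH3 hT hΩ
  obtain ⟨p, hp⟩ := hT.exists_isRitz hΩ hσ hα1 hασ hε ⟨u, huz⟩
  refine ⟨⟨p, hp, fun q hq => hT.isRitz_unique hΩ hσ hα1 hασ hε ⟨u, huz⟩ hp hq⟩, fun p hp => ?_⟩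
  have hm := C0IP.IsTriangulation.meshSize_nonneg (T := T)
  have hN : 0 ≤ C0IP.hNorm 3 Ω u := Real.sqrt_nonneg _
  refine (hT.norm2h_sub_le hΩ hσ hα1 hασ hε hu.mem huz hp).trans ?_
  gcongr
  exact le_add_of_nonneg_right zero_le_one
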